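/- Notation. Let $P=\{i\lambda_1+j\lambda_2 : i,j\in\mathbb Z\}$ be the co-weight lattice of the root system $A_2$, where $\lambda_1,\lambda_2$ are the fundamental co-weights; put $|i\lambda_1+j\lambda_2|=\max\{|i|,|j|\}$ and $\langle i\lambda_1+j\lambda_2,\alpha_0\rangle=i+j$. Let $\Sigma$ be the Coxeter complex of type $\tilde A_2$ (its vertex set is $P$) and $\mathcal S_0$ its fundamental sector. Let $\mathscr X$ be a triangle building (a building of type $\tilde A_2$, with its complete system of apartments) in which every edge lies in precisely $q+1$ chambers, $q<\infty$, and let $\Omega$ be its boundary, that is, the set of classes of sectors, two sectors being equivalent if they contain a common subsector. Fix a point $\omega_0\in\Omega$, a vertex $O$ of the same type as the origin of $\Sigma$, an apartment $\mathscr A_0$ containing the sector $[O,\omega_0]$ with base vertex $O$ that represents $\omega_0$, and the type-preserving isomorphism $\psi:\mathscr A_0\to\Sigma$ with $\psi([O,\omega_0])=-\mathcal S_0$. Let $\rho=\psi\circ\rho_0$, where $\rho_0$ is the retraction of $\mathscr X$ onto $\mathscr A_0$ centred at $\omega_0$. Let $\Omega_0$ be the set of all $\omega\in\Omega$ opposite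 to $\omega_0$; for $\omega\in\Omega_0$ let $[\omega,\omega_0]$ be the unique apartment containing sectors that represent $\omega$ and $\omega_0$. For a vertex $x$ put $E_x=\{\omega\in\Omega_0 : x\in[\omega,\omega_0]\}$. For $\lambda\in P$ let $\mathcal F_\lambda$ be the $\sigma$-field generated by the sets $E_x$ with $\rho(x)=\lambda$; let $\mathcal F$, $\mathcal F_{i,\infty}$ and $\mathcal F_{\infty,j}$ be the $\sigma$-fields generated by all $\mathcal F_\lambda$, by the $\mathcal F_{i\lambda_1+j'\lambda_2}$ ($j'\in\mathbb Z$), and by the $\mathcal F_{i'\lambda_1+j\lambda_2}$ ($i'\in\mathbb Z$), respectively. Let $\pi$ be the unique measure on $(\Omega_0,\mathcal F)$ with $\pi(E_x)=q^{-2\langle\rho(x),\alpha_0\rangle}$ for all vertices $x$. On $L^2(\Omega_0)=L^2(\Omega_0,\mathcal F,\pi)$ write $\mathbb E_\lambda f=\mathbb E[f\mid\mathcal F_\lambda]$ and $$L_if=\mathbb E[f\mid\mathcal F_{i,\infty}]-\mathbb E[f\mid\mathcal F_{i-1,\infty}],\qquad R_jf=\mathbb E[f\mid\mathcal F_{\infty,j}]-\mathbb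 E[f\mid\mathcal F_{\infty,j-1}],$$ $$D_{i\lambda_1+j\lambda_2}=L_iR_j,\qquad d_\lambda=\mathbb E_\lambda-\mathbb E_{\lambda-\lambda_1}-\mathbb E_{\lambda-\lambda_2}+\mathbb E_{\lambda-\lambda_1-\lambda_2}.$$ Proposition. There is an absolute constant $C>0$ (independent of the building, of $q$, and of $\lambda,\lambda',\mu,m$) such that for all $\lambda,\lambda',\mu\in P$ and all integers $m\ge1$ the operator norms on $L^2(\Omega_0)$ satisfy $$\|D_\lambda d_\mu^m D_{\lambda'}\|_{2\to2}\le C\,q^{-|\mu-\lambda|/4}\,q^{-|\mu-\lambda'|/4}\qquad\text{and}\qquad \|d_\lambda^m d_\mu^m\|_{2\to2}\le C\,q^{-|\lambda-\mu|/2}.$$ -/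

import Mathlib

open MeasureTheory
open scoped ENNReal

universe u

noncomputable section

/-! ### The Coxeter complex of type `Ã₂` -/

/-- The co-weight lattice `P` of the root system `A₂`; the pair `(i, j)` stands for
`i λ₁ + j λ₂`, where `λ₁, λ₂` are the fundamental co-weights.
So `⟨(i, j), α₁⟩ = i`, `⟨(i, j), α₂⟩ = j`, `⟨(i, j), α₀⟩ = i + j`. -/
abbrev Coweight : Type := ℤ × ℤ

namespace Coweight

/-- `|i λ₁ + j λ₂| = max (|i|, |j|)`. -/
def size (p : Coweight) : ℤ := max |p.1| |p.2|

/-- The level `⟨p, α₀⟩`. -/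
def level (p : Coweight) : ℤ := p.1 + p.2

/-- The first fundamental co-weight. -/
def fund₁ : Coweight := (1, 0)

/-- The second fundamental co-weight. -/
def fund₂ : Coweight := (0, 1)

/-- The type of a vertex of the Coxeter complex, that is, its class modulo the co-root lattice
(spanned by `α₁ = 2 λ₁ - λ₂` and `α₂ = 2 λ₂ - λ₁`): the vertices `0, λ₁, λ₂` of the fundamental
chamber have the types `0, 1, 2`. -/
def vertexType (p : Coweight) : ZMod 3 := ((p.1 - p.2 : ℤ) : ZMod 3)

/-- The reflection `x ↦ x - ⟨x, α₁⟩ α₁`. -/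
def refl₁ : Equiv.Perm Coweight :=
  Function.Involutive.toPerm (fun p => (-p.1, p.1 + p.2)) (fun p => by ext <;> simp)

/-- The reflection `x ↦ x - ⟨x, α₂⟩ α₂`. -/
def refl₂ : Equiv.Perm Coweight :=
  Function.Involutive.toPerm (fun p => (p.1 + p.2, -p.2)) (fun p => by ext <;> simp)

/-- The finite Weyl group `W₀`, generated by the two simple reflections. -/
def finiteWeyl : Subgroup (Equiv.Perm Coweight) := Subgroup.closure {refl₁, refl₂}

/-- The vertices of (the closure of) the fundamental sector `S₀`:
`⟨p, α₁⟩ ≥ 0` and `⟨p, α₂⟩ ≥ 0`. -/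
def fundSector : Set Coweight := {p | 0 ≤ p.1 ∧ 0 ≤ p.2}

/-- The vertices of the opposite sector `-S₀`. -/
def oppSector : Set Coweight := {p | p.1 ≤ 0 ∧ p.2 ≤ 0}

/-- The vertices of the sector `base + w S₀` of the Coxeter complex. -/
def sector (base : Coweight) (w : Equiv.Perm Coweight) : Set Coweight :=
  (fun p => base + w p) '' fundSector

/-- A set of vertices of the Coxeter complex is the vertex set of a chamber if it is
`v + {0, λ₁, λ₂}` or `v - {0, λ₁, λ₂}` for some `v` in `P` (the alcoves are the translates by `P`
of `C₀` and of `-C₀`). -/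
def IsChamber (c : Finset Coweight) : Prop :=
  ∃ v : Coweight, c = {v, v + fund₁, v + fund₂} ∨ c = {v, v - fund₁, v - fund₂}

/-- The Coxeter complex `Σ`: its simplexes are the non-empty sets of vertices of chambers. -/
def coxeterComplex : AbstractSimplicialComplex Coweight where
  faces := {s | s.Nonempty ∧ ∃ c, IsChamber c ∧ s ⊆ c}
  isRelLowerSet_faces := by
    rintro s ⟨hs, c, hc, hsc⟩
    exact ⟨hs, fun t hts ht => ⟨ht, c, hc, hts.trans hsc⟩⟩
  singleton_mem := fun v =>
    ⟨Finset.singleton_nonempty v, {v, v + fund₁, v + fund₂}, ⟨v, Or.inl rfl⟩, by simp⟩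

theorem fundSector_eq_sector : fundSector = sector 0 1 := by
  simp [sector]

theorem oppSector_eq_sector : oppSector = sector 0 (refl₁ * refl₂ * refl₁) := by
  have key : ∀ p : Coweight, (refl₁ * refl₂ * refl₁) p = (-p.2, -p.1) := by
    rintro ⟨c, d⟩
    change ((-((-c) + (c + d)), ((-c) + (c + d)) + -(c + d)) : Coweight) = (-d, -c)
    ext <;> simp
  ext ⟨a, b⟩
  constructor
  · rintro ⟨ha, hb⟩
    refine ⟨(-b, -a), ⟨neg_nonneg.2 hb, neg_nonneg.2 ha⟩, ?_⟩
    simp [key]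
  · rintro ⟨⟨c, d⟩, ⟨hc, hd⟩, h⟩
    simp only [key, zero_add, Prod.mk.injEq] at h
    obtain ⟨rfl, rfl⟩ := h
    exact ⟨neg_nonpos.2 hd, neg_nonpos.2 hc⟩

theorem longest_mem_finiteWeyl : refl₁ * refl₂ * refl₁ ∈ finiteWeyl :=
  have h1 : refl₁ ∈ finiteWeyl := Subgroup.subset_closure (Set.mem_insert _ _)
  have h2 : refl₂ ∈ finiteWeyl :=
    Subgroup.subset_closure (Set.mem_insert_of_mem _ (Set.mem_singleton _))
  mul_mem (mul_mem h1 h2) h1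

end Coweight

/-! ### Triangle buildings -/

/-- A type-preserving isomorphism of the Coxeter complex `Σ` onto a subcomplex of the simplicial
complex `K` with the vertex types `typ`. -/
structure ApartmentChart {V : Type u} (K : AbstractSimplicialComplex V) (typ : V → ZMod 3) where
  /-- the map on vertices -/
  toFun : Coweight → V
  injective : Function.Injective toFun
  type_eq : ∀ p, typ (toFun p) = p.vertexType
  simplicial : ∀ s ∈ Coweight.coxeterComplex, ∀ t : Finset V, (t : Set V) = toFun '' s → t ∈ K

namespace ApartmentChart

variable {V : Type u} {K : AbstractSimplicialComplex V} {typ : V → ZMod 3}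

/-- The simplexes of the apartment that is the image of the chart. -/
def simplexes (φ : ApartmentChart K typ) : Set (Finset V) :=
  {t | ∃ s ∈ Coweight.coxeterComplex, (t : Set V) = φ.toFun '' s}

/-- The vertices of the apartment that is the image of the chart. -/
def vertices (φ : ApartmentChart K typ) : Set V := Set.range φ.toFun

end ApartmentChart

/-- A (locally finite, regular) triangle building with the vertex set `V`, in which every edge lies
in precisely `q + 1` chambers. The system of apartments is the complete one: the apartments are all
subcomplexes that are type-isomorphic to `Σ`, that is, the images of the charts. -/
structure TriangleBuilding (V : Type u) (q : ℕ) where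
  /-- the simplicial complex -/
  complex : AbstractSimplicialComplex V
  /-- the type of a vertex -/
  typ : V → ZMod 3
  /-- Any two simplexes lie in a common apartment. -/
  exists_apartment : ∀ s ∈ complex, ∀ t ∈ complex,
    ∃ φ : ApartmentChart complex typ, s ∈ φ.simplexes ∧ t ∈ φ.simplexes
  /-- If two apartments have a chamber in common, then there is a type-preserving isomorphism from
  the first (the image of `φ`) onto the second (the image of `φ'`) that fixes their intersection
  pointwise. It is written as `χ ∘ φ⁻¹` with a chart `χ` of the second apartment. -/
  exists_iso : ∀ φ φ' : ApartmentChart complex typ,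
    (∃ c ∈ φ.simplexes ∩ φ'.simplexes, c.card = 3) →
    ∃ χ : ApartmentChart complex typ, χ.simplexes = φ'.simplexes ∧
      ∀ p, φ.toFun p ∈ φ'.vertices → χ.toFun p = φ.toFun p
  /-- Every edge lies in precisely `q + 1` chambers. -/
  card_chambers : ∀ e ∈ complex, e.card = 2 →
    {c : Finset V | c ∈ complex ∧ c.card = 3 ∧ e ⊆ c}.ncard = q + 1

namespace TriangleBuilding

variable {V : Type u} {q : ℕ}

/-- The charts of the apartments of the building. -/
abbrev Chart (X : TriangleBuilding V q) : Type u := ApartmentChart X.complex X.typ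

/-- The sectors of the building, given by their vertex sets: the images of the sectors of `Σ` under
the charts of the apartments. -/
def IsSector (X : TriangleBuilding V q) (S : Set V) : Prop :=
  ∃ (φ : X.Chart) (b : Coweight) (w : Equiv.Perm Coweight),
    w ∈ Coweight.finiteWeyl ∧ S = φ.toFun '' Coweight.sector b w

/-- The type of sectors of the building. -/
def Sector (X : TriangleBuilding V q) : Type u := {S : Set V // X.IsSector S}

/-- Two sectors are equivalent if they contain a common subsector. (In a building this is an
equivalence relation.) -/
def SectorEquiv (X : TriangleBuilding V q) (S T : X.Sector) : Prop :=
  ∃ R : X.Sector, R.1 ⊆ S.1 ∧ R.1 ⊆ T.1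

/-- The boundary `Ω`: the equivalence classes of sectors. -/
def Boundary (X : TriangleBuilding V q) : Type u := Quot X.SectorEquiv

variable {X : TriangleBuilding V q}

/-- The boundary point represented by the image of the upward pointing sector `S₀`. -/
def Chart.top (φ : X.Chart) : X.Boundary :=
  Quot.mk _ ⟨φ.toFun '' Coweight.fundSector,
    φ, 0, 1, one_mem _, by rw [Coweight.fundSector_eq_sector]⟩

/-- The boundary point represented by the image of the downward pointing sector `-S₀`. -/
def Chart.bottom (φ : X.Chart) : X.Boundary :=
  Quot.mk _ ⟨φ.toFun '' Coweight.oppSector,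
    φ, 0, _, Coweight.longest_mem_finiteWeyl, by rw [Coweight.oppSector_eq_sector]⟩

/-- Two boundary points are opposite if they are represented by two sectors of one apartment that
point in opposite directions. As the affine Weyl group acts on `Σ` by type-preserving automorphisms
and two sectors of `Σ` with the same direction are equivalent, the chart can be chosen such that
the sectors are the images of `S₀` and `-S₀`. -/
def Opposite (X : TriangleBuilding V q) (ω ω' : X.Boundary) : Prop :=
  ∃ φ : X.Chart, φ.top = ω ∧ φ.bottom = ω'

/-! ### The space `Ω₀` and its filtration

The data fixed once and for all are an origin `O` of type `0`, a boundary point `ω₀`, an apartment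
that contains the sector `[O, ω₀]`, and the type-preserving isomorphism `ψ` of this apartment onto
`Σ` that maps `[O, ω₀]` onto `-S₀`. They are the same as one chart, namely `φ₀ = ψ⁻¹`, and
`O = φ₀ 0`, `ω₀ = φ₀.bottom`. -/

/-- The set `Ω₀` of all boundary points opposite to `ω₀`. -/
def Omega₀ (φ₀ : X.Chart) : Type u := {ω : X.Boundary // X.Opposite ω φ₀.bottom}

/-- `RetractsTo φ₀ x p` says that `ρ x = p`, where `ρ = ψ ∘ ρ₀` and `ρ₀` is the retraction onto
the apartment `φ₀` with centre `ω₀`: there is an apartment that contains `x` and shares with `φ₀` a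
sector representing `ω₀`, and the type-preserving isomorphism onto the apartment `φ₀` that fixes
this sector pointwise maps `x` to the vertex `φ₀ p`. -/
def RetractsTo (φ₀ : X.Chart) (x : V) (p : Coweight) : Prop :=
  ∃ φ : X.Chart,
    (∃ b : Coweight, ∀ s ∈ Coweight.oppSector, φ.toFun (b + s) = φ₀.toFun (b + s)) ∧ φ.toFun p = x

/-- The set `E_x` of all `ω` in `Ω₀` such that `x` belongs to the apartment `[ω, ω₀]`, the unique
apartment that contains sectors representing `ω` and `ω₀`. -/
def E (φ₀ : X.Chart) (x : V) : Set (Omega₀ φ₀) :=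
  {ω | ∃ φ : X.Chart, φ.top = ω.1 ∧ φ.bottom = φ₀.bottom ∧ x ∈ φ.vertices}

/-- The `σ`-field `𝓕_p` generated by the sets `E_x` with `ρ x = p`. -/
@[reducible]
def filt (φ₀ : X.Chart) (p : Coweight) : MeasurableSpace (Omega₀ φ₀) :=
  MeasurableSpace.generateFrom {A | ∃ x, RetractsTo φ₀ x p ∧ A = E φ₀ x}

/-- The `σ`-field `𝓕` generated by all the `𝓕_p`. -/
@[reducible]
def filtTop (φ₀ : X.Chart) : MeasurableSpace (Omega₀ φ₀) := ⨆ p, filt φ₀ p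

instance instMeasurableSpaceOmega₀ (φ₀ : X.Chart) : MeasurableSpace (Omega₀ φ₀) := filtTop φ₀

/-- The `σ`-field `𝓕_{i, ∞}`. -/
@[reducible]
def filtL (φ₀ : X.Chart) (i : ℤ) : MeasurableSpace (Omega₀ φ₀) := ⨆ j : ℤ, filt φ₀ (i, j)

/-- The `σ`-field `𝓕_{∞, j}`. -/
@[reducible]
def filtR (φ₀ : X.Chart) (j : ℤ) : MeasurableSpace (Omega₀ φ₀) := ⨆ i : ℤ, filt φ₀ (i, j)

theorem filt_le (φ₀ : X.Chart) (p : Coweight) :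
    filt φ₀ p ≤ filtTop φ₀ := le_iSup (filt φ₀) p

theorem filtL_le (φ₀ : X.Chart) (i : ℤ) :
    filtL φ₀ i ≤ filtTop φ₀ :=
  iSup_le fun j => filt_le φ₀ (i, j)

theorem filtR_le (φ₀ : X.Chart) (j : ℤ) :
    filtR φ₀ j ≤ filtTop φ₀ :=
  iSup_le fun i => filt_le φ₀ (i, j)

/-- The property `π (E_x) = q ^ (-2 ⟨ρ x, α₀⟩)` for all `x`, which determines the measure `π`
on `(Ω₀, 𝓕)` uniquely. -/
def IsBoundaryMeasure (φ₀ : X.Chart) (π : Measure (Omega₀ φ₀)) : Prop :=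
  ∀ (x : V) (p : Coweight), RetractsTo φ₀ x p → π (E φ₀ x) = (q : ℝ≥0∞) ^ (-2 * p.level)

/-! ### The operators on `L²(Ω₀)` -/

/-- The conditional expectation with respect to the sub-`σ`-field `m`, as an operator on `L²`. -/
def condE {α : Type u} {m m0 : MeasurableSpace α} (π : Measure α) (hm : m ≤ m0) :
    Lp ℂ 2 π →L[ℂ] Lp ℂ 2 π :=
  (lpMeas ℂ ℂ m 2 π).subtypeL ∘L condExpL2 ℂ ℂ hm

variable {φ₀ : X.Chart} (π : Measure (Omega₀ φ₀))

/-- `𝔼_p f = 𝔼[f | 𝓕_p]`. -/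
def expect (p : Coweight) : Lp ℂ 2 π →L[ℂ] Lp ℂ 2 π := condE π (filt_le φ₀ p)

/-- `L_i f = 𝔼[f | 𝓕_{i, ∞}] - 𝔼[f | 𝓕_{i-1, ∞}]`. -/
def diffL (i : ℤ) : Lp ℂ 2 π →L[ℂ] Lp ℂ 2 π :=
  condE π (filtL_le φ₀ i) - condE π (filtL_le φ₀ (i - 1))

/-- `R_j f = 𝔼[f | 𝓕_{∞, j}] - 𝔼[f | 𝓕_{∞, j-1}]`. -/
def diffR (j : ℤ) : Lp ℂ 2 π →L[ℂ] Lp ℂ 2 π :=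
  condE π (filtR_le φ₀ j) - condE π (filtR_le φ₀ (j - 1))

/-- `D_p = L_i R_j` for `p = i λ₁ + j λ₂`. -/
def bigD (p : Coweight) : Lp ℂ 2 π →L[ℂ] Lp ℂ 2 π := diffL π p.1 ∘L diffR π p.2

/-- The double difference
`d_p f = f_p - f_{p - λ₁} - f_{p - λ₂} + f_{p - λ₁ - λ₂}`. -/
def smallD (p : Coweight) : Lp ℂ 2 π →L[ℂ] Lp ℂ 2 π :=
  expect π p - expect π (p - Coweight.fund₁) - expect π (p - Coweight.fund₂)
    + expect π (p - Coweight.fund₁ - Coweight.fund₂)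

end TriangleBuilding

end

/-! For `ω` in Ω₀ and `p` in `P` let `coord p ω` be the vertex of [ω, ω₀] that retracts to `p`. The
nonempty events `coord p = v` are exactly the sets `E_x` with ρ(x) = p, so 𝔼_p is the orthogonal
projection `P` onto the closed span of their indicators; `M` and `N` play the same role for 𝓕_{i,∞}
and 𝓕_{∞,j}. Intersections of apartments are convex, so a coordinate determines all smaller ones and
the σ-fields increase in both directions. The difficulty is that the projections on one line of
constant level `i + j` do not commute.

Let `Q i j` belong to the σ-field generated by the coordinates at `(i - 1, j)` and `(i, j - 1)`, and
let `U = P - Q`. Two facts come from the geometry. (1) Given the coordinate at `(i, j - 1)`, those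
at `(i - 1, j)` and `(i + 1, j - 1)` are independent: `P (i + 1) (j - 1) * Q i j = P i (j - 1)`, and
symmetrically. (2) `U i j * P (i + 1) (j - 1) * U i j = q⁻¹ U i j`, because in the link of a vertex
two points have exactly one common line; hence a step along the level line shrinks the range of `U`
by `t = q^(-1/2)`. The building gives only upper bounds for the branching numbers; the prescribed
measures of the `E_x` turn them into equalities.

Fact (1) yields a Markov property along level lines (`P_mul_P_markov`), lets `N (j - k)` act on `P i
j` as `P (i + k) (j - k)` (`N_mul_P_eq`), and carries the range of `U` into itself (`P_mul_U_step`).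
So `k` steps cost `t ^ k` (`P_mul_U_eq`). Since `N b * d i j = N b * U i j - N b * U (i - 1) j` for
`b < j`, products of `M` and `N` with `d` decay, and a comparison of the positions gives ‖D_λ d_μ‖ ≤
8 q^(-|μ-λ|/2) (`norm_diff_mul_diff_mul_d`); taking adjoints and exchanging the axes treats d_μ
D_λ'. As ‖d‖ ≤ 1 (`norm_d_le`), powers do no harm. The product D_λ d_μ^m D_λ' obeys both bounds,
hence their geometric mean, which accounts for the exponents 1/4; d_λ^m d_μ^m needs no mean and
keeps 1/2. -/

/-! ### Two-parameter families of projections in a C⋆-ring -/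

/-- A two-parameter increasing family `P` of projections with its limits `M` and `N`
along the two axes and the auxiliary projections `Q`, lying between `P (i - 1) j`, `P i (j - 1)`
and `P i j`. -/
structure ProjectionField (A : Type*) [NormedRing A] [StarRing A] (t : ℝ) where
  P : ℤ → ℤ → A
  Q : ℤ → ℤ → A
  M : ℤ → A
  N : ℤ → A
  isProj_P : ∀ i j, IsStarProjection (P i j)
  isProj_Q : ∀ i j, IsStarProjection (Q i j)
  isProj_M : ∀ i, IsStarProjection (M i)
  isProj_N : ∀ j, IsStarProjection (N j)
  P_mul_of_le : ∀ {i i' j j'}, i ≤ i' → j ≤ j' → P i j * P i' j' = P i j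
  M_mul_P : ∀ {i i' j}, i ≤ i' → M i' * P i j = P i j
  N_mul_P : ∀ {i j j'}, j ≤ j' → N j' * P i j = P i j
  -- This and the next field replace strong convergence `P i j → M i` and `P i j → N j`: only
  -- products that become stationary are ever passed to the limit.
  M_mul_eq : ∀ {i j₀ T S}, (∀ j, j₀ ≤ j → P i j * T = S) → M i * T = S
  N_mul_eq : ∀ {j i₀ T S}, (∀ i, i₀ ≤ i → P i j * T = S) → N j * T = S
  Q_mul_P : ∀ i j, Q i j * P i j = Q i j
  -- Conditional independence of the coordinates at `(i - 1, j)` and `(i + 1, j - 1)` given the one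
  -- at `(i, j - 1)`; the next field is its mirror image.
  P_right_mul_Q : ∀ i j, P (i + 1) (j - 1) * Q i j = P i (j - 1)
  P_left_mul_Q : ∀ i j, P (i - 1) (j + 1) * Q i j = P (i - 1) j
  norm_le : ∀ i j, ‖(P (i + 1) (j - 1) - Q (i + 1) (j - 1)) * (P i j - Q i j)‖ ≤ t

namespace ProjectionField

/-! ### Algebraic consequences: Markov property along lines of constant level. -/

section Ring

variable {A : Type*} [NormedRing A] [StarRing A] {t : ℝ}

/-- The difference of `P` and `Q`. -/
def U (S : ProjectionField A t) (i j : ℤ) : A := S.P i j - S.Q i j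

/-- The double difference of `P`. -/
def d (S : ProjectionField A t) (i j : ℤ) : A :=
  S.P i j - S.P (i - 1) j - S.P i (j - 1) + S.P (i - 1) (j - 1)

variable (S : ProjectionField A t)

theorem star_P (i j : ℤ) : star (S.P i j) = S.P i j := (S.isProj_P i j).isSelfAdjoint

theorem star_Q (i j : ℤ) : star (S.Q i j) = S.Q i j := (S.isProj_Q i j).isSelfAdjoint

theorem star_M (i : ℤ) : star (S.M i) = S.M i := (S.isProj_M i).isSelfAdjoint

theorem star_N (i : ℤ) : star (S.N i) = S.N i := (S.isProj_N i).isSelfAdjoint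

theorem star_U (i j : ℤ) : star (S.U i j) = S.U i j := by
  simp [U, star_P, star_Q]

theorem star_d (i j : ℤ) : star (S.d i j) = S.d i j := by
  simp [d, star_P]

theorem P_mul_of_ge {i i' j j' : ℤ} (hi : i ≤ i') (hj : j ≤ j') :
    S.P i' j' * S.P i j = S.P i j := by
  have h := congrArg star (S.P_mul_of_le hi hj)
  simpa [star_P] using h

theorem P_mul_Q (i j : ℤ) : S.P i j * S.Q i j = S.Q i j := by
  have h := congrArg star (S.Q_mul_P i j)
  simpa [star_P, star_Q] using h

theorem Q_mul_P_right (i j : ℤ) : S.Q i j * S.P i (j - 1) = S.P i (j - 1) := by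
  have h := congrArg star (S.P_right_mul_Q i j)
  simp only [star_mul, star_P, star_Q] at h
  conv_lhs => rw [← S.P_mul_of_ge (show i ≤ i + 1 by lia) le_rfl, ← mul_assoc, h]
  exact S.P_mul_of_le le_rfl le_rfl

theorem U_mul_U (i j : ℤ) : S.U i j * S.U i j = S.U i j := by
  simp only [U, mul_sub, sub_mul, S.Q_mul_P, S.P_mul_Q, (S.isProj_P i j).isIdempotentElem.eq,
    (S.isProj_Q i j).isIdempotentElem.eq]
  abel

theorem isProj_U (i j : ℤ) : IsStarProjection (S.U i j) :=
  ⟨S.U_mul_U i j, S.star_U i j⟩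

theorem P_mul_U (i j : ℤ) : S.P i j * S.U i j = S.U i j := by
  simp only [U, mul_sub, S.P_mul_Q, (S.isProj_P i j).isIdempotentElem.eq]

theorem P_mul_d (i j : ℤ) : S.P i j * S.d i j = S.d i j := by
  simp only [d, mul_sub, mul_add]
  rw [S.P_mul_of_ge le_rfl le_rfl, S.P_mul_of_ge (by lia) le_rfl, S.P_mul_of_ge le_rfl (by lia),
    S.P_mul_of_ge (by lia) (by lia)]

theorem N_mul_d {i j b : ℤ} (h : j ≤ b) : S.N b * S.d i j = S.d i j := by
  rw [← S.P_mul_d, ← mul_assoc, S.N_mul_P h]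

/-- The field with its two axes exchanged. -/
def swap [NormedStarGroup A] : ProjectionField A t where
  P i j := S.P j i
  Q i j := S.Q j i
  M := S.N
  N := S.M
  isProj_P i j := S.isProj_P j i
  isProj_Q i j := S.isProj_Q j i
  isProj_M := S.isProj_N
  isProj_N := S.isProj_M
  P_mul_of_le h h' := S.P_mul_of_le h' h
  M_mul_P h := S.N_mul_P h
  N_mul_P h := S.M_mul_P h
  M_mul_eq h := S.N_mul_eq h
  N_mul_eq h := S.M_mul_eq h
  Q_mul_P i j := S.Q_mul_P j i
  P_right_mul_Q i j := S.P_left_mul_Q j i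
  P_left_mul_Q i j := S.P_right_mul_Q j i
  norm_le i j := by
    have h := S.norm_le (j - 1) (i + 1)
    rw [← norm_star] at h
    simpa [star_P, star_Q] using h

/-- Once `(i', j)` has reached the level of `(i, j + k)`, going further right in row `j` reveals
nothing more about functions measurable at `(i, j + k)`. The induction passes through row `j + 1`.
-/
theorem P_succ_mul_P (k : ℕ) : ∀ i i' j : ℤ, i + k ≤ i' →
    S.P (i' + 1) j * S.P i (j + k) = S.P i' j * S.P i (j + k) := by
  -- `Q a b` dominates `P (a - 1) b`, so it may be inserted between the two factors; `P_right_mul_Q`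
  -- then lowers the left one.
  have base (a b : ℤ) : S.P (a + 1) (b - 1) * S.P (a - 1) b = S.P a (b - 1) * S.P (a - 1) b := by
    have h : S.Q a b * S.P (a - 1) b = S.P (a - 1) b := by
      have h := congrArg star (S.P_left_mul_Q a b)
      simp only [star_mul, star_P, star_Q] at h
      conv_lhs => rw [← S.P_mul_of_ge le_rfl (show b ≤ b + 1 by lia), ← mul_assoc, h]
      exact S.P_mul_of_le le_rfl le_rfl
    conv_lhs => rw [← h, ← mul_assoc, S.P_right_mul_Q]
  induction k with
  | zero =>
    intro i i' j h
    simp only [Nat.cast_zero, add_zero] at h ⊢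
    rw [S.P_mul_of_ge (by lia) le_rfl, S.P_mul_of_ge h le_rfl]
  | succ k ih =>
    intro i i' j h
    push_cast at h ⊢
    have e : j + (k + 1 : ℤ) = (j + 1) + k := by ring
    rw [e]
    set T := S.P i (j + 1 + k)
    have h1 : S.P (i' + 1) (j + 1) * T = S.P i' (j + 1) * T := ih i i' (j + 1) (by lia)
    have h2 : S.P i' (j + 1) * T = S.P (i' - 1) (j + 1) * T := by
      simpa using ih i (i' - 1) (j + 1) (by lia)
    have b := base i' (j + 1)
    simp only [add_sub_cancel_right] at b
    calc S.P (i' + 1) j * T = S.P (i' + 1) j * (S.P (i' + 1) (j + 1) * T) := by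
          rw [← mul_assoc, S.P_mul_of_le le_rfl (by lia)]
      _ = S.P i' j * (S.P i' (j + 1) * T) := by
          rw [h1, h2, ← mul_assoc, b, mul_assoc]
      _ = S.P i' j * T := by
          rw [← mul_assoc, S.P_mul_of_le le_rfl (by lia)]

theorem P_mul_P_eq {i j i' j' i'' : ℤ} (hj : j' ≤ j) (h : i + j ≤ i' + j') (hi : i' ≤ i'') :
    S.P i'' j' * S.P i j = S.P i' j' * S.P i j := by
  induction i'', hi using Int.leInduction with
  | base => rfl
  | succ n hn ih =>
    obtain ⟨k, rfl⟩ : ∃ k : ℕ, j = j' + k := ⟨(j - j').toNat, by lia⟩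
    rw [S.P_succ_mul_P k i n j' (by lia), ih]

/-- By `P_mul_P_eq` the products along row `j'` are constant from `(i', j')` on, so the limit is
already attained there. -/
theorem N_mul_P_eq {i j i' j' : ℤ} (hj : j' ≤ j) (h : i + j ≤ i' + j') :
    S.N j' * S.P i j = S.P i' j' * S.P i j :=
  S.N_mul_eq fun _ h' => S.P_mul_P_eq hj h h'

/-- On a line of constant level the middle point separates the outer two: `P i₂ j₂` may be moved to
`P i₃ j₂`, which dominates `P i₃ j₃`. -/
theorem P_mul_P_markov {i₁ j₁ i₂ j₂ i₃ j₃ : ℤ} (h₁₂ : i₁ ≤ i₂) (h₂₃ : i₂ ≤ i₃)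
    (e₁₂ : i₁ + j₁ = i₂ + j₂) (e₂₃ : i₂ + j₂ = i₃ + j₃) :
    S.P i₃ j₃ * S.P i₁ j₁ = S.P i₃ j₃ * (S.P i₂ j₂ * S.P i₁ j₁) := by
  rw [← S.P_mul_P_eq (show j₂ ≤ j₁ by lia) e₁₂.le h₂₃, ← mul_assoc,
    S.P_mul_of_le le_rfl (by lia)]

theorem P_mul_P_markov' {i₁ j₁ i₂ j₂ i₃ j₃ : ℤ} (h₁₂ : i₁ ≤ i₂) (h₂₃ : i₂ ≤ i₃)
    (e₁₂ : i₁ + j₁ = i₂ + j₂) (e₂₃ : i₂ + j₂ = i₃ + j₃) :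
    S.P i₁ j₁ * S.P i₃ j₃ = S.P i₁ j₁ * (S.P i₂ j₂ * S.P i₃ j₃) := by
  have h := congrArg star (S.P_mul_P_markov h₁₂ h₂₃ e₁₂ e₂₃)
  simpa [star_P, mul_assoc] using h

/-- Both `P i j` and `Q i j` become `P i (j - 1)` under `Q (i + 1) (j - 1)`, so the latter
annihilates `U i j`. -/
theorem P_mul_U_step (i j : ℤ) :
    S.P (i + 1) (j - 1) * S.U i j = S.U (i + 1) (j - 1) * S.U i j := by
  have h : S.Q (i + 1) (j - 1) * S.U i j = 0 := by
    have h1 := congrArg star (S.P_left_mul_Q (i + 1) (j - 1))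
    simp only [star_mul, star_P, star_Q, add_sub_cancel_right, sub_add_cancel] at h1
    have h2 := congrArg star (S.Q_mul_P_right i j)
    simp only [star_mul, star_P, star_Q] at h2
    rw [U, mul_sub, h1, ← S.P_mul_Q i j, ← mul_assoc, h1, h2, sub_self]
  conv_rhs => rw [U, sub_mul, h, sub_zero]

/-- Of the pair of coordinates behind `Q i j`, rows below `j` only see the one at `(i, j - 1)`. This
is what turns the double difference `d` into two terms `U`. -/
theorem N_mul_Q {i j b : ℤ} (h : b ≤ j - 1) : S.N b * S.Q i j = S.N b * S.P i (j - 1) := by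
  -- The bound `i + 1` lets `P_right_mul_Q` apply; `i + (j - 1) - b` is where row `b` reaches the
  -- level of `(i, j - 1)`.
  refine S.N_mul_eq (i₀ := max (i + 1) (i + (j - 1) - b)) fun i' hi' => ?_
  have h1 : S.P i' (j - 1) * S.Q i j = S.P i (j - 1) := by
    rw [← S.P_mul_Q, ← mul_assoc, S.P_mul_P_eq (i' := i + 1) (by lia) (by lia) (by lia),
      mul_assoc, S.P_mul_Q, S.P_right_mul_Q]
  rw [← S.P_mul_of_le le_rfl h, mul_assoc, h1, S.N_mul_P_eq h (i' := i') (by lia)]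

theorem N_mul_d_of_lt {i j b : ℤ} (h : b < j) :
    S.N b * S.d i j = S.N b * S.U i j - S.N b * S.U (i - 1) j := by
  have h1 := S.N_mul_Q (i := i) (show b ≤ j - 1 by lia)
  have h2 := S.N_mul_Q (i := i - 1) (show b ≤ j - 1 by lia)
  simp only [d, U, mul_sub, mul_add, h1, h2]
  abel

theorem N_mul_U (i : ℤ) {j i' j' : ℤ} (hj : j' ≤ j) (h : i + j ≤ i' + j') :
    S.N j' * S.U i j = S.P i' j' * S.U i j := by
  rw [← S.P_mul_U, ← mul_assoc, S.N_mul_P_eq hj h, mul_assoc]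

/-- On `d i j` the factor `N (j - k)` acts as `P (i + k) (j - k)`, whose range lies in that of `M
a`. -/
theorem M_mul_N_mul_d {i j k : ℤ} (hk : 0 ≤ k) {a : ℤ} (ha : i + k ≤ a) :
    S.M a * (S.N (j - k) * S.d i j) = S.N (j - k) * S.d i j := by
  rw [← S.P_mul_d, ← mul_assoc (S.N _), S.N_mul_P_eq (i' := i + k) (by lia) (by lia), mul_assoc,
    ← mul_assoc (S.M a), S.M_mul_P ha]

end Ring

/-! ### Norm estimates for products of the projections with `d`. -/

section CStar

variable {A : Type*} [NormedRing A] [StarRing A] [CStarRing A] {t : ℝ} (S : ProjectionField A t)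

/-- The Markov property inserts all intermediate points of the level line, and `P_mul_U_step`
replaces each `P` by `U`; each of the `k` steps contributes a factor `t`. -/
theorem P_mul_U_eq (k : ℕ) (i j : ℤ) :
    S.P (i + k) (j - k) * S.U i j = S.U (i + k) (j - k) * (S.P (i + k) (j - k) * S.U i j) ∧
      ‖S.P (i + k) (j - k) * S.U i j‖ ≤ t ^ k := by
  induction k with
  | zero => simp [P_mul_U, U_mul_U, (S.isProj_U i j).norm_le]
  | succ k ih =>
    obtain ⟨ih, ihn⟩ := ih
    have e1 : i + (k + 1 : ℕ) = i + k + 1 := by push_cast; ring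
    have e2 : j - (k + 1 : ℕ) = j - k - 1 := by push_cast; ring
    have key : S.P (i + (k + 1 : ℕ)) (j - (k + 1 : ℕ)) * S.U i j =
        S.U (i + k + 1) (j - k - 1) * S.U (i + k) (j - k) *
          (S.P (i + k) (j - k) * S.U i j) := by
      rw [← S.P_mul_U_step, mul_assoc, ← ih]
      conv_lhs => rw [← S.P_mul_U, ← mul_assoc,
        S.P_mul_P_markov (i₂ := i + k) (j₂ := j - k) (by lia) (by lia) (by lia) (by lia),
        mul_assoc, mul_assoc, S.P_mul_U, e1, e2]
    constructor
    · rw [key, e1, e2]; simp only [← mul_assoc, S.U_mul_U]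
    · rw [key, pow_succ']
      have h := S.norm_le (i + k) (j - k)
      exact (norm_mul_le _ _).trans (mul_le_mul h ihn (norm_nonneg _) ((norm_nonneg _).trans h))

/-- The product walks along the level line: `k` steps right because of `N (j - k)`, then `k` steps
back and `l` further left because of `M (i - l)`, always inside the ranges of the `U`. -/
theorem norm_M_mul_N_mul_U (ht : 0 ≤ t) (k l : ℕ) (i j : ℤ) :
    ‖S.M (i - l) * (S.N (j - k) * S.U i j)‖ ≤ t ^ (l + 2 * k) := by
  have h1 : S.N (j - k) * S.U i j = S.P (i + k) (j - k) * S.U i j :=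
    S.N_mul_U i (by lia) (by lia)
  have h2 : S.M (i - l) * S.P (i + k) (j - k) =
      S.P (i - l) (j + l) * (S.P i j * S.P (i + k) (j - k)) := by
    rw [← S.P_mul_P_markov' (by lia) (by lia) (by lia) (by lia)]
    exact S.swap.N_mul_P_eq (j := i + k) (j' := i - l) (by lia) (by lia)
  have h3 := S.P_mul_U_eq k i j
  have h4 := S.swap.P_mul_U_eq l j i
  have h5 := S.swap.P_mul_U_eq k (j - k) (i + k)
  simp only [add_sub_cancel_right, sub_add_cancel] at h5
  change S.P (i - l) (j + l) * S.U i j = _ ∧ ‖S.P (i - l) (j + l) * S.U i j‖ ≤ _ at h4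
  change S.P i j * S.U (i + k) (j - k) = S.U i j * (S.P i j * S.U (i + k) (j - k)) ∧
    ‖S.P i j * S.U (i + k) (j - k)‖ ≤ _ at h5
  have key : S.M (i - l) * (S.N (j - k) * S.U i j) = (S.P (i - l) (j + l) * S.U i j) *
      ((S.P i j * S.U (i + k) (j - k)) * (S.P (i + k) (j - k) * S.U i j)) := by
    calc _ = S.P (i - l) (j + l) * (S.P i j * (S.P (i + k) (j - k) * S.U i j)) := by
          rw [h1, ← mul_assoc, h2]; simp only [mul_assoc]
      _ = S.P (i - l) (j + l) * (S.P i j * (S.U (i + k) (j - k) *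
            (S.P (i + k) (j - k) * S.U i j))) := by rw [← h3.1]
      _ = S.P (i - l) (j + l) * (S.U i j * (S.P i j * S.U (i + k) (j - k)) *
            (S.P (i + k) (j - k) * S.U i j)) := by rw [← h5.1]; simp only [mul_assoc]
      _ = _ := by simp only [mul_assoc]
  rw [key, show l + 2 * k = l + (k + k) by ring, pow_add, pow_add]
  refine (norm_mul_le _ _).trans (mul_le_mul h4.2 ((norm_mul_le _ _).trans
    (mul_le_mul h5.2 h3.2 (norm_nonneg _) (by positivity))) (norm_nonneg _) (by positivity))

theorem norm_N_mul_d {k : ℕ} (hk : 1 ≤ k) (i j : ℤ) :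
    ‖S.N (j - k) * S.d i j‖ ≤ 2 * t ^ k := by
  have h (i : ℤ) : ‖S.N (j - k) * S.U i j‖ ≤ t ^ k := by
    rw [S.N_mul_U i (i' := i + k) (by lia) (by lia)]
    exact (S.P_mul_U_eq k i j).2
  rw [S.N_mul_d_of_lt (by lia), two_mul]
  exact (norm_sub_le _ _).trans (add_le_add (h _) (h _))

theorem swap_d (i j : ℤ) : S.swap.d i j = S.d j i := by
  change S.P j i - S.P j (i - 1) - S.P (j - 1) i + S.P (j - 1) (i - 1) = _
  rw [d]; abel

/-- For `k = 0` the factor `N j` acts trivially and the one-sided estimate with exchanged axes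
suffices; otherwise `d` splits into two terms `U`. -/
theorem norm_M_mul_N_mul_d (ht : 0 ≤ t) (ht1 : t ≤ 1) (k : ℕ) {l : ℕ} (hl : 1 ≤ l) (i j : ℤ) :
    ‖S.M (i - l) * (S.N (j - k) * S.d i j)‖ ≤ 2 * t ^ l := by
  rcases Nat.eq_zero_or_pos k with rfl | hk
  · have h := S.swap.norm_N_mul_d hl j i
    rw [swap_d] at h
    change ‖S.M (i - l) * S.d i j‖ ≤ _ at h
    simpa [S.N_mul_d le_rfl] using h
  · obtain ⟨l, rfl⟩ : ∃ n, l = n + 1 := ⟨l - 1, by lia⟩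
    have h1 := S.norm_M_mul_N_mul_U ht k (l + 1) i j
    -- Seen from `(i - 1, j)` one step to the left is missing; the factor `t ^ (2 * k)` with `k ≥ 1`
    -- makes up for it.
    have h2 := S.norm_M_mul_N_mul_U ht k l (i - 1) j
    have e : i - 1 - (l : ℤ) = i - (l + 1 : ℕ) := by push_cast; ring
    rw [e] at h2
    rw [S.N_mul_d_of_lt (by lia), mul_sub, two_mul]
    refine (norm_sub_le _ _).trans (add_le_add (h1.trans ?_) (h2.trans ?_)) <;>
      exact pow_le_pow_of_le_one ht ht1 (by lia)

/-- `d` is the mean of two operators `(P i j - R) - (R - P (i - 1) (j - 1))` with `R` one of the two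
intermediate projections. Each is a difference of orthogonal projections, so its square is the
projection `P i j - P (i - 1) (j - 1)`. -/
theorem norm_d_le [NormedSpace ℝ A] (i j : ℤ) : ‖S.d i j‖ ≤ 1 := by
  have aux (a b : ℤ) (ha : i - 1 ≤ a) (hb : j - 1 ≤ b) (ha' : a ≤ i) (hb' : b ≤ j) :
      ‖S.P i j - S.P a b - S.P a b + S.P (i - 1) (j - 1)‖ ≤ 1 := by
    set T := S.P i j - S.P a b - S.P a b + S.P (i - 1) (j - 1)
    have h1 : star T * T = S.P i j - S.P (i - 1) (j - 1) := by
      simp only [T, star_add, star_sub, star_P, mul_add, mul_sub, add_mul, sub_mul,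
        S.P_mul_of_le ha' hb', S.P_mul_of_ge ha' hb', S.P_mul_of_le ha hb, S.P_mul_of_ge ha hb,
        S.P_mul_of_le (ha.trans ha') (hb.trans hb'), S.P_mul_of_ge (ha.trans ha') (hb.trans hb'),
        S.P_mul_of_le le_rfl le_rfl]
      abel
    have h2 : IsStarProjection (star T * T) := by
      rw [h1]
      refine ⟨?_, by simp [IsSelfAdjoint, star_P]⟩
      simp only [IsIdempotentElem, mul_sub, sub_mul, S.P_mul_of_le le_rfl le_rfl,
        S.P_mul_of_le (ha.trans ha') (hb.trans hb'), S.P_mul_of_ge (ha.trans ha') (hb.trans hb')]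
      abel
    have h3 := h2.norm_le
    rw [CStarRing.norm_star_mul_self] at h3
    nlinarith [norm_nonneg T]
  have h1 := aux (i - 1) j le_rfl (by lia) (by lia) le_rfl
  have h2 := aux i (j - 1) (by lia) le_rfl le_rfl (by lia)
  have h3 : (2 : ℝ) • S.d i j =
      (S.P i j - S.P (i - 1) j - S.P (i - 1) j + S.P (i - 1) (j - 1)) +
      (S.P i j - S.P i (j - 1) - S.P i (j - 1) + S.P (i - 1) (j - 1)) := by
    rw [two_smul, d]; abel
  have h4 := norm_add_le_of_le h1 h2
  rw [← h3, norm_smul, Real.norm_eq_abs, abs_two] at h4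
  linarith

theorem norm_sub_proj_le {p r : A} (hp : IsStarProjection p) (hr : IsStarProjection r) (x : A) :
    ‖(p - r) * x‖ ≤ 2 * ‖x‖ :=
  (norm_mul_le _ _).trans (mul_le_mul_of_nonneg_right
    ((norm_sub_le _ _).trans (by linarith [hp.norm_le, hr.norm_le])) (norm_nonneg _))

/-- With `b = j - k` there are three ranges of `a`: right of `i + k` nearly everything cancels, left
of `i - k` the decay comes from `M`, and in between from `N`. -/
theorem norm_diff_mul_diff_mul_d [NormedSpace ℝ A] (ht : 0 ≤ t) (ht1 : t ≤ 1) (a b i j : ℤ) :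
    ‖(S.M a - S.M (a - 1)) * ((S.N b - S.N (b - 1)) * S.d i j)‖ ≤
      8 * t ^ (max |i - a| |j - b|).toNat := by
  rcases lt_or_ge j b with hb | hb
  · rw [sub_mul (S.N b), S.N_mul_d hb.le, S.N_mul_d (by lia), sub_self, mul_zero, norm_zero]
    positivity
  obtain ⟨k, rfl⟩ : ∃ k : ℕ, b = j - k := ⟨(j - b).toNat, by lia⟩
  have ek : j - (k : ℤ) - 1 = j - (k + 1 : ℕ) := by push_cast; ring
  have hN1 : ‖S.N (j - k - 1) * S.d i j‖ ≤ 2 * t ^ (k + 1) := by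
    rw [ek]; exact S.norm_N_mul_d (by lia) i j
  have hM := norm_sub_proj_le (S.isProj_M a) (S.isProj_M (a - 1))
  rcases lt_or_ge (i + k) a with ha | ha
  · have h0 : (S.M a - S.M (a - 1)) * (S.N (j - k) * S.d i j) = 0 := by
      rw [sub_mul, S.M_mul_N_mul_d (by lia) (by lia), S.M_mul_N_mul_d (by lia) (by lia), sub_self]
    rw [sub_mul (S.N _), mul_sub, h0, zero_sub, norm_neg]
    -- Only the term with `N (j - k - 1)` survives. It is fixed by `M (i + k + 1)` but not
    -- necessarily by `M (i + k)`, so the boundary value of `a` needs an estimate.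
    rcases eq_or_lt_of_le (show i + k + 1 ≤ a by lia) with rfl | ha'
    · have e : (max |i - (i + k + 1)| |j - (j - k)|).toNat = k + 1 := by
        rw [abs_of_nonpos (by lia), abs_of_nonneg (by lia)]; lia
      rw [e]
      have := hM (S.N (j - k - 1) * S.d i j)
      linarith [pow_nonneg ht (k + 1)]
    · rw [ek, sub_mul, S.M_mul_N_mul_d (by lia) (by push_cast; lia),
        S.M_mul_N_mul_d (by lia) (by push_cast; lia), sub_self, norm_zero]
      positivity
  rcases lt_or_ge a (i - k) with ha' | ha'
  · obtain ⟨l, rfl⟩ : ∃ l : ℕ, a = i - l := ⟨(i - a).toNat, by lia⟩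
    have e : (max |i - (i - l : ℤ)| |j - (j - k)|).toNat = l := by
      rw [abs_of_nonneg (by lia), abs_of_nonneg (by lia)]; lia
    have el : i - (l : ℤ) - 1 = i - (l + 1 : ℕ) := by push_cast; ring
    have hl : t ^ (l + 1) ≤ t ^ l := pow_le_pow_of_le_one ht ht1 (by lia)
    rw [e, el, ek]
    have h1 := S.norm_M_mul_N_mul_d ht ht1 k (l := l) (by lia) i j
    have h2 := S.norm_M_mul_N_mul_d ht ht1 (k + 1) (l := l) (by lia) i j
    have h3 := S.norm_M_mul_N_mul_d ht ht1 k (l := l + 1) (by lia) i j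
    have h4 := S.norm_M_mul_N_mul_d ht ht1 (k + 1) (l := l + 1) (by lia) i j
    -- Four terms, each at most `2 * t ^ l`, give the constant 8.
    rw [sub_mul (S.N _), sub_mul, mul_sub, mul_sub]
    refine (norm_sub_le _ _).trans ?_
    linarith [norm_sub_le (S.M (i - l) * (S.N (j - k) * S.d i j))
      (S.M (i - l) * (S.N (j - (k + 1 : ℕ)) * S.d i j)),
      norm_sub_le (S.M (i - (l + 1 : ℕ)) * (S.N (j - k) * S.d i j))
      (S.M (i - (l + 1 : ℕ)) * (S.N (j - (k + 1 : ℕ)) * S.d i j))]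
  · have e : (max |i - a| |j - (j - k)|).toNat = k := by
      have : |i - a| ≤ k := abs_le.2 ⟨by lia, by lia⟩
      rw [abs_of_nonneg (show 0 ≤ j - (j - (k : ℤ)) by lia)]; lia
    rw [e]
    refine (hM _).trans ?_
    rcases Nat.eq_zero_or_pos k with rfl | hk
    · have h1 := norm_sub_proj_le (S.isProj_N (j - (0 : ℕ))) (S.isProj_N (j - (0 : ℕ) - 1))
        (S.d i j)
      have h2 := S.norm_d_le i j
      rw [pow_zero]
      linarith
    · have h1 := S.norm_N_mul_d hk i j
      have h2 : t ^ (k + 1) ≤ t ^ k := pow_le_pow_of_le_one ht ht1 (by lia)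
      rw [sub_mul]
      linarith [norm_sub_le (S.N (j - k) * S.d i j) (S.N (j - k - 1) * S.d i j)]

/-- The adjoint reverses the order of the two differences, which the exchange of axes restores. -/
theorem norm_d_mul_diff_mul_diff [NormedSpace ℝ A] (ht : 0 ≤ t) (ht1 : t ≤ 1) (a b i j : ℤ) :
    ‖S.d i j * ((S.M a - S.M (a - 1)) * (S.N b - S.N (b - 1)))‖ ≤
      8 * t ^ (max |i - a| |j - b|).toNat := by
  have h := S.swap.norm_diff_mul_diff_mul_d ht ht1 b a j i
  rw [swap_d, ← norm_star, max_comm] at h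
  change ‖star ((S.N b - S.N (b - 1)) * ((S.M a - S.M (a - 1)) * S.d i j))‖ ≤ _ at h
  simpa [star_d, star_M, star_N, mul_assoc] using h

/-- The factor with the smaller second index absorbs `N` at that index, and `N` times the other `d`
is already small. Adjoints and exchange of axes cover the remaining positions. -/
theorem norm_d_mul_d [NormedSpace ℝ A] (ht : 0 ≤ t) (a b i j : ℤ) :
    ‖S.d a b * S.d i j‖ ≤ 8 * t ^ (max |a - i| |b - j|).toNat := by
  have step (S : ProjectionField A t) (a i j : ℤ) (k : ℕ) :
      ‖S.d a (j - k) * S.d i j‖ ≤ 8 * t ^ k := by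
    rcases Nat.eq_zero_or_pos k with rfl | hk
    · have h := norm_mul_le (S.d a (j - (0 : ℕ))) (S.d i j)
      have h1 := S.norm_d_le a (j - (0 : ℕ))
      have h2 := S.norm_d_le i j
      rw [pow_zero]
      nlinarith [norm_nonneg (S.d i j)]
    · have h1 : S.d a (j - k) * S.N (j - k) = S.d a (j - k) := by
        have h := congrArg star (S.N_mul_d (i := a) (le_refl (j - (k : ℤ))))
        simpa [star_d, star_N] using h
      rw [← h1, mul_assoc]
      have h2 := S.norm_N_mul_d hk i j
      have h3 := norm_mul_le (S.d a (j - k)) (S.N (j - k) * S.d i j)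
      have h4 := S.norm_d_le a (j - k)
      nlinarith [norm_nonneg (S.N (j - k) * S.d i j), pow_nonneg ht k]
  have step2 (S : ProjectionField A t) (a b i j : ℤ) :
      ‖S.d a b * S.d i j‖ ≤ 8 * t ^ (b - j).natAbs := by
    rcases le_total b j with h | h
    · obtain ⟨k, rfl⟩ : ∃ k : ℕ, b = j - k := ⟨(j - b).toNat, by lia⟩
      rw [show (j - (k : ℤ) - j).natAbs = k by lia]
      exact step S a i j k
    · obtain ⟨k, rfl⟩ : ∃ k : ℕ, j = b - k := ⟨(b - j).toNat, by lia⟩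
      rw [show (b - (b - (k : ℤ))).natAbs = k by lia, ← norm_star, star_mul, star_d, star_d]
      exact step S i a b k
  rcases le_total |a - i| |b - j| with h | h
  · rw [max_eq_right h, Int.abs_eq_natAbs (b - j), Int.toNat_natCast]
    exact step2 S a b i j
  · rw [max_eq_left h, Int.abs_eq_natAbs (a - i), Int.toNat_natCast]
    have := step2 S.swap b a j i
    rwa [swap_d, swap_d] at this

end CStar

end ProjectionField

/-! ### Projections onto closed spans -/

noncomputable section

section SpanProj

variable {H : Type*} [NormedAddCommGroup H] [InnerProductSpace ℂ H] [CompleteSpace H]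

/-- The orthogonal projection onto the closed span of a set of vectors. -/
def spanProj (G : Set H) : H →L[ℂ] H := (Submodule.span ℂ G).topologicalClosure.starProjection

theorem isStarProjection_spanProj (G : Set H) : IsStarProjection (spanProj G) :=
  isStarProjection_starProjection

theorem subset_closedSpan (G : Set H) {g : H} (hg : g ∈ G) :
    g ∈ (Submodule.span ℂ G).topologicalClosure :=
  Submodule.le_topologicalClosure _ (Submodule.subset_span hg)

theorem spanProj_eq_self {G : Set H} {v : H} :
    spanProj G v = v ↔ v ∈ (Submodule.span ℂ G).topologicalClosure :=
  Submodule.starProjection_eq_self_iff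

theorem mem_orthogonal_closedSpan {G : Set H} {v : H} (h : ∀ g ∈ G, inner ℂ g v = 0) :
    v ∈ (Submodule.span ℂ G).topologicalClosureᗮ := by
  rw [Submodule.orthogonal_closure, Submodule.mem_orthogonal]
  intro u hu
  induction hu using Submodule.span_induction with
  | mem x hx => exact h x hx
  | zero => simp
  | add x y _ _ hx hy => rw [inner_add_left, hx, hy, add_zero]
  | smul c x _ hx => rw [inner_smul_left, hx, mul_zero]

theorem spanProj_eq {G : Set H} {v w : H} (hw : w ∈ (Submodule.span ℂ G).topologicalClosure)
    (h : ∀ g ∈ G, inner ℂ g v = inner ℂ g w) : spanProj G v = w :=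
  Submodule.eq_starProjection_of_mem_orthogonal hw
    (mem_orthogonal_closedSpan fun g hg => by rw [inner_sub_right, h g hg, sub_self])

theorem mul_spanProj_ext {T T' : H →L[ℂ] H} {G : Set H} (h : ∀ g ∈ G, T g = T' g) :
    T * spanProj G = T' * spanProj G := by
  ext v
  have h1 : spanProj G v ∈ (Submodule.span ℂ G).topologicalClosure :=
    Submodule.starProjection_apply_mem _ _
  have h2 : (Submodule.span ℂ G).topologicalClosure ≤ LinearMap.eqLocus (T : H →ₗ[ℂ] H) T' := by
    refine Submodule.topologicalClosure_minimal _ (Submodule.span_le.2 h) ?_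
    exact isClosed_eq T.continuous T'.continuous
  exact h2 h1

theorem spanProj_mul_eq_right {G G' : Set H}
    (h : ∀ g ∈ G', g ∈ (Submodule.span ℂ G).topologicalClosure) :
    spanProj G * spanProj G' = spanProj G' := by
  have := mul_spanProj_ext (T := spanProj G) (T' := 1) (G := G') fun g hg =>
    spanProj_eq_self.2 (h g hg)
  rwa [one_mul] at this

theorem spanProj_mul_eq_left {G G' : Set H}
    (h : ∀ g ∈ G, g ∈ (Submodule.span ℂ G').topologicalClosure) :
    spanProj G * spanProj G' = spanProj G := by
  have := congrArg star (spanProj_mul_eq_right h)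
  simpa [(isStarProjection_spanProj _).isSelfAdjoint.star_eq] using this

end SpanProj

/-! ### Indicator functions in `L²` -/

section Ind

variable {Ω : Type*} [MeasurableSpace Ω] (π : Measure Ω)

open Classical in
/-- The indicator function of a measurable set of finite measure as an element of `L²`
(and `0` for other sets). -/
def ind (A : Set Ω) : Lp ℂ 2 π :=
  if h : MeasurableSet A ∧ π A ≠ ∞ then indicatorConstLp 2 h.1 h.2 1 else 0

theorem ind_eq {A : Set Ω} (hA : MeasurableSet A) (h : π A ≠ ∞) :
    ind π A = indicatorConstLp 2 hA h 1 :=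
  dif_pos ⟨hA, h⟩

theorem ind_empty : ind π ∅ = 0 := by
  rw [ind_eq π MeasurableSet.empty (by simp)]
  exact indicatorConstLp_empty

theorem inner_ind {A B : Set Ω} (hA : MeasurableSet A) (hB : MeasurableSet B) (h : π A ≠ ∞)
    (h' : π B ≠ ∞) : inner ℂ (ind π A) (ind π B) = (π.real (A ∩ B) : ℂ) := by
  rw [ind_eq π hA h, ind_eq π hB h', L2.inner_indicatorConstLp_indicatorConstLp]
  simp

theorem ind_union {A B : Set Ω} (hA : MeasurableSet A) (hB : MeasurableSet B) (h : π A ≠ ∞)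
    (h' : π B ≠ ∞) (d : Disjoint A B) : ind π (A ∪ B) = ind π A + ind π B := by
  rw [ind_eq π hA h, ind_eq π hB h', ← indicatorConstLp_disjoint_union hA hB h h' d,
    ind_eq π (hA.union hB) (measure_union_ne_top h h')]

theorem ind_biUnion {ι : Type*} (s : Finset ι) (f : ι → Set Ω)
    (hf : ∀ i, MeasurableSet (f i)) (h : ∀ i, π (f i) ≠ ∞) (d : Pairwise (Function.onFun Disjoint f)) :
    ind π (⋃ i ∈ s, f i) = ∑ i ∈ s, ind π (f i) := by
  classical
  induction s using Finset.induction_on with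
  | empty => simp [ind_empty]
  | insert a s ha ih =>
    rw [Finset.set_biUnion_insert, Finset.sum_insert ha, ← ih]
    refine ind_union π (hf a) (s.measurableSet_biUnion fun i _ => hf i) (h a) ?_ ?_
    · exact (measure_biUnion_lt_top s.finite_toSet fun i _ => (h i).lt_top).ne
    · rw [Set.disjoint_iUnion₂_right]
      exact fun i hi => d fun e => ha (e ▸ hi)

/-- The closed span of the indicator functions of a π-system that generates the σ-field `m`. -/
theorem lpMeas_eq_closedSpan {Ω : Type*} {m m0 : MeasurableSpace Ω} (π : Measure Ω) (hm : m ≤ m0)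
    {C : Set (Set Ω)} (hC : m = MeasurableSpace.generateFrom C) (hpi : IsPiSystem C)
    (hfin : ∀ A ∈ C, π A ≠ ∞) (hcover : ∃ C' ⊆ C, C'.Countable ∧ ⋃₀ C' = Set.univ) :
    lpMeas ℂ ℂ m 2 π = (Submodule.span ℂ (ind π '' C)).topologicalClosure := by
  have hCm : ∀ A ∈ C, MeasurableSet[m] A := fun A hA => by
    rw [hC]; exact MeasurableSpace.measurableSet_generateFrom hA
  have hle : (Submodule.span ℂ (ind π '' C)).topologicalClosure ≤ lpMeas ℂ ℂ m 2 π := by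
    refine Submodule.topologicalClosure_minimal _ (Submodule.span_le.2 ?_) ?_
    · rintro _ ⟨A, hA, rfl⟩
      rw [ind_eq π (hm A (hCm A hA)) (hfin A hA)]
      exact mem_lpMeas_indicatorConstLp hm (hCm A hA) (hfin A hA)
    · exact (isComplete_aestronglyMeasurable hm).isClosed
  refine le_antisymm ?_ hle
  -- It remains to show that an `m`-measurable `f` orthogonal to all the indicators vanishes.
  rw [← Submodule.sup_orthogonal_inf_of_hasOrthogonalProjection hle]
  refine sup_le le_rfl ?_
  rintro f ⟨hf1, hf2⟩
  suffices h : f = 0 by rw [h]; exact Submodule.zero_mem _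
  have hint (A) (hA : A ∈ C) : IntegrableOn f A π :=
    integrableOn_Lp_of_measure_ne_top f (by norm_num) (hfin A hA)
  have h0 (A) (hA : A ∈ C) : ∫ x in A, f x ∂π = 0 := by
    rw [← L2.inner_indicatorConstLp_one (𝕜 := ℂ) (hm A (hCm A hA)) (hfin A hA),
      ← ind_eq π (hm A (hCm A hA)) (hfin A hA)]
    exact (Submodule.mem_orthogonal _ _).1 hf1 _ (subset_closedSpan _ ⟨A, hA, rfl⟩)
  -- The measure may be infinite, so the π-λ argument runs inside a fixed `A` of finite measure; the
  -- countable cover then removes the restriction to `A`.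
  have h1 (A) (hA : A ∈ C) (B) (hB : MeasurableSet[m] B) : ∫ x in B ∩ A, f x ∂π = 0 := by
    induction B, hB using MeasurableSpace.induction_on_inter hC hpi with
    | empty => simp
    | basic B hB =>
      rcases (B ∩ A).eq_empty_or_nonempty with h | h
      · simp [h]
      · exact h0 _ (hpi B hB A hA h)
    | compl B hB ih =>
      have h2 : Bᶜ ∩ A = A \ (B ∩ A) := by ext; simp; tauto
      rw [h2, setIntegral_sdiff ((hm B hB).inter (hm A (hCm A hA))) (hint A hA)
        Set.inter_subset_right, ih, h0 A hA, sub_zero]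
    | iUnion g hd hg ih =>
      rw [Set.iUnion_inter, integral_iUnion (fun i => (hm _ (hg i)).inter (hm A (hCm A hA)))]
      · simp [ih]
      · exact fun i j hij => (hd hij).mono Set.inter_subset_left Set.inter_subset_left
      · exact (hint A hA).mono_set (Set.iUnion_subset fun i => Set.inter_subset_right)
  obtain ⟨g, hg, hfg⟩ : AEStronglyMeasurable[m] f π := mem_lpMeas_iff_aestronglyMeasurable.1 hf2
  have h2 (A) (hA : A ∈ C) : ∀ᵐ x ∂π.restrict A, f x = 0 := by
    have hfgA : f =ᵐ[π.restrict A] g := ae_restrict_of_ae hfg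
    have hgi : Integrable g ((π.restrict A).trim hm) :=
      ((hint A hA).congr hfgA).trim hm hg
    have h3 := hgi.ae_eq_zero_of_forall_setIntegral_eq_zero fun s hs _ => by
      rw [← setIntegral_trim hm hg hs, ← setIntegral_congr_ae (hm s hs)
        (hfgA.mono fun x hx _ => hx), Measure.restrict_restrict (hm s hs)]
      exact h1 A hA s hs
    filter_upwards [hfgA, ae_eq_of_ae_eq_trim h3] with x hx hx'
    rw [hx, hx']; rfl
  obtain ⟨C', hC', hcount, hU⟩ := hcover
  have h3 : ∀ᵐ x ∂π, f x = 0 := by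
    have h4 := (ae_restrict_biUnion_iff (μ := π) (fun A : Set Ω => A) hcount
      (fun x => f x = 0)).2 fun A hA => h2 A (hC' hA)
    rwa [← Set.sUnion_eq_biUnion, hU, Measure.restrict_univ] at h4
  exact (Lp.eq_zero_iff_ae_eq_zero).2 h3

theorem condE_eq_spanProj {Ω : Type u} {m m0 : MeasurableSpace Ω} {π : Measure Ω}
    (hm : m ≤ m0) {G : Set (Lp ℂ 2 π)}
    (h : lpMeas ℂ ℂ m 2 π = (Submodule.span ℂ G).topologicalClosure) :
    TriangleBuilding.condE π hm = spanProj G := by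
  unfold TriangleBuilding.condE condExpL2 spanProj
  have : Fact (m ≤ m0) := ⟨hm⟩
  have : (lpMeas ℂ ℂ m 2 π).starProjection = (Submodule.span ℂ G).topologicalClosure.starProjection := by
    congr 1
  rw [← this]
  rfl

end Ind

end

noncomputable section

/-! ### Systems of coordinates with uniform branching -/

/-- Disjoint parts of measure at least `c` can only be finitely many in a set of finite measure. -/
theorem finite_image_of_le_measureReal {Ω V : Type*} [MeasurableSpace Ω] {π : Measure Ω}
    {A : Set Ω} {Z : Ω → V} (hZ : ∀ v, MeasurableSet (A ∩ Z ⁻¹' {v})) (hA : π A ≠ ∞) {c : ℝ}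
    (hc : 0 < c) (h : ∀ ω ∈ A, c ≤ π.real (A ∩ Z ⁻¹' {Z ω})) : (Z '' A).Finite := by
  have h1 := Measure.finite_const_le_meas_of_disjoint_iUnion π (ε := ENNReal.ofReal c)
    (As := fun v => A ∩ Z ⁻¹' {v}) (by simpa using hc) hZ
    (fun v w hvw => Set.disjoint_left.2 fun ω h1 h2 => hvw (h1.2.symm.trans h2.2))
    (measure_ne_top_of_subset (Set.iUnion_subset fun v => Set.inter_subset_left) hA)
  refine h1.subset ?_
  rintro _ ⟨ω, hω, rfl⟩
  exact ENNReal.ofReal_le_of_le_toReal (h ω hω)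

section Partition

variable {Ω V : Type*} [MeasurableSpace Ω] {π : Measure Ω} {A : Set Ω} {Z : Ω → V}

theorem eq_biUnion_fibers (hfin : (Z '' A).Finite) :
    A = ⋃ v ∈ hfin.toFinset, A ∩ Z ⁻¹' {v} := by
  ext ω
  simp only [Set.mem_iUnion, Set.Finite.mem_toFinset]
  exact ⟨fun h => ⟨Z ω, ⟨ω, h, rfl⟩, h, rfl⟩, fun ⟨_, _, h, _⟩ => h⟩

theorem pairwise_disjoint_fibers :
    Pairwise (Function.onFun Disjoint fun v => A ∩ Z ⁻¹' {v}) :=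
  fun _ _ hvw => Set.disjoint_left.2 fun _ h1 h2 => hvw (h1.2.symm.trans h2.2)

theorem measureReal_eq_sum_fibers (hZ : ∀ v, MeasurableSet (A ∩ Z ⁻¹' {v})) (hA : π A ≠ ∞)
    (hfin : (Z '' A).Finite) :
    π.real A = ∑ v ∈ hfin.toFinset, π.real (A ∩ Z ⁻¹' {v}) := by
  conv_lhs => rw [eq_biUnion_fibers hfin]
  exact measureReal_biUnion_finset (pairwise_disjoint_fibers.set_pairwise _) (fun v _ => hZ v)
    fun v _ => measure_ne_top_of_subset Set.inter_subset_left hA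

theorem ind_eq_sum_fibers (hZ : ∀ v, MeasurableSet (A ∩ Z ⁻¹' {v})) (hA : π A ≠ ∞)
    (hfin : (Z '' A).Finite) :
    ind π A = ∑ v ∈ hfin.toFinset, ind π (A ∩ Z ⁻¹' {v}) := by
  conv_lhs => rw [eq_biUnion_fibers hfin]
  exact ind_biUnion π _ _ hZ (fun v => measure_ne_top_of_subset Set.inter_subset_left hA)
    pairwise_disjoint_fibers

theorem measureReal_le_of_encard_le (hZ : ∀ v, MeasurableSet (A ∩ Z ⁻¹' {v})) (hA : π A ≠ ∞)
    {n : ℕ} (hn : (Z '' A).encard ≤ n) {c : ℝ} (hc : 0 ≤ c)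
    (h : ∀ ω ∈ A, π.real (A ∩ Z ⁻¹' {Z ω}) ≤ c) : π.real A ≤ n * c := by
  obtain ⟨hfin, hn⟩ := Set.encard_le_coe_iff_finite_ncard_le.1 hn
  rw [measureReal_eq_sum_fibers hZ hA hfin]
  refine (Finset.sum_le_card_nsmul _ _ c ?_).trans ?_
  · intro v hv
    obtain ⟨ω, hω, rfl⟩ := hfin.mem_toFinset.1 hv
    exact h ω hω
  · rw [nsmul_eq_mul]
    rw [Set.ncard_eq_toFinset_card _ hfin] at hn
    gcongr

/-- If `A` splits into at most `n` parts of measure at most `π A / n`, then there are exactly `n`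
parts, of the same measure. -/
theorem measureReal_fiber_eq_of_encard_le (hZ : ∀ v, MeasurableSet (A ∩ Z ⁻¹' {v}))
    (hA : π A ≠ ∞) {n : ℕ} (hn : (Z '' A).encard ≤ n) {c : ℝ} (hc : 0 < c)
    (h : ∀ ω ∈ A, π.real (A ∩ Z ⁻¹' {Z ω}) ≤ c) (hAc : π.real A = n * c) :
    (Z '' A).ncard = n ∧ ∀ ω ∈ A, π.real (A ∩ Z ⁻¹' {Z ω}) = c := by
  obtain ⟨hfin, hn⟩ := Set.encard_le_coe_iff_finite_ncard_le.1 hn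
  have hle : ∀ v ∈ hfin.toFinset, π.real (A ∩ Z ⁻¹' {v}) ≤ c := by
    intro v hv
    obtain ⟨ω, hω, rfl⟩ := hfin.mem_toFinset.1 hv
    exact h ω hω
  have hsum := measureReal_eq_sum_fibers hZ hA hfin
  rw [hAc] at hsum
  have hcard : (Z '' A).ncard = n := by
    refine le_antisymm hn ?_
    rw [Set.ncard_eq_toFinset_card _ hfin]
    have h1 := Finset.sum_le_card_nsmul _ _ c hle
    rw [← hsum, nsmul_eq_mul] at h1
    exact_mod_cast le_of_mul_le_mul_right h1 hc
  refine ⟨hcard, fun ω hω => ?_⟩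
  have h2 : ∑ v ∈ hfin.toFinset, π.real (A ∩ Z ⁻¹' {v}) = ∑ v ∈ hfin.toFinset, c := by
    rw [← hsum, Finset.sum_const, nsmul_eq_mul, ← Set.ncard_eq_toFinset_card _ hfin, hcard]
  exact (Finset.sum_eq_sum_iff_of_le hle).1 h2 _ (hfin.mem_toFinset.2 ⟨ω, hω, rfl⟩)

end Partition

/-- A family of discrete random variables indexed by `ℤ × ℤ` with the combinatorial properties
of the vertices of the apartments `[ω, ω₀]`. -/
structure CoordSystem {Ω : Type*} [MeasurableSpace Ω] (V : Type*) (π : Measure Ω) (q : ℕ) where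
  X : ℤ → ℤ → Ω → V
  pos : 0 < q
  measurableSet_fiber : ∀ i j v, MeasurableSet (X i j ⁻¹' {v})
  measure_ne_top : ∀ i j v, π (X i j ⁻¹' {v}) ≠ ∞
  -- Together with this exact value the one-sided cardinality bounds below become equalities.
  measureReal_fiber : ∀ i j ω, π.real (X i j ⁻¹' {X i j ω}) = (q : ℝ)⁻¹ ^ (2 * (i + j))
  countable_range : ∀ i j, (Set.range (X i j)).Countable
  det_left : ∀ {i j ω ω'}, X i j ω = X i j ω' → X (i - 1) j ω = X (i - 1) j ω'
  det_right : ∀ {i j ω ω'}, X i j ω = X i j ω' → X i (j - 1) ω = X i (j - 1) ω'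
  encard_right_le : ∀ i j v, (X i (j - 1) '' (X (i - 1) j ⁻¹' {v})).encard ≤ q
  encard_left_le : ∀ i j v, (X (i - 1) j '' (X i (j - 1) ⁻¹' {v})).encard ≤ q
  encard_top_le : ∀ i j v w,
    (X i j '' (X (i - 1) j ⁻¹' {v} ∩ X i (j - 1) ⁻¹' {w})).encard ≤ q
  -- In the link of the vertex at `(i, j - 1)` those at `(i - 1, j)` and `(i + 1, j - 1)` are
  -- distinct lines, and the vertex at `(i, j)` is their common point.
  det_of_right : ∀ {i j ω ω'}, X (i - 1) j ω = X (i - 1) j ω' → X i (j - 1) ω = X i (j - 1) ω' →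
    X (i + 1) (j - 1) ω = X (i + 1) (j - 1) ω' → X i j ω = X i j ω'
  det_of_left : ∀ {i j ω ω'}, X (i - 1) j ω = X (i - 1) j ω' → X i (j - 1) ω = X i (j - 1) ω' →
    X (i - 1) (j + 1) ω = X (i - 1) (j + 1) ω' → X i j ω = X i j ω'
  no_four_cycle : ∀ {i j a b c d}, X (i - 1) j a = X (i - 1) j b → X (i - 1) j c = X (i - 1) j d →
    X i (j - 1) a = X i (j - 1) c → X i (j - 1) b = X i (j - 1) d →
    X (i - 1) j a = X (i - 1) j c ∨ X i (j - 1) a = X i (j - 1) b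

namespace CoordSystem

variable {Ω V : Type*} [MeasurableSpace Ω] {π : Measure Ω} {q : ℕ} (S : CoordSystem V π q)

/-- The system with its two axes exchanged. -/
def swap : CoordSystem V π q where
  X i j := S.X j i
  pos := S.pos
  measurableSet_fiber i j := S.measurableSet_fiber j i
  measure_ne_top i j := S.measure_ne_top j i
  measureReal_fiber i j ω := by rw [S.measureReal_fiber, add_comm]
  countable_range i j := S.countable_range j i
  det_left := S.det_right
  det_right := S.det_left
  encard_right_le i j := S.encard_left_le j i
  encard_left_le i j := S.encard_right_le j i
  encard_top_le i j v w := by rw [Set.inter_comm]; exact S.encard_top_le j i w v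
  det_of_right h1 h2 h3 := S.det_of_left h2 h1 h3
  det_of_left h1 h2 h3 := S.det_of_right h2 h1 h3
  no_four_cycle h1 h2 h3 h4 := (S.no_four_cycle h3 h4 h1 h2).symm

/-- The event that the coordinate `(i, j)` is `v`. -/
def F (i j : ℤ) (v : V) : Set Ω := S.X i j ⁻¹' {v}

variable {S}

theorem mem_F {i j : ℤ} {v : V} {ω : Ω} : ω ∈ S.F i j v ↔ S.X i j ω = v := Iff.rfl

theorem det_of_le {i j i' j' : ℤ} (hi : i ≤ i') (hj : j ≤ j') {ω ω' : Ω}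
    (h : S.X i' j' ω = S.X i' j' ω') : S.X i j ω = S.X i j ω' := by
  have h1 : S.X i j' ω = S.X i j' ω' := by
    induction i, hi using Int.leInductionDown with
    | base => exact h
    | pred n _ ih => exact S.det_left ih
  induction j, hj using Int.leInductionDown with
  | base => exact h1
  | pred n _ ih => exact S.det_right ih

variable (S)

theorem measurableSet_F (i j : ℤ) (v : V) : MeasurableSet (S.F i j v) :=
  S.measurableSet_fiber i j v

theorem measure_F_ne_top (i j : ℤ) (v : V) : π (S.F i j v) ≠ ∞ := S.measure_ne_top i j v

theorem measureReal_F {i j : ℤ} {v : V} {ω : Ω} (h : S.X i j ω = v) :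
    π.real (S.F i j v) = (q : ℝ)⁻¹ ^ (2 * (i + j)) := by
  rw [← h]; exact S.measureReal_fiber i j ω

theorem inv_q_pos (S : CoordSystem V π q) : 0 < (q : ℝ)⁻¹ := by
  have := S.pos
  positivity

theorem q_mul_zpow (S : CoordSystem V π q) (n : ℤ) : (q : ℝ) * (q : ℝ)⁻¹ ^ n = (q : ℝ)⁻¹ ^ (n - 1) := by
  have h := S.inv_q_pos.ne'
  rw [zpow_sub₀ h, zpow_one, div_inv_eq_mul, mul_comm]

/-- The pair event splits into at most `q` atoms at `(i, j)`. -/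
theorem measureReal_pair_le (i j : ℤ) (x y : V) :
    π.real (S.F (i - 1) j x ∩ S.F i (j - 1) y) ≤ (q : ℝ)⁻¹ ^ (2 * (i + j) - 1) := by
  rw [← S.q_mul_zpow]
  refine measureReal_le_of_encard_le (Z := S.X i j)
    (fun v => ((S.measurableSet_F _ _ _).inter (S.measurableSet_F _ _ _)).inter
      (S.measurableSet_F _ _ _))
    (measure_ne_top_of_subset Set.inter_subset_left (S.measure_F_ne_top _ _ _))
    (S.encard_top_le i j x y) (zpow_pos S.inv_q_pos _).le fun ω _ => ?_
  rw [← S.measureReal_fiber i j ω]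
  exact measureReal_mono Set.inter_subset_right (S.measure_ne_top _ _ _)

/-- At most `q` parts, each bounded by `measureReal_pair_le`, must fill an event whose measure is
`q` times that bound. -/
theorem right_children {i j : ℤ} {ω : Ω} {x : V} (hx : S.X (i - 1) j ω = x) :
    (S.X i (j - 1) '' S.F (i - 1) j x).ncard = q ∧
    ∀ ω ∈ S.F (i - 1) j x, π.real (S.F (i - 1) j x ∩ S.F i (j - 1) (S.X i (j - 1) ω)) =
      (q : ℝ)⁻¹ ^ (2 * (i + j) - 1) := by
  refine measureReal_fiber_eq_of_encard_le
    (fun v => (S.measurableSet_F _ _ _).inter (S.measurableSet_F _ _ _))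
    (S.measure_F_ne_top _ _ _) (S.encard_right_le i j x) (zpow_pos S.inv_q_pos _)
    (fun ω _ => S.measureReal_pair_le i j _ _) ?_
  rw [S.measureReal_F hx, S.q_mul_zpow]
  congr 1; ring

theorem measureReal_pair {i j : ℤ} {ω : Ω} {x y : V} (hx : S.X (i - 1) j ω = x)
    (hy : S.X i (j - 1) ω = y) :
    π.real (S.F (i - 1) j x ∩ S.F i (j - 1) y) = (q : ℝ)⁻¹ ^ (2 * (i + j) - 1) := by
  rw [← hy]
  exact (S.right_children hx).2 ω hx

theorem ncard_right {i j : ℤ} {ω : Ω} {x : V} (hx : S.X (i - 1) j ω = x) :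
    (S.X i (j - 1) '' S.F (i - 1) j x).ncard = q := (S.right_children hx).1

theorem ncard_left {i j : ℤ} {ω : Ω} {y : V} (hy : S.X i (j - 1) ω = y) :
    (S.X (i - 1) j '' S.F i (j - 1) y).ncard = q := S.swap.ncard_right hy

/-- A set is saturated if it is a union of events `F i j v`. -/
def Saturated (i j : ℤ) (A : Set Ω) : Prop := ∀ ω ∈ A, S.F i j (S.X i j ω) ⊆ A

theorem Saturated.inter {S : CoordSystem V π q} {i j : ℤ} {A B : Set Ω} (hA : S.Saturated i j A)
    (hB : S.Saturated i j B) : S.Saturated i j (A ∩ B) :=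
  fun ω h => Set.subset_inter (hA ω h.1) (hB ω h.2)

theorem saturated_F {i j i' j' : ℤ} (hi : i ≤ i') (hj : j ≤ j') (v : V) :
    S.Saturated i' j' (S.F i j v) :=
  fun _ h _ h' => (det_of_le hi hj h').trans h

variable {S}

theorem Saturated.inter_fiber {i j : ℤ} {A : Set Ω} (h : S.Saturated i j A) {ω : Ω} (hω : ω ∈ A) :
    A ∩ S.X i j ⁻¹' {S.X i j ω} = S.F i j (S.X i j ω) :=
  Set.inter_eq_right.2 (h ω hω)

theorem Saturated.finite {i j : ℤ} {A : Set Ω} (h : S.Saturated i j A) (hA : MeasurableSet A)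
    (hA' : π A ≠ ∞) : (S.X i j '' A).Finite :=
  finite_image_of_le_measureReal (fun v => hA.inter (S.measurableSet_F _ _ _)) hA'
    (zpow_pos S.inv_q_pos (2 * (i + j))) fun ω hω => by
      rw [h.inter_fiber hω, S.measureReal_F rfl]

theorem Saturated.measureReal_eq {i j : ℤ} {A : Set Ω} (h : S.Saturated i j A)
    (hA : MeasurableSet A) (hA' : π A ≠ ∞) :
    π.real A = (S.X i j '' A).ncard * (q : ℝ)⁻¹ ^ (2 * (i + j)) := by
  have hfin := h.finite hA hA'
  rw [measureReal_eq_sum_fibers (fun v => hA.inter (S.measurableSet_F _ _ _)) hA' hfin,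
    Finset.sum_congr rfl (g := fun _ => (q : ℝ)⁻¹ ^ (2 * (i + j)))]
  · rw [Finset.sum_const, nsmul_eq_mul, ← Set.ncard_eq_toFinset_card _ hfin]
  · intro v hv
    obtain ⟨ω, hω, rfl⟩ := hfin.mem_toFinset.1 hv
    rw [h.inter_fiber hω, S.measureReal_F rfl]

theorem Saturated.ncard_eq {i j : ℤ} {A : Set Ω} (h : S.Saturated i j A)
    (hA : MeasurableSet A) (hA' : π A ≠ ∞) {n : ℕ}
    (hn : π.real A = (q : ℝ)⁻¹ ^ (2 * (i + j) - n)) : (S.X i j '' A).ncard = q ^ n := by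
  have h1 := h.measureReal_eq hA hA'
  have hp := zpow_pos S.inv_q_pos (2 * (i + j))
  have h2 : (q : ℝ)⁻¹ ^ (2 * (i + j) - n) = (q : ℝ) ^ n * (q : ℝ)⁻¹ ^ (2 * (i + j)) := by
    rw [zpow_sub₀ S.inv_q_pos.ne', zpow_natCast, inv_pow, div_inv_eq_mul, mul_comm]
  rw [hn, h2] at h1
  exact_mod_cast (mul_right_cancel₀ hp.ne' h1).symm

variable (S)

/-- The quantitative form of conditional independence: every vertex at `(i + 1, j - 1)` that occurs
over `y` occurs together with `x`, with the same measure. The pair event has at most `q ^ 2` such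
parts, and its measure is `q ^ 2` times the bound for each. -/
theorem triple {i j : ℤ} {a b : Ω} {x y : V} (hx : S.X (i - 1) j a = x)
    (hy : S.X i (j - 1) a = y) (hb : S.X i (j - 1) b = y) :
    π.real (S.F (i - 1) j x ∩ S.F i (j - 1) y ∩ S.F (i + 1) (j - 1) (S.X (i + 1) (j - 1) b)) =
      (q : ℝ)⁻¹ ^ (2 * (i + j) + 1) := by
  set A := S.F (i - 1) j x ∩ S.F i (j - 1) y with hA
  set Z := S.X (i + 1) (j - 1) with hZ
  have hAm : MeasurableSet A := (S.measurableSet_F _ _ _).inter (S.measurableSet_F _ _ _)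
  have hA' : π A ≠ ∞ := measure_ne_top_of_subset Set.inter_subset_left (S.measure_F_ne_top _ _ _)
  have hsat : S.Saturated (i + 1) (j - 1) (S.F i (j - 1) y) :=
    S.saturated_F (by lia) le_rfl y
  have hcard : (Z '' S.F i (j - 1) y).ncard = q ^ 2 :=
    hsat.ncard_eq (S.measurableSet_F _ _ _) (S.measure_F_ne_top _ _ _)
      (by rw [S.measureReal_F hy]; congr 1; push_cast; ring)
  have hfin : (Z '' S.F i (j - 1) y).Finite :=
    hsat.finite (S.measurableSet_F _ _ _) (S.measure_F_ne_top _ _ _)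
  have hsub : Z '' A ⊆ Z '' S.F i (j - 1) y := Set.image_mono Set.inter_subset_right
  have hle : ∀ ω ∈ A, π.real (A ∩ Z ⁻¹' {Z ω}) ≤ (q : ℝ)⁻¹ ^ (2 * (i + j) + 1) := by
    intro ω hω
    have e : (q : ℝ)⁻¹ ^ (2 * (i + j) + 1) = q * (q : ℝ)⁻¹ ^ (2 * (i + 1 + j)) := by
      rw [S.q_mul_zpow]; congr 1; ring
    rw [e]
    refine measureReal_le_of_encard_le (Z := S.X (i + 1) j)
      (fun v => (hAm.inter (S.measurableSet_F _ _ _)).inter (S.measurableSet_F _ _ _))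
      (measure_ne_top_of_subset Set.inter_subset_left hA') ?_ (zpow_pos S.inv_q_pos _).le
      fun ω' _ => ?_
    · refine (Set.encard_le_encard ?_).trans (S.encard_top_le (i + 1) j (S.X i j ω) (Z ω))
      refine Set.image_mono fun ω' hω' => ⟨?_, hω'.2⟩
      have h1 : S.X (i - 1) j ω' = S.X (i - 1) j ω := hω'.1.1.trans hω.1.symm
      have h2 : S.X i (j - 1) ω' = S.X i (j - 1) ω := hω'.1.2.trans hω.2.symm
      have := S.det_of_right h1 h2 hω'.2
      simpa using this
    · rw [← S.measureReal_fiber (i + 1) j ω']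
      exact measureReal_mono Set.inter_subset_right (S.measure_ne_top _ _ _)
  obtain ⟨h1, h2⟩ := measureReal_fiber_eq_of_encard_le (n := q ^ 2)
    (fun v => hAm.inter (S.measurableSet_F _ _ _)) hA'
    (by
      rw [Set.encard_le_coe_iff_finite_ncard_le]
      exact ⟨hfin.subset hsub, hcard ▸ Set.ncard_le_ncard hsub hfin⟩)
    (zpow_pos S.inv_q_pos (2 * (i + j) + 1)) hle (by
      rw [S.measureReal_pair hx hy]
      push_cast
      rw [pow_two, mul_assoc, S.q_mul_zpow, S.q_mul_zpow]; congr 1; ring)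
  -- The `q ^ 2` values on `A` exhaust the `q ^ 2` values over `y`, so the value at `b` is among
  -- them.
  have heq : Z '' A = Z '' S.F i (j - 1) y :=
    Set.eq_of_subset_of_ncard_le hsub (by rw [h1, hcard]) hfin
  obtain ⟨ω, hω, hωb⟩ : Z b ∈ Z '' A := by rw [heq]; exact ⟨b, hb, rfl⟩
  rw [← hωb]
  exact h2 ω hω

end CoordSystem

end

/-! ### The projections attached to a coordinate system. -/

noncomputable section

namespace CoordSystem

variable {Ω V : Type*} [MeasurableSpace Ω] {π : Measure Ω} {q : ℕ} (S : CoordSystem V π q)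

/-- The indicator functions of the events `F i j v`. -/
def gensP (i j : ℤ) : Set (Lp ℂ 2 π) := Set.range fun v => ind π (S.F i j v)

/-- The indicator functions of the joint events at `(i - 1, j)` and `(i, j - 1)`. -/
def gensQ (i j : ℤ) : Set (Lp ℂ 2 π) :=
  Set.range fun p : V × V => ind π (S.F (i - 1) j p.1 ∩ S.F i (j - 1) p.2)

/-- The indicator functions of the events `F i j v` with fixed `i`. -/
def gensM (i : ℤ) : Set (Lp ℂ 2 π) := ⋃ j, S.gensP i j

/-- The indicator functions of the events `F i j v` with fixed `j`. -/
def gensN (j : ℤ) : Set (Lp ℂ 2 π) := ⋃ i, S.gensP i j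

theorem measurableSet_pair (i j : ℤ) (x y : V) :
    MeasurableSet (S.F (i - 1) j x ∩ S.F i (j - 1) y) :=
  (S.measurableSet_F _ _ _).inter (S.measurableSet_F _ _ _)

theorem measure_pair_ne_top (i j : ℤ) (x y : V) :
    π (S.F (i - 1) j x ∩ S.F i (j - 1) y) ≠ ∞ :=
  measure_ne_top_of_subset Set.inter_subset_left (S.measure_F_ne_top _ _ _)

theorem inner_ind_F (i j : ℤ) (v : V) {A : Set Ω} (hA : MeasurableSet A) (h : π A ≠ ∞) :
    inner ℂ (ind π (S.F i j v)) (ind π A) = (π.real (S.F i j v ∩ A) : ℂ) :=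
  inner_ind π (S.measurableSet_F _ _ _) hA (S.measure_F_ne_top _ _ _) h

theorem ind_F_mem (i j : ℤ) (v : V) :
    ind π (S.F i j v) ∈ (Submodule.span ℂ (S.gensP i j)).topologicalClosure :=
  subset_closedSpan _ ⟨v, rfl⟩

theorem Saturated.ind_mem {S : CoordSystem V π q} {i j : ℤ} {A : Set Ω} (h : S.Saturated i j A)
    (hA : MeasurableSet A) (hA' : π A ≠ ∞) :
    ind π A ∈ (Submodule.span ℂ (S.gensP i j)).topologicalClosure := by
  have hfin := h.finite hA hA'
  rw [ind_eq_sum_fibers (fun v => hA.inter (S.measurableSet_F _ _ _)) hA' hfin]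
  refine Submodule.sum_mem _ fun v hv => ?_
  obtain ⟨ω, hω, rfl⟩ := hfin.mem_toFinset.1 hv
  rw [h.inter_fiber hω]
  exact S.ind_F_mem _ _ _

theorem saturated_pair (i j : ℤ) (x y : V) :
    S.Saturated i j (S.F (i - 1) j x ∩ S.F i (j - 1) y) :=
  (S.saturated_F (by lia) le_rfl x).inter (S.saturated_F le_rfl (by lia) y)

theorem ind_F_mem_of_le {i j i' j' : ℤ} (hi : i ≤ i') (hj : j ≤ j') (v : V) :
    ind π (S.F i j v) ∈ (Submodule.span ℂ (S.gensP i' j')).topologicalClosure :=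
  (S.saturated_F hi hj v).ind_mem (S.measurableSet_F _ _ _) (S.measure_F_ne_top _ _ _)

theorem ind_F_mem_gensQ (i j : ℤ) (y : V) :
    ind π (S.F i (j - 1) y) ∈ (Submodule.span ℂ (S.gensQ i j)).topologicalClosure := by
  have hfin := (Set.encard_le_coe_iff_finite_ncard_le.1 (S.encard_left_le i j y)).1
  rw [ind_eq_sum_fibers (fun v => (S.measurableSet_F _ _ _).inter (S.measurableSet_F _ _ _))
    (S.measure_F_ne_top _ _ _) hfin]
  refine Submodule.sum_mem _ fun v _ => subset_closedSpan _ ⟨(v, y), ?_⟩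
  dsimp only
  rw [Set.inter_comm]; rfl

theorem spanProj_gensP_eq {i j : ℤ} {f g : Lp ℂ 2 π}
    (hg : g ∈ (Submodule.span ℂ (S.gensP i j)).topologicalClosure)
    (h : ∀ ω, inner ℂ (ind π (S.F i j (S.X i j ω))) f =
      inner ℂ (ind π (S.F i j (S.X i j ω))) g) : spanProj (S.gensP i j) f = g := by
  refine spanProj_eq hg ?_
  rintro _ ⟨v, rfl⟩
  dsimp only
  rcases (S.F i j v).eq_empty_or_nonempty with h' | ⟨ω, rfl⟩
  · rw [h', ind_empty, inner_zero_left, inner_zero_left]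
  · exact h ω

theorem disjoint_F {i j : ℤ} {v w : V} (h : v ≠ w) : S.F i j v ∩ S.F i j w = ∅ :=
  Set.disjoint_iff_inter_eq_empty.1 <| Set.disjoint_left.2 fun _ h1 h2 => h (h1.symm.trans h2)

/-- By `triple`, given `y` the event `x` has probability `q⁻¹` whatever the finer coordinate at `(i
+ 1, j - 1)` is. -/
theorem P_right_ind_pair {i j : ℤ} {ω : Ω} {x y : V} (hx : S.X (i - 1) j ω = x)
    (hy : S.X i (j - 1) ω = y) :
    spanProj (S.gensP (i + 1) (j - 1)) (ind π (S.F (i - 1) j x ∩ S.F i (j - 1) y)) =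
      ((q : ℝ)⁻¹ : ℂ) • ind π (S.F i (j - 1) y) := by
  refine S.spanProj_gensP_eq
    (Submodule.smul_mem _ _ (S.ind_F_mem_of_le (by lia) le_rfl y)) fun ω' => ?_
  rw [inner_smul_right, S.inner_ind_F _ _ _ (S.measurableSet_pair _ _ _ _)
    (S.measure_pair_ne_top _ _ _ _), S.inner_ind_F _ _ _ (S.measurableSet_F _ _ _)
    (S.measure_F_ne_top _ _ _)]
  norm_cast
  have hsat : S.Saturated (i + 1) (j - 1) (S.F i (j - 1) y) := S.saturated_F (by lia) le_rfl y
  by_cases hω : S.X i (j - 1) ω' = y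
  · rw [Set.inter_comm, S.triple hx hy hω, Set.inter_eq_left.2 (hsat ω' hω), S.measureReal_F rfl,
      ← zpow_one_add₀ S.inv_q_pos.ne']
    congr 1; ring
  · have h0 : S.F (i + 1) (j - 1) (S.X (i + 1) (j - 1) ω') ∩ S.F i (j - 1) y = ∅ := by
      refine Set.eq_empty_of_forall_notMem fun ω'' h => hω ?_
      exact (det_of_le (by lia) le_rfl (mem_F.1 h.1)).symm.trans h.2
    rw [Set.inter_left_comm, h0]
    simp

theorem P_base_ind_pair {i j : ℤ} {ω : Ω} {x y : V} (hx : S.X (i - 1) j ω = x)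
    (hy : S.X i (j - 1) ω = y) :
    spanProj (S.gensP i (j - 1)) (ind π (S.F (i - 1) j x ∩ S.F i (j - 1) y)) =
      ((q : ℝ)⁻¹ : ℂ) • ind π (S.F i (j - 1) y) := by
  refine S.spanProj_gensP_eq (Submodule.smul_mem _ _ (S.ind_F_mem _ _ y)) fun ω' => ?_
  rw [inner_smul_right, S.inner_ind_F _ _ _ (S.measurableSet_pair _ _ _ _)
    (S.measure_pair_ne_top _ _ _ _), S.inner_ind_F _ _ _ (S.measurableSet_F _ _ _)
    (S.measure_F_ne_top _ _ _)]
  norm_cast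
  by_cases hω : S.X i (j - 1) ω' = y
  · rw [hω, Set.inter_self, Set.inter_left_comm, Set.inter_self, S.measureReal_pair hx hy,
      S.measureReal_F hy, ← zpow_one_add₀ S.inv_q_pos.ne']
    congr 1; ring
  · rw [Set.inter_left_comm, S.disjoint_F hω]
    simp

theorem spanProj_right_mul_gensQ (i j : ℤ) :
    spanProj (S.gensP (i + 1) (j - 1)) * spanProj (S.gensQ i j) = spanProj (S.gensP i (j - 1)) := by
  rw [mul_spanProj_ext (T' := spanProj (S.gensP i (j - 1)))]
  · refine spanProj_mul_eq_left ?_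
    rintro _ ⟨y, rfl⟩
    exact S.ind_F_mem_gensQ i j y
  · rintro _ ⟨⟨x, y⟩, rfl⟩
    dsimp only
    rcases (S.F (i - 1) j x ∩ S.F i (j - 1) y).eq_empty_or_nonempty with h | ⟨ω, hx, hy⟩
    · rw [h, ind_empty, map_zero, map_zero]
    · rw [S.P_right_ind_pair hx hy, S.P_base_ind_pair hx hy]

theorem gensQ_swap (i j : ℤ) : S.swap.gensQ j i = S.gensQ i j := by
  ext f
  constructor
  · rintro ⟨⟨x, y⟩, rfl⟩
    exact ⟨(y, x), by dsimp only; rw [Set.inter_comm]; rfl⟩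
  · rintro ⟨⟨x, y⟩, rfl⟩
    exact ⟨(y, x), by dsimp only; rw [Set.inter_comm]; rfl⟩

theorem spanProj_left_mul_gensQ (i j : ℤ) :
    spanProj (S.gensP (i - 1) (j + 1)) * spanProj (S.gensQ i j) = spanProj (S.gensP (i - 1) j) := by
  have h := S.swap.spanProj_right_mul_gensQ j i
  rw [gensQ_swap] at h
  exact h

/-- A generator of row `j` is measurable at every point far enough to the right, so it can be tested
against a stationary product. -/
theorem spanProj_gensN_mul_eq {j i₀ : ℤ} {T T' : Lp ℂ 2 π →L[ℂ] Lp ℂ 2 π}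
    (h : ∀ i, i₀ ≤ i → spanProj (S.gensP i j) * T = T') : spanProj (S.gensN j) * T = T' := by
  ext1 f
  have hf (i : ℤ) (hi : i₀ ≤ i) : spanProj (S.gensP i j) (T f) = T' f := by rw [← h i hi]; rfl
  refine spanProj_eq ?_ ?_
  · rw [← hf i₀ le_rfl]
    refine Submodule.topologicalClosure_mono (Submodule.span_mono ?_)
      (Submodule.starProjection_apply_mem _ _)
    exact Set.subset_iUnion (fun i => S.gensP i j) i₀
  · intro g hg
    obtain ⟨i, v, rfl⟩ := Set.mem_iUnion.1 hg
    have h1 : spanProj (S.gensP (max i i₀) j) (ind π (S.F i j v)) = ind π (S.F i j v) :=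
      spanProj_eq_self.2 (S.ind_F_mem_of_le (le_max_left _ _) le_rfl v)
    dsimp only
    rw [← hf _ (le_max_right i i₀)]
    conv_lhs => rw [← h1]
    exact Submodule.inner_starProjection_left_eq_right _ _ _

/-- The neighbours at `(i + 1, j - 1)` of the vertex `x` at `(i, j)`. -/
def nbrs (i j : ℤ) (x : V) : Set V := S.X (i + 1) (j - 1) '' S.F i j x

theorem finite_nbrs (i j : ℤ) (x : V) : (S.nbrs i j x).Finite := by
  have h := (Set.encard_le_coe_iff_finite_ncard_le.1 (S.encard_right_le (i + 1) j x)).1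
  rwa [add_sub_cancel_right] at h

variable {S} in
theorem ncard_nbrs {i j : ℤ} {ω : Ω} {x : V} (hx : S.X i j ω = x) : (S.nbrs i j x).ncard = q := by
  have h := S.ncard_right (i := i + 1) (j := j) (ω := ω) (x := x) (by rwa [add_sub_cancel_right])
  rwa [add_sub_cancel_right] at h

theorem measureReal_nbrs {i j : ℤ} {x y : V} (h : y ∈ S.nbrs i j x) :
    π.real (S.F i j x ∩ S.F (i + 1) (j - 1) y) = (q : ℝ)⁻¹ ^ (2 * (i + j) + 1) := by
  obtain ⟨ω, hx, hy⟩ := h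
  have h := S.measureReal_pair (i := i + 1) (j := j) (ω := ω) (x := x) (y := y)
    (by rwa [add_sub_cancel_right]) hy
  rw [add_sub_cancel_right] at h
  rw [h]; congr 1; ring

theorem measureReal_not_nbrs {i j : ℤ} {x y : V} (h : y ∉ S.nbrs i j x) :
    π.real (S.F i j x ∩ S.F (i + 1) (j - 1) y) = 0 := by
  have : S.F i j x ∩ S.F (i + 1) (j - 1) y = ∅ :=
    Set.eq_empty_of_forall_notMem fun ω hω => h ⟨ω, hω⟩
  simp [this]

theorem spanProj_right_ind (i j : ℤ) (x : V) :
    spanProj (S.gensP (i + 1) (j - 1)) (ind π (S.F i j x)) =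
      ((q : ℝ)⁻¹ : ℂ) • ∑ y ∈ (S.finite_nbrs i j x).toFinset, ind π (S.F (i + 1) (j - 1) y) := by
  classical
  refine S.spanProj_gensP_eq (Submodule.smul_mem _ _ (Submodule.sum_mem _ fun y _ =>
    S.ind_F_mem _ _ y)) fun ω' => ?_
  set z := S.X (i + 1) (j - 1) ω' with hz
  have h1 (y : V) : inner ℂ (ind π (S.F (i + 1) (j - 1) z)) (ind π (S.F (i + 1) (j - 1) y)) =
      if z = y then (((q : ℝ)⁻¹ ^ (2 * (i + j)) : ℝ) : ℂ) else 0 := by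
    rw [S.inner_ind_F _ _ _ (S.measurableSet_F _ _ _) (S.measure_F_ne_top _ _ _)]
    split_ifs with h
    · rw [← h, Set.inter_self, S.measureReal_F hz.symm]; congr 2; ring
    · rw [S.disjoint_F h]; simp
  rw [inner_smul_right, inner_sum, Finset.sum_congr rfl fun y _ => h1 y, Finset.sum_ite_eq,
    S.inner_ind_F _ _ _ (S.measurableSet_F _ _ _) (S.measure_F_ne_top _ _ _), Set.inter_comm]
  simp only [Set.Finite.mem_toFinset]
  split_ifs with h
  · rw [S.measureReal_nbrs h]
    norm_cast
    rw [← zpow_one_add₀ S.inv_q_pos.ne']; congr 1; ring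
  · rw [S.measureReal_not_nbrs h]; simp

theorem inner_spanProj_right (i j : ℤ) (x x' : V) :
    inner ℂ (ind π (S.F i j x')) (spanProj (S.gensP (i + 1) (j - 1)) (ind π (S.F i j x))) =
      (((S.nbrs i j x ∩ S.nbrs i j x').ncard * (q : ℝ)⁻¹ ^ (2 * (i + j) + 2) : ℝ) : ℂ) := by
  classical
  have h1 (y : V) : inner ℂ (ind π (S.F i j x')) (ind π (S.F (i + 1) (j - 1) y)) =
      if y ∈ S.nbrs i j x' then (((q : ℝ)⁻¹ ^ (2 * (i + j) + 1) : ℝ) : ℂ) else 0 := by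
    rw [S.inner_ind_F _ _ _ (S.measurableSet_F _ _ _) (S.measure_F_ne_top _ _ _)]
    split_ifs with h
    · rw [S.measureReal_nbrs h]
    · rw [S.measureReal_not_nbrs h]; simp
  have h2 : {y ∈ (S.finite_nbrs i j x).toFinset | y ∈ S.nbrs i j x'} =
      ((S.finite_nbrs i j x).inter_of_left (S.nbrs i j x')).toFinset := by
    ext; simp
  rw [S.spanProj_right_ind i j x, inner_smul_right, inner_sum, Finset.sum_congr rfl fun y _ => h1 y,
    ← Finset.sum_filter, Finset.sum_const, nsmul_eq_mul, h2,
    ← Set.ncard_eq_toFinset_card _ ((S.finite_nbrs i j x).inter_of_left _)]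
  norm_cast
  rw [show 2 * (i + j) + 2 = 1 + (2 * (i + j) + 1) by ring,
    zpow_one_add₀ S.inv_q_pos.ne' (2 * (i + j) + 1)]
  ring

variable {S} in
-- In the link of the vertex at `(i, j - 1)`, two points on the line given by the vertex at `(i - 1,
-- j)` have no second common line.
theorem eq_of_common_nbr {i j : ℤ} {a b : Ω} {y : V} (hl : S.X (i - 1) j a = S.X (i - 1) j b)
    (ha : y ∈ S.nbrs i j (S.X i j a)) (hb : y ∈ S.nbrs i j (S.X i j b)) :
    S.X i j a = S.X i j b := by
  obtain ⟨a', ha', hay⟩ := ha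
  obtain ⟨b', hb', hby⟩ := hb
  have e : S.X (i + 1) (j - 1) a' = S.X (i + 1) (j - 1) b' := hay.trans hby.symm
  rw [← mem_F.1 ha', ← mem_F.1 hb']
  refine S.det_of_right ?_ (det_of_le (by lia) le_rfl e) e
  rw [S.det_left ha', S.det_left hb', hl]

variable {S} in
theorem right_eq_of_common_nbr {i j : ℤ} {a b : Ω} {y : V}
    (ha : y ∈ S.nbrs i j (S.X i j a)) (hb : y ∈ S.nbrs i j (S.X i j b)) :
    S.X i (j - 1) a = S.X i (j - 1) b := by
  obtain ⟨a', ha', hay⟩ := ha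
  obtain ⟨b', hb', hby⟩ := hb
  have e : S.X (i + 1) (j - 1) a' = S.X (i + 1) (j - 1) b' := hay.trans hby.symm
  rw [← S.det_right ha', ← S.det_right hb']
  exact det_of_le (by lia) le_rfl e

theorem ncard_common_le {i j : ℤ} {a b : Ω} (hne : S.X i j a ≠ S.X i j b) :
    (S.nbrs i j (S.X i j a) ∩ S.nbrs i j (S.X i j b)).ncard ≤ 1 := by
  refine (Set.ncard_le_one ((S.finite_nbrs _ _ _).inter_of_left _)).2 ?_
  rintro _ ⟨⟨a₁, ha₁, rfl⟩, b₁, hb₁, h₁⟩ _ ⟨⟨a₂, ha₂, rfl⟩, b₂, hb₂, h₂⟩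
  have h := S.no_four_cycle (i := i + 1) (j := j) (a := a₁) (b := a₂) (c := b₁) (d := b₂)
  simp only [add_sub_cancel_right] at h
  rcases h ((mem_F.1 ha₁).trans (mem_F.1 ha₂).symm) ((mem_F.1 hb₁).trans (mem_F.1 hb₂).symm)
    h₁.symm h₂.symm with h | h
  · exact (hne ((mem_F.1 ha₁).symm.trans (h.trans hb₁))).elim
  · exact h

theorem ncard_right_parents {i j : ℤ} {ω : Ω} {y : V} (hy : S.X (i + 1) (j - 1) ω = y) :
    (S.X i j '' S.F (i + 1) (j - 1) y).ncard = q := by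
  have h := S.ncard_left (i := i + 1) (j := j) hy
  rwa [add_sub_cancel_right] at h

/-- Two vertices `x ≠ x'` over the same vertex at `(i, j - 1)` but over different vertices at
`(i - 1, j)` have exactly one common neighbour. -/
theorem ncard_common_eq {a b : Ω} {i j : ℤ} (hr : S.X i (j - 1) a = S.X i (j - 1) b)
    (hl : S.X (i - 1) j a ≠ S.X (i - 1) j b) :
    (S.nbrs i j (S.X i j a) ∩ S.nbrs i j (S.X i j b)).ncard = 1 := by
  classical
  set x := S.X i j a with hx
  set v := S.X i (j - 1) a with hv
  set α := S.X (i - 1) j a with hα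
  have hsatv : S.Saturated i j (S.F i (j - 1) v) := S.saturated_F le_rfl (by lia) v
  have hsat := S.saturated_pair i j α v
  have finCh := hsatv.finite (S.measurableSet_F _ _ _) (S.measure_F_ne_top _ _ _)
  have finD := hsat.finite (S.measurableSet_pair _ _ _ _) (S.measure_pair_ne_top _ _ _ _)
  have hCh : finCh.toFinset.card = q ^ 2 := by
    rw [← Set.ncard_eq_toFinset_card _ finCh]
    refine hsatv.ncard_eq (S.measurableSet_F _ _ _) (S.measure_F_ne_top _ _ _) ?_
    rw [S.measureReal_F hv.symm]; congr 1; push_cast; ring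
  have hD : finD.toFinset.card = q ^ 1 := by
    rw [← Set.ncard_eq_toFinset_card _ finD]
    refine hsat.ncard_eq (S.measurableSet_pair _ _ _ _) (S.measure_pair_ne_top _ _ _ _) ?_
    rw [S.measureReal_pair hα.symm hv.symm]; norm_num
  have hDCh : finD.toFinset ⊆ finCh.toFinset := by
    simp only [Set.Finite.toFinset_subset_toFinset]
    exact Set.image_mono Set.inter_subset_right
  set Y := (S.finite_nbrs i j x).toFinset with hY
  set n : V → ℕ := fun x' => (S.nbrs i j x ∩ S.nbrs i j x').ncard with hn
  have hYcard : Y.card = q := by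
    rw [hY, ← Set.ncard_eq_toFinset_card _ (S.finite_nbrs i j x), S.ncard_nbrs hx.symm]
  have hn_eq (x' : V) : n x' = {y ∈ Y | y ∈ S.nbrs i j x'}.card := by
    simp only [hn]
    rw [Set.ncard_eq_toFinset_card _ ((S.finite_nbrs i j x).inter_of_left (S.nbrs i j x'))]
    congr 1; ext; simp [hY]
  have hxD : x ∈ finD.toFinset := finD.mem_toFinset.2 ⟨a, ⟨hα.symm, hv.symm⟩, rfl⟩
  -- Double counting: each of the `q` neighbours of `x` has exactly `q` neighbours at `(i, j)`, all
  -- over `v`.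
  have sumCh : ∑ x' ∈ finCh.toFinset, n x' = q * q := by
    simp only [hn_eq, Finset.card_filter]
    rw [Finset.sum_comm, Finset.sum_congr rfl (g := fun _ => q)]
    · rw [Finset.sum_const, hYcard, smul_eq_mul]
    · intro y hy
      obtain ⟨ω, hω, hωy⟩ : y ∈ S.nbrs i j x := by simpa [hY] using hy
      have hfin : (S.X i j '' S.F (i + 1) (j - 1) y).Finite :=
        (Set.encard_le_coe_iff_finite_ncard_le.1 (by
          have h := S.encard_left_le (i + 1) j y
          rwa [add_sub_cancel_right] at h)).1
      rw [← Finset.card_filter]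
      refine Eq.trans ?_ (S.ncard_right_parents hωy)
      rw [Set.ncard_eq_toFinset_card _ hfin]
      congr 1
      ext x'
      simp only [Finset.mem_filter, Set.Finite.mem_toFinset]
      constructor
      · rintro ⟨-, ω', h1, h2⟩
        exact ⟨ω', h2, h1⟩
      · rintro ⟨ω', h2, rfl⟩
        refine ⟨⟨ω', ?_, rfl⟩, ω', rfl, h2⟩
        have := right_eq_of_common_nbr (S := S) (a := ω') (b := a) (y := y) ⟨ω', rfl, h2⟩
          (hx ▸ ⟨ω, hω, hωy⟩)
        exact this
  -- Among the vertices over both `α` and `v` only `x` itself shares a neighbour with `x`.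
  have sumD : ∑ x' ∈ finD.toFinset, n x' = q := by
    rw [Finset.sum_eq_single_of_mem x hxD]
    · simp only [hn, Set.inter_self]
      exact S.ncard_nbrs hx.symm
    · intro x' hx' hne
      obtain ⟨ω, ⟨hω1, hω2⟩, rfl⟩ := finD.mem_toFinset.1 hx'
      have : S.nbrs i j x ∩ S.nbrs i j (S.X i j ω) = ∅ := by
        refine Set.eq_empty_of_forall_notMem fun y hy => hne ?_
        exact eq_of_common_nbr (mem_F.1 hω1) hy.2 hy.1
      simp only [hn, this, Set.ncard_empty]
  have hle : ∀ x' ∈ finCh.toFinset \ finD.toFinset, n x' ≤ 1 := by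
    intro x' hx'
    rw [Finset.mem_sdiff] at hx'
    obtain ⟨ω, hω, rfl⟩ := finCh.mem_toFinset.1 hx'.1
    exact S.ncard_common_le fun h => hx'.2 (h ▸ hxD)
  -- The `q ^ 2 - q` vertices left have a total of `q ^ 2 - q` common neighbours, at most one each.
  have hsum : ∑ x' ∈ finCh.toFinset \ finD.toFinset, n x' =
      ∑ x' ∈ finCh.toFinset \ finD.toFinset, 1 := by
    have h1 := Finset.sum_sdiff (f := n) hDCh
    rw [sumCh, sumD] at h1
    have h2 := Finset.card_sdiff_add_card_eq_card hDCh
    rw [hCh, hD] at h2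
    rw [Finset.sum_const, smul_eq_mul, mul_one]
    lia
  refine (Finset.sum_eq_sum_iff_of_le hle).1 hsum _ ?_
  rw [Finset.mem_sdiff]
  refine ⟨finCh.mem_toFinset.2 ⟨b, hr.symm, rfl⟩, fun h => hl ?_⟩
  obtain ⟨ω, ⟨hω1, -⟩, hω2⟩ := finD.mem_toFinset.1 h
  rw [← mem_F.1 hω1]
  exact S.det_left hω2

/-- A step to the right and back returns to `x` with weight `q⁻¹` and reaches with weight `q⁻²` each
vertex over the same `(i, j - 1)` but another `(i - 1, j)`. Except for the first term the result
lies in the range of `Q`, hence is killed by `U`. -/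
theorem spanProj_return (i j : ℤ) (a : Ω) :
    spanProj (S.gensP i j) (spanProj (S.gensP (i + 1) (j - 1)) (ind π (S.F i j (S.X i j a)))) =
      ((q : ℝ)⁻¹ : ℂ) • ind π (S.F i j (S.X i j a)) +
      (((q : ℝ)⁻¹ ^ 2 : ℝ) : ℂ) • (ind π (S.F i (j - 1) (S.X i (j - 1) a)) -
        ind π (S.F (i - 1) j (S.X (i - 1) j a) ∩ S.F i (j - 1) (S.X i (j - 1) a))) := by
  have hsatv := S.saturated_F (le_refl i) (show j - 1 ≤ j by lia) (S.X i (j - 1) a)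
  have hsat := S.saturated_pair i j (S.X (i - 1) j a) (S.X i (j - 1) a)
  refine S.spanProj_gensP_eq ?_ fun b => ?_
  · exact Submodule.add_mem _ (Submodule.smul_mem _ _ (S.ind_F_mem _ _ _))
      (Submodule.smul_mem _ _ (Submodule.sub_mem _
        (S.ind_F_mem_of_le le_rfl (by lia) _)
        (hsat.ind_mem (S.measurableSet_pair _ _ _ _) (S.measure_pair_ne_top _ _ _ _))))
  rw [S.inner_spanProj_right i j, inner_add_right, inner_smul_right, inner_smul_right,
    inner_sub_right, S.inner_ind_F _ _ _ (S.measurableSet_F _ _ _) (S.measure_F_ne_top _ _ _),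
    S.inner_ind_F _ _ _ (S.measurableSet_F _ _ _) (S.measure_F_ne_top _ _ _),
    S.inner_ind_F _ _ _ (S.measurableSet_pair _ _ _ _) (S.measure_pair_ne_top _ _ _ _)]
  have hsq : (q : ℝ)⁻¹ ^ (2 * (i + j) + 2) = (q : ℝ)⁻¹ ^ 2 * (q : ℝ)⁻¹ ^ (2 * (i + j)) := by
    rw [add_comm, zpow_add₀ S.inv_q_pos.ne']; norm_cast
  have hq : (q : ℝ) * (q : ℝ)⁻¹ = 1 := mul_inv_cancel₀ (by have := S.pos; positivity)
  norm_cast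
  have hsub {A : Set Ω} (hs : S.Saturated i j A) (h : b ∈ A) :
      π.real (S.F i j (S.X i j b) ∩ A) = (q : ℝ)⁻¹ ^ (2 * (i + j)) := by
    rw [Set.inter_eq_left.2 (hs b h), S.measureReal_F rfl]
  have hdis {A : Set Ω} (hs : S.Saturated i j A) (h : b ∉ A) :
      π.real (S.F i j (S.X i j b) ∩ A) = 0 := by
    have : S.F i j (S.X i j b) ∩ A = ∅ :=
      Set.eq_empty_of_forall_notMem fun ω hω => h (hs ω hω.2 (mem_F.1 hω.1).symm)
    simp [this]
  rw [hsq]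
  by_cases hv : S.X i (j - 1) b = S.X i (j - 1) a
  · rw [hsub hsatv hv]
    by_cases hα : S.X (i - 1) j b = S.X (i - 1) j a
    · rw [hsub hsat ⟨hα, hv⟩, sub_self, mul_zero, add_zero]
      by_cases hx : S.X i j b = S.X i j a
      · rw [hx, Set.inter_self, Set.inter_self, S.ncard_nbrs rfl, S.measureReal_F rfl]
        linear_combination ((q : ℝ)⁻¹ * (q : ℝ)⁻¹ ^ (2 * (i + j))) * hq
      · have h0 : S.nbrs i j (S.X i j a) ∩ S.nbrs i j (S.X i j b) = ∅ :=
          Set.eq_empty_of_forall_notMem fun y hy => hx (eq_of_common_nbr hα hy.2 hy.1)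
        rw [h0, S.disjoint_F hx]
        simp
    · have hx : S.X i j b ≠ S.X i j a := fun h => hα (S.det_left h)
      rw [hdis hsat fun h => hα h.1, S.disjoint_F hx, S.ncard_common_eq hv.symm (Ne.symm hα)]
      simp
  · have hx : S.X i j b ≠ S.X i j a := fun h => hv (S.det_right h)
    have h0 : S.nbrs i j (S.X i j a) ∩ S.nbrs i j (S.X i j b) = ∅ :=
      Set.eq_empty_of_forall_notMem fun y hy => hv (right_eq_of_common_nbr hy.2 hy.1)
    rw [h0, S.disjoint_F hx, hdis hsatv hv, hdis hsat fun h => hv h.2]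
    simp

theorem spanProj_gensQ_mul_gensP (i j : ℤ) :
    spanProj (S.gensQ i j) * spanProj (S.gensP i j) = spanProj (S.gensQ i j) := by
  refine spanProj_mul_eq_left ?_
  rintro _ ⟨⟨x, y⟩, rfl⟩
  exact (S.saturated_pair i j x y).ind_mem (S.measurableSet_pair _ _ _ _)
    (S.measure_pair_ne_top _ _ _ _)

theorem diff_mul_return (i j : ℤ) :
    (spanProj (S.gensP i j) - spanProj (S.gensQ i j)) * spanProj (S.gensP (i + 1) (j - 1)) *
      spanProj (S.gensP i j) =
    ((q : ℝ)⁻¹ : ℂ) • (spanProj (S.gensP i j) - spanProj (S.gensQ i j)) := by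
  set P := spanProj (S.gensP i j)
  set Q := spanProj (S.gensQ i j)
  set P' := spanProj (S.gensP (i + 1) (j - 1))
  have hP : P * P = P := (isStarProjection_spanProj _).isIdempotentElem
  have hQP : Q * P = Q := S.spanProj_gensQ_mul_gensP i j
  have hUP : (P - Q) * P = P - Q := by rw [sub_mul, hP, hQP]
  have hsmul : ((q : ℝ)⁻¹ : ℂ) • (P - Q) = (((q : ℝ)⁻¹ : ℂ) • (P - Q)) * P := by
    rw [smul_mul_assoc, hUP]
  rw [hsmul]
  refine mul_spanProj_ext ?_
  rintro _ ⟨v, rfl⟩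
  dsimp only
  rcases (S.F i j v).eq_empty_or_nonempty with h | ⟨a, rfl⟩
  · rw [h, ind_empty, map_zero, map_zero]
  · have h0 (f : Lp ℂ 2 π) (hf : f ∈ (Submodule.span ℂ (S.gensQ i j)).topologicalClosure) :
        (P - Q) f = 0 := by
      have h1 : Q f = f := spanProj_eq_self.2 hf
      have h2 : (P - Q) * Q = 0 := by
        have h3 := congrArg star hQP
        simp only [star_mul, P, Q, (isStarProjection_spanProj _).isSelfAdjoint.star_eq] at h3
        rw [sub_mul, (isStarProjection_spanProj _).isIdempotentElem.eq]
        exact sub_eq_zero.2 h3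
      rw [← h1]
      exact DFunLike.congr_fun h2 f
    rw [← hUP]
    change (P - Q) (P (P' _)) = _
    rw [S.spanProj_return, map_add, map_smul, map_smul, map_sub, h0 _ (S.ind_F_mem_gensQ i j _),
      h0 _ (subset_closedSpan _ ⟨(_, _), rfl⟩), sub_zero, smul_zero, add_zero, hUP]
    rfl

/-- The C⋆-identity gives `‖P' U‖ ^ 2 = ‖U P' U‖`, and `diff_mul_return` identifies this product as
`q⁻¹ U`. -/
theorem norm_diff_mul_diff_le (i j : ℤ) :
    ‖(spanProj (S.gensP (i + 1) (j - 1)) - spanProj (S.gensQ (i + 1) (j - 1))) *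
      (spanProj (S.gensP i j) - spanProj (S.gensQ i j))‖ ≤ √((q : ℝ)⁻¹) := by
  set P := spanProj (S.gensP i j) with hPdef
  set Q := spanProj (S.gensQ i j) with hQdef
  set P' := spanProj (S.gensP (i + 1) (j - 1)) with hPdef'
  set Q' := spanProj (S.gensQ (i + 1) (j - 1)) with hQdef'
  have diffProj (i j : ℤ) :
      IsStarProjection (spanProj (S.gensP i j) - spanProj (S.gensQ i j)) := by
    have hP : IsStarProjection (spanProj (S.gensP i j)) := isStarProjection_spanProj _
    have hQ : IsStarProjection (spanProj (S.gensQ i j)) := isStarProjection_spanProj _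
    have h1 := S.spanProj_gensQ_mul_gensP i j
    have h2 := congrArg star h1
    simp only [star_mul, hP.isSelfAdjoint.star_eq, hQ.isSelfAdjoint.star_eq] at h2
    refine ⟨?_, hP.isSelfAdjoint.sub hQ.isSelfAdjoint⟩
    simp only [IsIdempotentElem, mul_sub, sub_mul, h1, h2, hP.isIdempotentElem.eq,
      hQ.isIdempotentElem.eq]
    abel
  have hU := diffProj i j
  have hU' := diffProj (i + 1) (j - 1)
  have hP' : IsStarProjection P' := isStarProjection_spanProj _
  have e1 : (P' - Q') * P' = P' - Q' := by
    rw [sub_mul, hP'.isIdempotentElem.eq, S.spanProj_gensQ_mul_gensP]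
  have e2 : star (P' * (P - Q)) * (P' * (P - Q)) = ((q : ℝ)⁻¹ : ℂ) • (P - Q) := by
    have e3 : P * (P - Q) = P - Q := by
      have hP : IsStarProjection P := isStarProjection_spanProj _
      have h1 := congrArg star (S.spanProj_gensQ_mul_gensP i j)
      simp only [star_mul, (isStarProjection_spanProj _).isSelfAdjoint.star_eq] at h1
      rw [mul_sub, hP.isIdempotentElem.eq, h1]
    rw [star_mul, hU.isSelfAdjoint.star_eq, hP'.isSelfAdjoint.star_eq, mul_assoc,
      ← mul_assoc P', hP'.isIdempotentElem.eq]
    conv_lhs => rw [← e3, ← mul_assoc P', ← mul_assoc, ← mul_assoc, e3, S.diff_mul_return]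
    rw [smul_mul_assoc, hU.isIdempotentElem.eq]
  have h1 : ‖P' * (P - Q)‖ ^ 2 ≤ (q : ℝ)⁻¹ := by
    rw [sq, ← CStarRing.norm_star_mul_self, e2, norm_smul]
    have : ‖((q : ℝ)⁻¹ : ℂ)‖ = (q : ℝ)⁻¹ := by
      rw [norm_inv]; simp
    rw [this]
    exact mul_le_of_le_one_right S.inv_q_pos.le hU.norm_le
  rw [← e1, mul_assoc]
  calc _ ≤ ‖P' - Q'‖ * ‖P' * (P - Q)‖ := norm_mul_le _ _
    _ ≤ 1 * ‖P' * (P - Q)‖ := by gcongr; exact hU'.norm_le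
    _ ≤ _ := by rw [one_mul]; exact Real.le_sqrt_of_sq_le h1

theorem spanProj_gensN_mul_gensP {i j j' : ℤ} (h : j ≤ j') :
    spanProj (S.gensN j') * spanProj (S.gensP i j) = spanProj (S.gensP i j) := by
  refine spanProj_mul_eq_right ?_
  rintro _ ⟨v, rfl⟩
  refine Submodule.topologicalClosure_mono (Submodule.span_mono ?_)
    (S.ind_F_mem_of_le (i' := i) (j' := j') le_rfl h v)
  exact Set.subset_iUnion (fun i => S.gensP i j') i

/-- The projections of a system of coordinates. -/
def projectionField : ProjectionField (Lp ℂ 2 π →L[ℂ] Lp ℂ 2 π) (√((q : ℝ)⁻¹)) where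
  P i j := spanProj (S.gensP i j)
  Q i j := spanProj (S.gensQ i j)
  M i := spanProj (S.gensM i)
  N j := spanProj (S.gensN j)
  isProj_P _ _ := isStarProjection_spanProj _
  isProj_Q _ _ := isStarProjection_spanProj _
  isProj_M _ := isStarProjection_spanProj _
  isProj_N _ := isStarProjection_spanProj _
  P_mul_of_le hi hj := by
    refine spanProj_mul_eq_left ?_
    rintro _ ⟨v, rfl⟩
    exact S.ind_F_mem_of_le hi hj v
  M_mul_P h := S.swap.spanProj_gensN_mul_gensP h
  N_mul_P h := S.spanProj_gensN_mul_gensP h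
  M_mul_eq h := S.swap.spanProj_gensN_mul_eq h
  N_mul_eq h := S.spanProj_gensN_mul_eq h
  Q_mul_P := S.spanProj_gensQ_mul_gensP
  P_right_mul_Q := S.spanProj_right_mul_gensQ
  P_left_mul_Q := S.spanProj_left_mul_gensQ
  norm_le := S.norm_diff_mul_diff_le

end CoordSystem

end

noncomputable section

/-! ### Geometry of the Coxeter complex -/

namespace Coweight

/-- The differences of adjacent vertices. -/
def steps : Finset Coweight := {(1, 0), (0, -1), (-1, 1), (0, 1), (-1, 0), (1, -1)}

/-- The differences of adjacent vertices that raise the type by `1`. -/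
def posSteps : Finset Coweight := {(1, 0), (0, -1), (-1, 1)}

/-- The differences of adjacent vertices that lower the type by `1`. -/
def negSteps : Finset Coweight := {(0, 1), (-1, 0), (1, -1)}

theorem IsChamber.mem {c : Finset Coweight} (h : IsChamber c) : c ∈ coxeterComplex := by
  refine ⟨?_, c, h, subset_rfl⟩
  obtain ⟨v, rfl | rfl⟩ := h <;> exact ⟨v, by simp⟩

theorem IsChamber.card {c : Finset Coweight} (h : IsChamber c) : c.card = 3 := by
  obtain ⟨v, rfl | rfl⟩ := h <;>
  · rw [Finset.card_eq_three]
    refine ⟨_, _, _, ?_, ?_, ?_, rfl⟩ <;>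
    · simp only [fund₁, fund₂, ne_eq, Prod.ext_iff, Prod.fst_add, Prod.snd_add, Prod.fst_sub,
        Prod.snd_sub]
      lia

/-- The chamber `v + {0, λ₁, λ₂}`. -/
def upChamber (v : Coweight) : Finset Coweight := {v, v + fund₁, v + fund₂}

theorem isChamber_up (v : Coweight) : IsChamber (upChamber v) := ⟨v, Or.inl rfl⟩

theorem sub_mem_steps {s : Finset Coweight} (hs : s ∈ coxeterComplex) {p p' : Coweight}
    (hp : p ∈ s) (hp' : p' ∈ s) (hne : p ≠ p') : p' - p ∈ steps := by
  obtain ⟨-, c, ⟨v, rfl | rfl⟩, hsc⟩ := hs <;>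
  · have h1 := hsc hp
    have h2 := hsc hp'
    simp only [Finset.mem_insert, Finset.mem_singleton] at h1 h2
    rcases h1 with rfl | rfl | rfl <;> rcases h2 with rfl | rfl | rfl <;>
      simp [fund₁, fund₂, steps, Prod.ext_iff] at hne ⊢

theorem exists_chamber_of_step {p d : Coweight} (hd : d ∈ steps) :
    ∃ c, IsChamber c ∧ p ∈ c ∧ p + d ∈ c := by
  obtain ⟨a, b⟩ := p
  simp only [steps, Finset.mem_insert, Finset.mem_singleton] at hd
  rcases hd with rfl | rfl | rfl | rfl | rfl | rfl
  · exact ⟨_, ⟨(a, b), Or.inl rfl⟩, by simp, by simp [fund₁]⟩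
  · exact ⟨_, ⟨(a, b), Or.inr rfl⟩, by simp, by simp [fund₁, fund₂, sub_eq_add_neg]⟩
  · exact ⟨_, ⟨(a - 1, b), Or.inl rfl⟩, by simp [fund₁], by
      simp only [fund₁, fund₂, Finset.mem_insert, Finset.mem_singleton, Prod.mk_add_mk,
        Prod.mk.injEq]; lia⟩
  · exact ⟨_, ⟨(a, b), Or.inl rfl⟩, by simp, by simp [fund₂]⟩
  · exact ⟨_, ⟨(a, b), Or.inr rfl⟩, by simp, by
      simp only [fund₁, fund₂, Finset.mem_insert, Finset.mem_singleton, Prod.mk_add_mk,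
        Prod.mk_sub_mk, Prod.mk.injEq]; lia⟩
  · exact ⟨_, ⟨(a, b - 1), Or.inl rfl⟩, by simp [fund₂], by
      simp only [fund₁, fund₂, Finset.mem_insert, Finset.mem_singleton, Prod.mk_add_mk,
        Prod.mk.injEq]; lia⟩

theorem vertexType_add (p p' : Coweight) :
    (p + p').vertexType = p.vertexType + p'.vertexType := by
  simp only [vertexType, Prod.fst_add, Prod.snd_add]
  push_cast
  ring

theorem posSteps_of_type {d : Coweight} (hd : d ∈ steps) (h : d.vertexType = 1) : d ∈ posSteps := by
  simp only [steps, Finset.mem_insert, Finset.mem_singleton] at hd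
  rcases hd with rfl | rfl | rfl | rfl | rfl | rfl <;> first
    | decide
    | (simp only [vertexType] at h; exact absurd h (by decide))

theorem negSteps_of_type {d : Coweight} (hd : d ∈ steps) (h : d.vertexType = -1) :
    d ∈ negSteps := by
  simp only [steps, Finset.mem_insert, Finset.mem_singleton] at hd
  rcases hd with rfl | rfl | rfl | rfl | rfl | rfl <;> first
    | decide
    | (simp only [vertexType] at h; exact absurd h (by decide))

theorem posSteps_subset : posSteps ⊆ steps := by decide

theorem negSteps_subset : negSteps ⊆ steps := by decide

theorem type_of_posSteps {d : Coweight} (hd : d ∈ posSteps) : d.vertexType = 1 := by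
  simp only [posSteps, Finset.mem_insert, Finset.mem_singleton] at hd
  rcases hd with rfl | rfl | rfl <;> (simp only [vertexType]; decide)

theorem type_of_negSteps {d : Coweight} (hd : d ∈ negSteps) : d.vertexType = -1 := by
  simp only [negSteps, Finset.mem_insert, Finset.mem_singleton] at hd
  rcases hd with rfl | rfl | rfl <;> (simp only [vertexType]; decide)

theorem type_ne_of_step {d : Coweight} (hd : d ∈ steps) : d.vertexType ≠ 0 := by
  simp only [steps, Finset.mem_insert, Finset.mem_singleton] at hd
  rcases hd with rfl | rfl | rfl | rfl | rfl | rfl <;> (simp only [vertexType]; decide)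

/-- The images of `(λ₁, λ₂)` under the elements of the finite Weyl group. -/
def weylPairs : Finset (Coweight × Coweight) :=
  {((1, 0), (0, 1)), ((-1, 1), (0, 1)), ((1, 0), (1, -1)), ((-1, 1), (-1, 0)),
    ((0, -1), (1, -1)), ((0, -1), (-1, 0))}

/-- The additive map that sends `(λ₁, λ₂)` to the given pair. -/
def lin (u : Coweight × Coweight) (p : Coweight) : Coweight := p.1 • u.1 + p.2 • u.2

theorem lin_add (u : Coweight × Coweight) (p p' : Coweight) :
    lin u (p + p') = lin u p + lin u p' := by
  simp only [lin, Prod.fst_add, Prod.snd_add, add_smul]; abel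

theorem lin_lin (u u' : Coweight × Coweight) (p : Coweight) :
    lin u (lin u' p) = lin (lin u u'.1, lin u u'.2) p := by
  ext <;> simp only [lin, Prod.smul_fst, Prod.smul_snd, Prod.fst_add, Prod.snd_add, smul_eq_mul] <;>
    ring

theorem lin_weylPairs_mul : ∀ u ∈ weylPairs, ∀ u' ∈ weylPairs,
    (lin u u'.1, lin u u'.2) ∈ weylPairs := by
  decide

theorem exists_weylPairs_inv : ∀ u ∈ weylPairs,
    ∃ u' ∈ weylPairs, (lin u u'.1, lin u u'.2) = ((1, 0), (0, 1)) := by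
  decide

theorem lin_one (p : Coweight) : lin ((1, 0), (0, 1)) p = p := by
  ext <;> simp [lin]

theorem exists_weylPairs_of_mem {w : Equiv.Perm Coweight} (hw : w ∈ finiteWeyl) :
    ∃ u ∈ weylPairs, ∀ p, w p = lin u p := by
  induction hw using Subgroup.closure_induction with
  | mem w hw =>
    rcases hw with rfl | rfl
    · refine ⟨((-1, 1), (0, 1)), by decide, fun p => ?_⟩
      change ((-p.1, p.1 + p.2) : Coweight) = _
      ext <;> simp [lin]
    · refine ⟨((1, 0), (1, -1)), by decide, fun p => ?_⟩
      change ((p.1 + p.2, -p.2) : Coweight) = _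
      ext <;> simp [lin]
  | one => exact ⟨((1, 0), (0, 1)), by decide, fun p => (lin_one p).symm⟩
  | mul w w' _ _ ih ih' =>
    obtain ⟨u, hu, h⟩ := ih
    obtain ⟨u', hu', h'⟩ := ih'
    exact ⟨_, lin_weylPairs_mul u hu u' hu', fun p => by
      rw [Equiv.Perm.mul_apply, h', h, lin_lin]⟩
  | inv w _ ih =>
    obtain ⟨u, hu, h⟩ := ih
    obtain ⟨u', hu', e⟩ := exists_weylPairs_inv u hu
    exact ⟨u', hu', fun p => by
      rw [Equiv.Perm.inv_eq_iff_eq, h, lin_lin, e, lin_one]⟩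

theorem isChamber_weylPairs {u : Coweight × Coweight} (hu : u ∈ weylPairs) (b : Coweight) :
    IsChamber {b, b + u.1, b + u.2} := by
  obtain ⟨x, y⟩ := b
  simp only [weylPairs, Finset.mem_insert, Finset.mem_singleton] at hu
  rcases hu with rfl | rfl | rfl | rfl | rfl | rfl
  · exact ⟨(x, y), Or.inl rfl⟩
  · refine ⟨(x, y + 1), Or.inr ?_⟩
    ext ⟨c, d⟩; simp only [fund₁, fund₂, Finset.mem_insert, Finset.mem_singleton, Prod.mk_add_mk,
      Prod.mk_sub_mk, Prod.mk.injEq]; lia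
  · refine ⟨(x + 1, y), Or.inr ?_⟩
    ext ⟨c, d⟩; simp only [fund₁, fund₂, Finset.mem_insert, Finset.mem_singleton, Prod.mk_add_mk,
      Prod.mk_sub_mk, Prod.mk.injEq]; lia
  · refine ⟨(x - 1, y), Or.inl ?_⟩
    ext ⟨c, d⟩; simp only [fund₁, fund₂, Finset.mem_insert, Finset.mem_singleton, Prod.mk_add_mk,
      Prod.mk.injEq]; lia
  · refine ⟨(x, y - 1), Or.inl ?_⟩
    ext ⟨c, d⟩; simp only [fund₁, fund₂, Finset.mem_insert, Finset.mem_singleton, Prod.mk_add_mk,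
      Prod.mk.injEq]; lia
  · refine ⟨(x, y), Or.inr ?_⟩
    ext ⟨c, d⟩; simp only [fund₁, fund₂, Finset.mem_insert, Finset.mem_singleton, Prod.mk_add_mk,
      Prod.mk_sub_mk, Prod.mk.injEq]; lia

/-- An injective type-preserving simplicial map of the Coxeter complex to itself is an affine map
with linear part in the finite Weyl group. -/
theorem exists_affine {g : Coweight → Coweight} (hinj : Function.Injective g)
    (htype : ∀ p, (g p).vertexType = p.vertexType)
    (hstep : ∀ p p', p' - p ∈ steps → g p' - g p ∈ steps) :
    ∃ u ∈ weylPairs, ∀ p, g p = g 0 + lin u p := by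
  have hpos (v d : Coweight) (hd : d ∈ posSteps) : g (v + d) - g v ∈ posSteps := by
    refine posSteps_of_type (hstep _ _ (by simpa using posSteps_subset hd)) ?_
    have h := vertexType_add (g (v + d) - g v) (g v)
    rw [sub_add_cancel, htype, htype, vertexType_add, type_of_posSteps hd, add_comm] at h
    exact (add_right_cancel h).symm
  have hneg (v d : Coweight) (hd : d ∈ negSteps) : g (v + d) - g v ∈ negSteps := by
    refine negSteps_of_type (hstep _ _ (by simpa using negSteps_subset hd)) ?_
    have h := vertexType_add (g (v + d) - g v) (g v)
    rw [sub_add_cancel, htype, htype, vertexType_add, type_of_negSteps hd, add_comm] at h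
    exact (add_right_cancel h).symm
  have hadj (v d d' : Coweight) (hd : d' - d ∈ steps) :
      (g (v + d') - g v) - (g (v + d) - g v) ∈ steps := by
    rw [sub_sub_sub_cancel_right]
    exact hstep _ _ (by simpa using hd)
  have hne (v d d' : Coweight) (hd : d ≠ d') : g (v + d) - g v ≠ g (v + d') - g v :=
    fun h => hd (add_left_cancel (hinj (sub_left_injective h)))
  -- The six steps form a hexagon with alternating types; a negative step is the sum of its two
  -- positive neighbours. Around each vertex `g` thus respects sums, which forces it to be affine.
  have sum_two : ∀ a ∈ posSteps, ∀ a' ∈ posSteps, a ≠ a' → ∀ b ∈ negSteps,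
      b - a ∈ steps → b - a' ∈ steps → b = a + a' := by decide
  have sum_three : ∀ a ∈ posSteps, ∀ a' ∈ posSteps, ∀ a'' ∈ posSteps, a ≠ a' → a ≠ a'' →
      a' ≠ a'' → a + a' + a'' = 0 := by decide
  have comb (v a a' b : Coweight) (ha : a ∈ posSteps) (ha' : a' ∈ posSteps) (hb : b ∈ negSteps)
      (h : a ≠ a') (h1 : b - a ∈ steps) (h2 : b - a' ∈ steps) :
      g (v + b) - g v = (g (v + a) - g v) + (g (v + a') - g v) :=
    sum_two _ (hpos v a ha) _ (hpos v a' ha') (hne v a a' h) _ (hneg v b hb)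
      (hadj v a b h1) (hadj v a' b h2)
  have comb3 (v : Coweight) := sum_three _ (hpos v (1, 0) (by decide)) _
    (hpos v (-1, 1) (by decide)) _ (hpos v (0, -1) (by decide)) (hne v _ _ (by decide))
    (hne v _ _ (by decide)) (hne v _ _ (by decide))
  have c1 (v : Coweight) := comb v (1, 0) (-1, 1) (0, 1) (by decide) (by decide) (by decide)
    (by decide) (by decide) (by decide)
  have c2 (v : Coweight) := comb v (-1, 1) (0, -1) (-1, 0) (by decide) (by decide) (by decide)
    (by decide) (by decide) (by decide)
  have mid1 (i j : ℤ) : g (i + 1, j) - g (i, j) = g (i, j) - g (i - 1, j) := by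
    have h1 := comb3 (i, j)
    have h2 := c2 (i, j)
    simp only [Prod.mk_add_mk, add_zero, ← sub_eq_add_neg] at h1 h2
    rw [add_assoc, ← h2] at h1
    rw [eq_neg_of_add_eq_zero_left h1, neg_sub]
  have mid2 (i j : ℤ) : g (i, j + 1) - g (i, j) = g (i, j) - g (i, j - 1) := by
    have h1 := comb3 (i, j)
    have h2 := c1 (i, j)
    simp only [Prod.mk_add_mk, add_zero, ← sub_eq_add_neg] at h1 h2
    rw [← h2] at h1
    rw [eq_neg_of_add_eq_zero_left h1, neg_sub]
  have shift (i j : ℤ) : g (i, j + 1) - g (i, j) = g (i - 1, j + 1) - g (i - 1, j) := by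
    have h1 := c1 (i, j)
    have h2 := mid1 i j
    simp only [Prod.mk_add_mk, add_zero, ← sub_eq_add_neg] at h1 h2
    rw [h1, h2]; abel
  have const (f : ℤ → Coweight) (h : ∀ n, f n = f (n - 1)) (n : ℤ) : f n = f 0 := by
    induction n using Int.induction_on with
    | zero => rfl
    | succ n ih => rw [h, add_sub_cancel_right, ih]
    | pred n ih => rw [← h, ih]
  have hv (i j : ℤ) : g (i, j + 1) - g (i, j) = g (0, 1) - g (0, 0) := by
    rw [const (fun i => g (i, j + 1) - g (i, j)) (fun i => shift i j) i]
    exact const (fun j => g (0, j + 1) - g (0, j)) (fun j => by simpa using mid2 0 j) j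
  have hh (i j : ℤ) : g (i + 1, j) - g (i, j) = g (1, 0) - g (0, 0) := by
    rw [const (fun i => g (i + 1, j) - g (i, j)) (fun i => by simpa using mid1 i j) i]
    refine const (fun j => g (0 + 1, j) - g (0, j)) (fun j => ?_) j
    have h1 := hv (0 + 1) (j - 1)
    rw [← hv 0 (j - 1)] at h1
    simp only [sub_add_cancel] at h1
    rw [sub_eq_sub_iff_add_eq_add] at h1 ⊢
    rw [h1]; abel
  have linear (f : ℤ → Coweight) (c : Coweight) (h : ∀ n, f (n + 1) - f n = c) (n : ℤ) :
      f n = f 0 + n • c := by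
    have := const (fun n => f n - n • c) (fun n => by
      have := h (n - 1)
      rw [sub_add_cancel, sub_eq_iff_eq_add] at this
      rw [this, sub_smul, one_smul]; abel) n
    simp only [zero_smul, sub_zero] at this
    rw [← this]; abel
  refine ⟨(g (1, 0) - g (0, 0), g (0, 1) - g (0, 0)), ?_, fun p => ?_⟩
  · have pairs : ∀ a ∈ posSteps, ∀ b ∈ negSteps, b - a ∈ steps → (a, b) ∈ weylPairs := by decide
    have h1 := hpos (0, 0) (1, 0) (by decide)
    have h2 := hneg (0, 0) (0, 1) (by decide)
    have h3 := hadj (0, 0) (1, 0) (0, 1) (by decide)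
    simp only [Prod.mk_add_mk, zero_add] at h1 h2 h3
    exact pairs _ h1 _ h2 h3
  · obtain ⟨i, j⟩ := p
    rw [linear (fun j => g (i, j)) _ (fun j => hv i j) j,
      linear (fun i => g (i, 0)) _ (fun i => hh i 0) i, lin, add_assoc]
    rfl

end Coweight

end

noncomputable section

namespace Coweight

/-- A map that sends the steps `λ₁` and `λ₂` to steps of the same type and fixes the ends of a
parallelogram fixes the whole parallelogram. -/
theorem fixed_of_fixed_ends {f : Coweight → Coweight} (h₁ : ∀ p, f (p + (1, 0)) - f p ∈ posSteps)
    (h₂ : ∀ p, f (p + (0, 1)) - f p ∈ negSteps) {a b p : Coweight} (ha : f a = a) (hb : f b = b)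
    (hap : a ≤ p) (hpb : p ≤ b) : f p = p := by
  have zero_zero (p : Coweight) : p + ((0 : ℤ), (0 : ℤ)) = p := add_zero p
  -- A step of this type raises the level by at most 1, with equality only for the step itself. As
  -- the ends are fixed, a monotone path between them leaves no room for loss, so each of its steps
  -- is preserved.
  have l₁ : ∀ d ∈ posSteps, d.level ≤ 1 ∧ (d.level = 1 → d = (1, 0)) := by
    simp only [level]; decide
  have l₂ : ∀ d ∈ negSteps, d.level ≤ 1 ∧ (d.level = 1 → d = (0, 1)) := by
    simp only [level]; decide
  have level_sub (p p' : Coweight) : (p - p').level = p.level - p'.level := by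
    simp only [level, Prod.fst_sub, Prod.snd_sub]; ring
  have up₁ (p : Coweight) (m : ℕ) : (f (p + ((m : ℤ), 0))).level ≤ (f p).level + m := by
    induction m with
    | zero => simp [zero_zero]
    | succ m ih =>
      have h := (l₁ _ (h₁ (p + ((m : ℤ), 0)))).1
      rw [level_sub] at h
      rw [show p + (((m + 1 : ℕ) : ℤ), 0) = p + ((m : ℤ), 0) + (1, 0) by ext <;> simp [add_assoc]]
      push_cast; lia
  have up₂ (p : Coweight) (m : ℕ) : (f (p + (0, (m : ℤ)))).level ≤ (f p).level + m := by
    induction m with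
    | zero => simp [zero_zero]
    | succ m ih =>
      have h := (l₂ _ (h₂ (p + (0, (m : ℤ))))).1
      rw [level_sub] at h
      rw [show p + (0, ((m + 1 : ℕ) : ℤ)) = p + (0, (m : ℤ)) + (0, 1) by ext <;> simp [add_assoc]]
      push_cast; lia
  have up {p p' : Coweight} (h : p ≤ p') : (f p').level ≤ (f p).level + (p'.level - p.level) := by
    obtain ⟨m, hm⟩ : ∃ m : ℕ, (m : ℤ) = p'.1 - p.1 :=
      ⟨(p'.1 - p.1).toNat, Int.toNat_of_nonneg (sub_nonneg.2 h.1)⟩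
    obtain ⟨n, hn⟩ : ∃ n : ℕ, (n : ℤ) = p'.2 - p.2 :=
      ⟨(p'.2 - p.2).toNat, Int.toNat_of_nonneg (sub_nonneg.2 h.2)⟩
    have e : p' = p + ((m : ℤ), 0) + (0, (n : ℤ)) := by ext <;> simp [hm, hn]
    have h1 := up₁ p m
    have h2 := up₂ (p + ((m : ℤ), 0)) n
    rw [← e] at h2
    simp only [level] at *
    lia
  have hlevel {p : Coweight} (hap : a ≤ p) (hpb : p ≤ b) : (f p).level = p.level := by
    have h1 := up hap
    have h2 := up hpb
    rw [ha] at h1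
    rw [hb] at h2
    lia
  obtain ⟨m, hm⟩ : ∃ m : ℕ, (m : ℤ) = p.1 - a.1 :=
    ⟨(p.1 - a.1).toNat, Int.toNat_of_nonneg (sub_nonneg.2 hap.1)⟩
  obtain ⟨n, hn⟩ : ∃ n : ℕ, (n : ℤ) = p.2 - a.2 :=
    ⟨(p.2 - a.2).toNat, Int.toNat_of_nonneg (sub_nonneg.2 hap.2)⟩
  have key₁ : ∀ k : ℕ, k ≤ m → f (a + ((k : ℤ), 0)) = a + ((k : ℤ), 0) := by
    intro k
    induction k with
    | zero => intro _; simpa [zero_zero] using ha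
    | succ k ih =>
      intro hk
      have e : a + (((k + 1 : ℕ) : ℤ), 0) = a + ((k : ℤ), 0) + (1, 0) := by ext <;> simp [add_assoc]
      have hle (k : ℕ) (hk : k ≤ m) : a ≤ a + ((k : ℤ), 0) ∧ a + ((k : ℤ), 0) ≤ b := by
        have h1 := hpb.1
        have h2 := hap.2.trans hpb.2
        refine ⟨⟨?_, ?_⟩, ⟨?_, ?_⟩⟩ <;> simp only [Prod.fst_add, Prod.snd_add] <;> lia
      have h1 := hlevel (hle k (by lia)).1 (hle k (by lia)).2
      have h2 := hlevel (hle (k + 1) hk).1 (hle (k + 1) hk).2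
      have h3 := (l₁ _ (h₁ (a + ((k : ℤ), 0)))).2
      rw [← e, level_sub, h1, h2, ih (by lia)] at h3
      rw [sub_eq_iff_eq_add'.1 (h3 (by simp [level])), e]
  have key₂ : ∀ k : ℕ, k ≤ n → f (a + ((m : ℤ), 0) + (0, (k : ℤ))) = a + ((m : ℤ), 0) + (0, (k : ℤ)) := by
    intro k
    induction k with
    | zero => intro _; simpa [zero_zero] using key₁ m le_rfl
    | succ k ih =>
      intro hk
      have e : a + ((m : ℤ), 0) + (0, ((k + 1 : ℕ) : ℤ)) = a + ((m : ℤ), 0) + (0, (k : ℤ)) + (0, 1) := by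
        ext <;> simp [add_assoc]
      have hle (k : ℕ) (hk : k ≤ n) :
          a ≤ a + ((m : ℤ), 0) + (0, (k : ℤ)) ∧ a + ((m : ℤ), 0) + (0, (k : ℤ)) ≤ b := by
        have h1 := hpb.1
        have h2 := hpb.2
        refine ⟨⟨?_, ?_⟩, ⟨?_, ?_⟩⟩ <;> simp only [Prod.fst_add, Prod.snd_add] <;> lia
      have h1 := hlevel (hle k (by lia)).1 (hle k (by lia)).2
      have h2 := hlevel (hle (k + 1) hk).1 (hle (k + 1) hk).2
      have h3 := (l₂ _ (h₂ (a + ((m : ℤ), 0) + (0, (k : ℤ))))).2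
      rw [← e, level_sub, h1, h2, ih (by lia)] at h3
      rw [sub_eq_iff_eq_add'.1 (h3 (by simp [level])), e]
  have e : p = a + ((m : ℤ), 0) + (0, (n : ℤ)) := by ext <;> simp [hm, hn]
  rw [e]
  exact key₂ n le_rfl

end Coweight

/-! ### Charts and apartments -/

namespace ApartmentChart

open Coweight

variable {V : Type u} {K : AbstractSimplicialComplex V} {typ : V → ZMod 3}

theorem ext {φ ψ : ApartmentChart K typ} (h : ∀ p, φ.toFun p = ψ.toFun p) : φ = ψ := by
  cases φ; cases ψ
  congr
  exact funext h

/-- The image of a simplex of the Coxeter complex. -/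
def face (φ : ApartmentChart K typ) (s : Finset Coweight) : Finset V :=
  s.map ⟨φ.toFun, φ.injective⟩

variable (φ : ApartmentChart K typ)

theorem mem_face {s : Finset Coweight} {p : Coweight} : φ.toFun p ∈ φ.face s ↔ p ∈ s :=
  Finset.mem_map' ⟨φ.toFun, φ.injective⟩

theorem exists_of_mem_face {s : Finset Coweight} {v : V} (h : v ∈ φ.face s) :
    ∃ p ∈ s, φ.toFun p = v := Finset.mem_map.1 h

theorem card_face (s : Finset Coweight) : (φ.face s).card = s.card := Finset.card_map _

theorem coe_face (s : Finset Coweight) : (φ.face s : Set V) = φ.toFun '' s := Finset.coe_map _ _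

theorem face_mem {s : Finset Coweight} (hs : s ∈ coxeterComplex) : φ.face s ∈ K :=
  φ.simplicial s hs _ (φ.coe_face s)

theorem face_mem_simplexes {s : Finset Coweight} (hs : s ∈ coxeterComplex) :
    φ.face s ∈ φ.simplexes :=
  ⟨s, hs, φ.coe_face s⟩

theorem exists_face {t : Finset V} (ht : t ∈ φ.simplexes) : ∃ s ∈ coxeterComplex, t = φ.face s := by
  obtain ⟨s, hs, h⟩ := ht
  exact ⟨s, hs, Finset.coe_injective (h.trans (φ.coe_face s).symm)⟩

theorem mem_vertices (p : Coweight) : φ.toFun p ∈ φ.vertices := ⟨p, rfl⟩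

theorem mem_vertices_of_mem {t : Finset V} (ht : t ∈ φ.simplexes) {v : V} (hv : v ∈ t) :
    v ∈ φ.vertices := by
  obtain ⟨s, -, rfl⟩ := φ.exists_face ht
  obtain ⟨p, -, rfl⟩ := φ.exists_of_mem_face hv
  exact φ.mem_vertices p

variable {φ} in
theorem vertices_subset {ψ : ApartmentChart K typ} (h : φ.simplexes = ψ.simplexes) :
    φ.vertices ⊆ ψ.vertices := by
  rintro _ ⟨p, rfl⟩
  have h1 := φ.face_mem_simplexes (isChamber_up p).mem
  rw [h] at h1
  exact ψ.mem_vertices_of_mem h1 (φ.mem_face.2 (by simp [upChamber]))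

variable {φ} in
/-- Two charts of the same apartment differ by an element of the affine Weyl group. -/
theorem exists_affine_of_simplexes_eq {ψ : ApartmentChart K typ}
    (h : φ.simplexes = ψ.simplexes) :
    ∃ (b : Coweight), ∃ u ∈ weylPairs, ∀ p, φ.toFun p = ψ.toFun (b + lin u p) := by
  choose g hg using fun p => vertices_subset h (φ.mem_vertices p)
  obtain ⟨u, hu, hgu⟩ := exists_affine (g := g)
    (fun p p' e => φ.injective (by rw [← hg, e, hg]))
    (fun p => by rw [← ψ.type_eq, hg, φ.type_eq])
    (fun p p' hs => by
      obtain ⟨c, hc, h1, h2⟩ := exists_chamber_of_step (p := p) hs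
      rw [add_sub_cancel] at h2
      have h3 := φ.face_mem_simplexes hc.mem
      rw [h] at h3
      obtain ⟨s, hs', e⟩ := ψ.exists_face h3
      have h4 (r : Coweight) (hr : r ∈ c) : g r ∈ s := by
        rw [← ψ.mem_face, ← e, hg]
        exact φ.mem_face.2 hr
      refine sub_mem_steps hs' (h4 p h1) (h4 p' h2) fun e' => ?_
      have e2 : p = p' := φ.injective (by rw [← hg, e', hg])
      rw [e2, sub_self] at hs
      exact absurd hs (by decide))
  exact ⟨g 0, u, hu, fun p => by rw [← hgu, hg]⟩

/-- The composition of a chart with a type-preserving translation. -/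
def translate (c : Coweight) (hc : c.vertexType = 0) : ApartmentChart K typ where
  toFun p := φ.toFun (c + p)
  injective := φ.injective.comp (add_right_injective c)
  type_eq p := by rw [φ.type_eq, vertexType_add, hc, zero_add]
  simplicial s hs t ht := by
    refine φ.simplicial (s.map (addLeftEmbedding c)) ?_ t ?_
    swap
    · rw [ht, Finset.coe_map, Set.image_image]; rfl
    obtain ⟨hne, d, ⟨v, hd⟩, hsd⟩ := hs
    refine ⟨hne.map, d.map (addLeftEmbedding c), ⟨c + v, ?_⟩, Finset.map_subset_map.2 hsd⟩
    rcases hd with rfl | rfl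
    · left; simp [add_assoc]
    · right; simp [add_sub_assoc]

end ApartmentChart

namespace TriangleBuilding

open Coweight

variable {V : Type u} {q : ℕ} {X : TriangleBuilding V q}

/-- For every chamber of an apartment and every simplex there is an apartment that contains both,
with a chart that agrees with the given one wherever possible. -/
theorem exists_chart (φ : X.Chart) {c : Finset Coweight} (hc : IsChamber c) {t : Finset V}
    (ht : t ∈ X.complex) :
    ∃ η : X.Chart, t ∈ η.simplexes ∧ (∀ p, φ.toFun p ∈ η.vertices → η.toFun p = φ.toFun p) ∧
      ∀ p ∈ c, η.toFun p = φ.toFun p := by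
  obtain ⟨ψ, h1, h2⟩ := X.exists_apartment _ (φ.face_mem hc.mem) _ ht
  obtain ⟨η, hη, h3⟩ := X.exists_iso φ ψ
    ⟨_, ⟨φ.face_mem_simplexes hc.mem, h1⟩, by rw [φ.card_face, hc.card]⟩
  refine ⟨η, hη ▸ h2, fun p hp => h3 p (ApartmentChart.vertices_subset hη hp), fun p hp => h3 p ?_⟩
  exact ψ.mem_vertices_of_mem h1 (φ.mem_face.2 hp)

/-- Apartments are full subcomplexes. -/
theorem exists_simplex (φ : X.Chart) {t : Finset V} (ht : t ∈ X.complex) :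
    ∃ s ∈ coxeterComplex, ∀ p, φ.toFun p ∈ t → p ∈ s := by
  obtain ⟨η, h1, h2, -⟩ := exists_chart φ (isChamber_up 0) ht
  obtain ⟨s, hs, rfl⟩ := η.exists_face h1
  refine ⟨s, hs, fun p hp => ?_⟩
  have h3 := h2 p (η.mem_vertices_of_mem h1 hp)
  rw [← h3] at hp
  exact η.mem_face.1 hp

theorem mem_simplexes_of_subset (φ : X.Chart) {t : Finset V} (ht : t ∈ X.complex)
    (h : ∀ v ∈ t, v ∈ φ.vertices) : t ∈ φ.simplexes := by
  classical
  obtain ⟨s, hs, hs'⟩ := exists_simplex φ ht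
  have e : (t : Set V) = φ.toFun '' (s.filter fun p => φ.toFun p ∈ t : Finset Coweight) := by
    ext v
    constructor
    · intro hv
      obtain ⟨p, rfl⟩ := h v hv
      exact ⟨p, by simpa using ⟨hs' p hv, hv⟩, rfl⟩
    · rintro ⟨p, hp, rfl⟩
      simp only [Finset.coe_filter, Set.mem_ofPred_eq] at hp
      exact hp.2
  refine ⟨_, ⟨?_, ?_⟩, e⟩
  · obtain ⟨v, hv⟩ := (X.complex.isRelLowerSet_faces ht).1
    have hv' : v ∈ (t : Set V) := hv
    rw [e] at hv'
    obtain ⟨p, hp, -⟩ := hv'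
    exact ⟨p, hp⟩
  · obtain ⟨-, c, hc, hsc⟩ := hs
    exact ⟨c, hc, (Finset.filter_subset _ _).trans hsc⟩

/-- Two charts that agree on a chamber agree wherever their apartments meet. -/
theorem eq_of_mem_vertices {φ ψ : X.Chart} {c : Finset Coweight} (hc : IsChamber c)
    (h : ∀ p ∈ c, φ.toFun p = ψ.toFun p) {p : Coweight} (hp : φ.toFun p ∈ ψ.vertices) :
    ψ.toFun p = φ.toFun p := by
  have hface : φ.face c = ψ.face c := by
    ext v
    constructor
    · intro hv
      obtain ⟨p, hp, rfl⟩ := φ.exists_of_mem_face hv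
      rw [h p hp]; exact ψ.mem_face.2 hp
    · intro hv
      obtain ⟨p, hp, rfl⟩ := ψ.exists_of_mem_face hv
      rw [← h p hp]; exact φ.mem_face.2 hp
  obtain ⟨χ, h1, h2⟩ := X.exists_iso φ ψ ⟨φ.face c, ⟨φ.face_mem_simplexes hc.mem,
    hface ▸ ψ.face_mem_simplexes hc.mem⟩, by rw [φ.card_face, hc.card]⟩
  obtain ⟨b, u, hu, hχ⟩ := ApartmentChart.exists_affine_of_simplexes_eq h1
  have fix (r : Coweight) (hr : r ∈ c) : b + lin u r = r := by
    refine ψ.injective ?_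
    rw [← hχ, h2 r (by rw [h r hr]; exact ψ.mem_vertices r), h r hr]
  -- An affine map fixing the three vertices of a chamber is the identity.
  have key : ∀ r, b + lin u r = r := by
    obtain ⟨v, rfl | rfl⟩ := hc
    · have e0 := fix v (by simp)
      have e1 := fix (v + fund₁) (by simp)
      have e2 := fix (v + fund₂) (by simp)
      rw [lin_add, ← add_assoc, e0, add_right_inj] at e1 e2
      intro r
      simp only [lin, fund₁, fund₂, one_smul, zero_smul, add_zero, zero_add] at e1 e2
      have hu : u = ((1, 0), (0, 1)) := Prod.ext e1 e2
      rw [hu, lin_one] at e0 ⊢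
      rw [add_eq_right.1 e0, zero_add]
    · have e0 := fix v (by simp)
      have e1 := fix (v - fund₁) (by simp)
      have e2 := fix (v - fund₂) (by simp)
      rw [sub_eq_add_neg, lin_add, ← add_assoc, e0, add_right_inj] at e1 e2
      intro r
      simp only [lin, fund₁, fund₂, Prod.neg_mk, neg_smul, one_smul, neg_zero, zero_smul, add_zero,
        zero_add, neg_eq_iff_eq_neg] at e1 e2
      have hu : u = ((1, 0), (0, 1)) := Prod.ext (by simpa using e1) (by simpa using e2)
      rw [hu, lin_one] at e0 ⊢
      rw [add_eq_right.1 e0, zero_add]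
  rw [← h2 p hp, hχ, key]

/-- The set where two charts agree is convex. -/
theorem eq_of_eq_ends {φ ψ : X.Chart} {a b p : Coweight} (ha : φ.toFun a = ψ.toFun a)
    (hb : φ.toFun b = ψ.toFun b) (hap : a ≤ p) (hpb : p ≤ b) : φ.toFun p = ψ.toFun p := by
  set c := upChamber p with hcdef
  have hc : IsChamber c := isChamber_up p
  have hpc : p ∈ c := by simp [hcdef, upChamber]
  -- The retraction onto the apartment of `φ` centred at the chamber `c`. Composed with `ψ` it
  -- becomes a type-preserving simplicial map `f` fixing `a` and `b`, hence `p`; since `p` belongs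
  -- to the centre, this means `ψ p = φ p`.
  let Retr (x : V) (r : Coweight) : Prop :=
    ∃ η : X.Chart, (∀ s ∈ c, η.toFun s = φ.toFun s) ∧ η.toFun r = x
  have uniq {x : V} {r r' : Coweight} (h : Retr x r) (h' : Retr x r') : r = r' := by
    obtain ⟨η, h1, h2⟩ := h
    obtain ⟨η', h1', h2'⟩ := h'
    have h3 := eq_of_mem_vertices hc (fun s hs => (h1 s hs).trans (h1' s hs).symm)
      (p := r) (by rw [h2, ← h2']; exact η'.mem_vertices r')
    exact η'.injective (by rw [h3, h2, h2'])
  have exist (t : Finset V) (ht : t ∈ X.complex) :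
      ∃ s ∈ coxeterComplex, ∀ x ∈ t, ∃ r ∈ s, Retr x r := by
    obtain ⟨η, h1, -, h2⟩ := exists_chart φ hc ht
    obtain ⟨s, hs, rfl⟩ := η.exists_face h1
    refine ⟨s, hs, fun x hx => ?_⟩
    obtain ⟨r, hr, rfl⟩ := η.exists_of_mem_face hx
    exact ⟨r, hr, η, h2, rfl⟩
  have exist' (r : Coweight) : ∃ r', Retr (ψ.toFun r) r' := by
    obtain ⟨s, -, h⟩ := exist _ (ψ.face_mem (isChamber_up r).mem)
    obtain ⟨r', -, h'⟩ := h _ (ψ.mem_face.2 (show r ∈ upChamber r by simp [upChamber]))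
    exact ⟨r', h'⟩
  choose f hf using exist'
  have typf (r : Coweight) : (f r).vertexType = r.vertexType := by
    obtain ⟨η, -, h⟩ := hf r
    rw [← η.type_eq, h, ψ.type_eq]
  have stepf (r d : Coweight) (hd : d ∈ steps) : f (r + d) - f r ∈ steps := by
    obtain ⟨c', hc', h1, h2⟩ := exists_chamber_of_step (p := r) hd
    obtain ⟨s, hs, h⟩ := exist _ (ψ.face_mem hc'.mem)
    obtain ⟨r1, hr1, hR1⟩ := h _ (ψ.mem_face.2 h1)
    obtain ⟨r2, hr2, hR2⟩ := h _ (ψ.mem_face.2 h2)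
    rw [uniq (hf r) hR1, uniq (hf (r + d)) hR2]
    refine sub_mem_steps hs hr1 hr2 fun e => type_ne_of_step hd ?_
    have h3 := typf (r + d)
    rw [uniq (hf (r + d)) hR2, ← e, ← uniq (hf r) hR1, typf, vertexType_add] at h3
    simpa using h3.symm
  have typd (r d : Coweight) : (f (r + d) - f r).vertexType = d.vertexType := by
    have h := vertexType_add (f (r + d) - f r) (f r)
    rw [sub_add_cancel, typf, typf, vertexType_add, add_comm] at h
    exact (add_right_cancel h).symm
  have h1 : f p = p := by
    refine fixed_of_fixed_ends
      (fun r => posSteps_of_type (stepf r _ (by decide)) ((typd _ _).trans ?_))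
      (fun r => negSteps_of_type (stepf r _ (by decide)) ((typd _ _).trans ?_))
      (uniq (hf a) ⟨φ, fun _ _ => rfl, ha⟩) (uniq (hf b) ⟨φ, fun _ _ => rfl, hb⟩) hap hpb
    · exact type_of_posSteps (by decide)
    · exact type_of_negSteps (by decide)
  obtain ⟨η, h2, h3⟩ := hf p
  rw [h1, h2 p hpc] at h3
  exact h3

/-! ### Sectors -/

theorem mem_fundSector {p : Coweight} : p ∈ fundSector ↔ 0 ≤ p := Iff.rfl

/-- A sector contained in an apartment is a sector of that apartment. -/
theorem exists_sector_in_chart (χ ψ : X.Chart) (b : Coweight) {u : Coweight × Coweight}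
    (hu : u ∈ weylPairs) (h : ∀ p, 0 ≤ p → χ.toFun (b + lin u p) ∈ ψ.vertices) :
    ∃ (b' : Coweight), ∃ u' ∈ weylPairs, ∀ p, 0 ≤ p →
      χ.toFun (b + lin u p) = ψ.toFun (b' + lin u' p) := by
  have hc := isChamber_weylPairs hu b
  have hmem : ∀ v ∈ χ.face {b, b + u.1, b + u.2}, v ∈ ψ.vertices := by
    intro v hv
    obtain ⟨p, hp, rfl⟩ := χ.exists_of_mem_face hv
    simp only [Finset.mem_insert, Finset.mem_singleton] at hp
    rcases hp with rfl | rfl | rfl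
    · simpa [lin] using h 0 le_rfl
    · simpa [lin] using h (1, 0) (by decide)
    · simpa [lin] using h (0, 1) (by decide)
  obtain ⟨η, h1, h2⟩ := X.exists_iso χ ψ ⟨χ.face {b, b + u.1, b + u.2},
    ⟨χ.face_mem_simplexes hc.mem, mem_simplexes_of_subset ψ (χ.face_mem hc.mem) hmem⟩,
    by rw [χ.card_face, hc.card]⟩
  obtain ⟨b', u', hu', hη⟩ := ApartmentChart.exists_affine_of_simplexes_eq h1
  refine ⟨b' + lin u' b, _, lin_weylPairs_mul u' hu' u hu, fun p hp => ?_⟩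
  rw [← h2 _ (h p hp), hη, lin_add, lin_lin, add_assoc]

/-- Nested sectors of the Coxeter complex have the same direction. -/
theorem weylPairs_eq_of_subset {b b' : Coweight} {u u' : Coweight × Coweight} (hu : u ∈ weylPairs)
    (hu' : u' ∈ weylPairs) (h : ∀ p, 0 ≤ p → ∃ p', 0 ≤ p' ∧ b + lin u p = b' + lin u' p') :
    u = u' := by
  obtain ⟨v', hv', e'⟩ := exists_weylPairs_inv u' hu'
  obtain ⟨v, hv, e⟩ := exists_weylPairs_inv v' hv'
  have hinv (p : Coweight) : lin u' (lin v' p) = p := by rw [lin_lin, e', lin_one]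
  have hinv2 (p : Coweight) : lin v' (lin u' p) = p := by
    have hvp : lin v p = lin u' p := by
      rw [← hinv (lin v p), lin_lin v' v, e, lin_one]
    rw [← hvp, lin_lin, e, lin_one]
  set c := lin v' (b - b') with hc
  have hw := lin_weylPairs_mul v' hv' u hu
  set w := (lin v' u.1, lin v' u.2) with hwdef
  have key (p : Coweight) (hp : 0 ≤ p) : 0 ≤ c + lin w p := by
    obtain ⟨p', hp', e⟩ := h p hp
    have : c + lin w p = p' := by
      rw [hc, hwdef, ← lin_lin, ← lin_add, sub_add_eq_add_sub, e, add_sub_cancel_left, hinv2]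
    rwa [this]
  have hw1 : w = ((1, 0), (0, 1)) := by
    -- The coordinate `|c.1| + |c.2| + 1` outweighs the offset `c`, so a negative entry of `w` would
    -- leave the sector.
    have k1 := key (|c.1| + |c.2| + 1, 0) ⟨by positivity, le_rfl⟩
    have k2 := key (0, |c.1| + |c.2| + 1) ⟨le_rfl, by positivity⟩
    have a1 := le_abs_self c.1
    have a2 := le_abs_self c.2
    have a3 := abs_nonneg c.1
    have a4 := abs_nonneg c.2
    simp only [weylPairs, Finset.mem_insert, Finset.mem_singleton] at hw
    rcases hw with hw | hw | hw | hw | hw | hw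
    · exact hw
    all_goals
      rw [hw] at k1 k2
      simp only [lin, Prod.smul_mk, smul_eq_mul, Prod.le_def, Prod.fst_add, Prod.snd_add,
        Prod.fst_zero, Prod.snd_zero] at k1 k2
      exfalso
      lia
  have h1 (p : Coweight) : lin u p = lin u' p := by
    rw [← hinv (lin u p), lin_lin v' u, ← hwdef, hw1, lin_one]
  have h2 := h1 (1, 0)
  have h3 := h1 (0, 1)
  simp only [lin, one_smul, zero_smul, add_zero, zero_add] at h2 h3
  exact Prod.ext h2 h3

theorem exists_common (u : Coweight × Coweight) (hu : u ∈ weylPairs) (b b' : Coweight) :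
    ∃ p p' : Coweight, 0 ≤ p ∧ 0 ≤ p' ∧ b + lin u p = b' + lin u p' := by
  obtain ⟨v, -, e⟩ := exists_weylPairs_inv u hu
  set c := lin v (b' - b) with hc
  have h1 : lin u c = b' - b := by rw [hc, lin_lin, e, lin_one]
  refine ⟨c ⊔ 0, (c ⊔ 0) - c, le_sup_right, sub_nonneg.2 le_sup_left, ?_⟩
  have h2 := lin_add u (c ⊔ 0 - c) c
  rw [sub_add_cancel] at h2
  rw [h2, h1]; abel

/-- The set contains a subsector of given direction of the apartment `ψ`. -/
def ContainsSector (ψ : X.Chart) (u : Coweight × Coweight) (S : Set V) : Prop :=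
  ∃ b : Coweight, ∀ p, 0 ≤ p → ψ.toFun (b + lin u p) ∈ S

theorem exists_of_isSector {S : Set V} (h : X.IsSector S) :
    ∃ (φ : X.Chart) (b : Coweight), ∃ u ∈ weylPairs,
      S = {x | ∃ p, 0 ≤ p ∧ φ.toFun (b + lin u p) = x} := by
  obtain ⟨φ, b, w, hw, rfl⟩ := h
  obtain ⟨u, hu, h⟩ := exists_weylPairs_of_mem hw
  refine ⟨φ, b, u, hu, ?_⟩
  ext x
  simp only [sector, Set.mem_image, mem_fundSector, Set.mem_ofPred_eq]
  constructor
  · rintro ⟨_, ⟨p, hp, rfl⟩, rfl⟩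
    exact ⟨p, hp, by rw [h]⟩
  · rintro ⟨p, hp, rfl⟩
    exact ⟨_, ⟨p, hp, rfl⟩, by rw [h]⟩

/-- Inside an apartment containing `S`, both the given sector of `ψ` and the common subsector `R`
have the direction of `S`. They therefore share a subsector, which lies in `R` and so in `T`. -/
theorem ContainsSector.of_equiv {ψ : X.Chart} {u : Coweight × Coweight} (hu : u ∈ weylPairs)
    {S T : X.Sector} (hST : X.SectorEquiv S T) (h : ContainsSector ψ u S.1) :
    ContainsSector ψ u T.1 := by
  obtain ⟨R, hRS, hRT⟩ := hST
  obtain ⟨b, hb⟩ := h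
  obtain ⟨η, s, us, hus, hS⟩ := exists_of_isSector S.2
  obtain ⟨χ, r, ur, hur, hR⟩ := exists_of_isSector R.2
  have hSη : ∀ x ∈ S.1, x ∈ η.vertices := by
    intro x hx
    rw [hS] at hx
    obtain ⟨p, -, rfl⟩ := hx
    exact η.mem_vertices _
  have hRmem (p : Coweight) (hp : 0 ≤ p) : χ.toFun (r + lin ur p) ∈ R.1 := by
    rw [hR]; exact ⟨p, hp, rfl⟩
  obtain ⟨r', u₁, hu₁, h₁⟩ := exists_sector_in_chart χ η r hur
    fun p hp => hSη _ (hRS (hRmem p hp))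
  obtain ⟨b₁, u₂, hu₂, h₂⟩ := exists_sector_in_chart ψ η b hu fun p hp => hSη _ (hb p hp)
  have hS' (x : Coweight) (hx : η.toFun x ∈ S.1) : ∃ p', 0 ≤ p' ∧ x = s + lin us p' := by
    rw [hS] at hx
    obtain ⟨p, hp, e⟩ := hx
    exact ⟨p, hp, η.injective e.symm⟩
  have e₁ : u₁ = us := weylPairs_eq_of_subset hu₁ hus fun p hp =>
    hS' _ (by rw [← h₁ p hp]; exact hRS (hRmem p hp))
  have e₂ : u₂ = us := weylPairs_eq_of_subset hu₂ hus fun p hp =>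
    hS' _ (by rw [← h₂ p hp]; exact hb p hp)
  subst e₂
  subst e₁
  obtain ⟨p₀, p₀', hp₀, hp₀', e⟩ := exists_common u₁ hu₁ b₁ r'
  refine ⟨b + lin u p₀, fun p hp => hRT ?_⟩
  rw [add_assoc, ← lin_add, h₂ _ (add_nonneg hp₀ hp), lin_add, ← add_assoc, e, add_assoc,
    ← lin_add, ← h₁ _ (add_nonneg hp₀' hp)]
  exact hRmem _ (add_nonneg hp₀' hp)

/-- Containment of a sector of `ψ` is an invariant of the quotient, so transitivity of `SectorEquiv`
is never needed. -/
theorem ContainsSector.of_quot_eq {ψ : X.Chart} {u : Coweight × Coweight} (hu : u ∈ weylPairs)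
    {S T : X.Sector} (hST : Quot.mk X.SectorEquiv S = Quot.mk X.SectorEquiv T)
    (h : ContainsSector ψ u S.1) : ContainsSector ψ u T.1 := by
  let P : X.Boundary → Prop := Quot.lift (fun S => ContainsSector ψ u S.1) fun S T hST =>
    propext ⟨of_equiv hu hST, of_equiv hu (by
      obtain ⟨R, h1, h2⟩ := hST
      exact ⟨R, h2, h1⟩)⟩
  have : P (Quot.mk _ S) = P (Quot.mk _ T) := by rw [hST]
  exact (iff_of_eq this).1 h

/-- The image of `λ₁, λ₂` under the longest element. -/
def oppPair : Coweight × Coweight := ((0, -1), (-1, 0))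

/-- The fundamental direction. -/
def idPair : Coweight × Coweight := ((1, 0), (0, 1))

theorem oppPair_mem : oppPair ∈ weylPairs := by decide

theorem idPair_mem : idPair ∈ weylPairs := by decide

theorem lin_oppPair (p : Coweight) : lin oppPair p = (-p.2, -p.1) := by
  ext <;> simp [lin, oppPair]

theorem lin_idPair (p : Coweight) : lin idPair p = p := lin_one p

theorem mem_oppSector {p : Coweight} : p ∈ oppSector ↔ p ≤ 0 := Iff.rfl

theorem mem_oppSector_iff {p : Coweight} : p ≤ 0 ↔ ∃ p', 0 ≤ p' ∧ p = lin oppPair p' := by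
  constructor
  · intro h
    refine ⟨(-p.2, -p.1), ⟨neg_nonneg.2 h.2, neg_nonneg.2 h.1⟩, ?_⟩
    rw [lin_oppPair]; simp
  · rintro ⟨p', hp', rfl⟩
    rw [lin_oppPair]
    exact ⟨neg_nonpos.2 hp'.2, neg_nonpos.2 hp'.1⟩

theorem top_translate (φ : X.Chart) (c : Coweight) (hc : c.vertexType = 0) :
    Chart.top (φ.translate c hc) = φ.top := by
  refine Quot.sound ⟨⟨φ.toFun '' sector (c ⊔ 0) 1, φ, _, 1, one_mem _, rfl⟩, ?_, ?_⟩
  · rintro _ ⟨_, ⟨p, hp, rfl⟩, rfl⟩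
    refine ⟨c ⊔ 0 + p - c, ?_, ?_⟩
    · rw [mem_fundSector]
      exact sub_nonneg.2 (le_add_of_le_of_nonneg le_sup_left hp)
    · change φ.toFun _ = φ.toFun _
      rw [add_sub_cancel]; rfl
  · rintro _ ⟨_, ⟨p, hp, rfl⟩, rfl⟩
    exact ⟨_, add_nonneg le_sup_right (mem_fundSector.1 hp), rfl⟩

theorem bottom_translate (φ : X.Chart) (c : Coweight) (hc : c.vertexType = 0) :
    Chart.bottom (φ.translate c hc) = φ.bottom := by
  have hsec : ∀ b : Coweight, ∀ x ∈ sector b (refl₁ * refl₂ * refl₁), ∃ p ≤ 0, x = b + p := by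
    rintro b _ ⟨p, hp, rfl⟩
    refine ⟨(refl₁ * refl₂ * refl₁) p, ?_, rfl⟩
    have h : (refl₁ * refl₂ * refl₁) p ∈ oppSector := by
      rw [oppSector_eq_sector]
      exact ⟨p, hp, by simp⟩
    exact h
  refine Quot.sound ⟨⟨φ.toFun '' sector (c ⊓ 0) (refl₁ * refl₂ * refl₁), φ, _, _,
    longest_mem_finiteWeyl, rfl⟩, ?_, ?_⟩
  · rintro _ ⟨x, hx, rfl⟩
    obtain ⟨p, hp, rfl⟩ := hsec _ x hx
    refine ⟨c ⊓ 0 + p - c, ?_, ?_⟩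
    · rw [mem_oppSector]
      exact sub_nonpos.2 (add_le_of_le_of_nonpos inf_le_left hp)
    · change φ.toFun _ = φ.toFun _
      rw [add_sub_cancel]
  · rintro _ ⟨x, hx, rfl⟩
    obtain ⟨p, hp, rfl⟩ := hsec _ x hx
    exact ⟨_, add_nonpos inf_le_right hp, rfl⟩

/-- The chart agrees with `φ₀` on a subsector of the sector that represents `ω₀`. -/
def Normal (φ₀ φ : X.Chart) : Prop := ∃ b : Coweight, ∀ p ≤ b, φ.toFun p = φ₀.toFun p

theorem normal_iff {φ₀ φ : X.Chart} :
    Normal φ₀ φ ↔ ∃ b : Coweight, ∀ s ∈ oppSector, φ.toFun (b + s) = φ₀.toFun (b + s) := by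
  constructor
  · rintro ⟨b, h⟩
    exact ⟨b, fun s hs => h _ (add_le_of_le_of_nonpos le_rfl hs)⟩
  · rintro ⟨b, h⟩
    refine ⟨b, fun p hp => ?_⟩
    have := h (p - b) (sub_nonpos.2 hp)
    rwa [add_sub_cancel] at this

/-- The apartment of `φ` contains a subsector of the sector of `φ₀` at ω₀, and in both charts it
points in the direction opposite to the fundamental one. The charts thus differ there by a
translation, of type 0 since types are preserved. -/
theorem exists_normal {φ₀ φ : X.Chart} (h : φ.bottom = φ₀.bottom) :
    ∃ (c : Coweight) (hc : c.vertexType = 0), Normal φ₀ (φ.translate c hc) := by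
  have h0 : ContainsSector φ₀ oppPair (φ₀.toFun '' oppSector) := by
    refine ⟨0, fun p hp => ⟨_, mem_oppSector_iff.2 ⟨p, hp, rfl⟩, ?_⟩⟩
    rw [zero_add]
  obtain ⟨b', hb'⟩ := ContainsSector.of_quot_eq (S := ⟨φ₀.toFun '' oppSector, _⟩)
    (T := ⟨φ.toFun '' oppSector, _⟩) oppPair_mem h.symm h0
  have hmem (p : Coweight) (hp : 0 ≤ p) :
      ∃ p' ≤ 0, φ.toFun p' = φ₀.toFun (b' + lin oppPair p) := hb' p hp
  obtain ⟨b₁, u₁, hu₁, h₁⟩ := exists_sector_in_chart φ₀ φ b' oppPair_mem fun p hp => by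
    obtain ⟨p', -, e⟩ := hmem p hp
    exact ⟨p', e⟩
  have hu : u₁ = oppPair := weylPairs_eq_of_subset (b := b₁) (b' := 0) hu₁ oppPair_mem
    fun p hp => by
      obtain ⟨p', hp', e⟩ := hmem p hp
      obtain ⟨p'', hp'', e''⟩ := mem_oppSector_iff.1 hp'
      refine ⟨p'', hp'', ?_⟩
      rw [zero_add, ← e'']
      exact φ.injective (by rw [e, h₁ p hp])
  subst hu
  have hc : (b₁ - b').vertexType = 0 := by
    have h2 := h₁ 0 le_rfl
    simp only [lin, Prod.fst_zero, Prod.snd_zero, zero_smul, add_zero] at h2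
    have h3 : b₁.vertexType = b'.vertexType := by rw [← φ.type_eq, ← h2, φ₀.type_eq]
    have h4 := vertexType_add (b₁ - b') b'
    rw [sub_add_cancel, h3] at h4
    exact add_eq_right.1 h4.symm
  refine ⟨b₁ - b', hc, b', fun p hp => ?_⟩
  obtain ⟨p', hp', e⟩ := mem_oppSector_iff.1 (sub_nonpos.2 hp)
  change φ.toFun (b₁ - b' + p) = _
  rw [show p = b' + lin oppPair p' by rw [← e, add_sub_cancel], h₁ p' hp']
  congr 1; abel

/-- Two normal charts agree on a chamber far down towards ω₀. This makes ρ well defined. -/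
theorem Normal.eq_of_mem_vertices {φ₀ φ ψ : X.Chart} (hφ : Normal φ₀ φ) (hψ : Normal φ₀ ψ)
    {p : Coweight} (hp : φ.toFun p ∈ ψ.vertices) : ψ.toFun p = φ.toFun p := by
  obtain ⟨b, hb⟩ := hφ
  obtain ⟨b', hb'⟩ := hψ
  refine TriangleBuilding.eq_of_mem_vertices ⟨b ⊓ b', Or.inr rfl⟩ (fun r hr => ?_) hp
  have hr : r ≤ b ⊓ b' := by
    simp only [Finset.mem_insert, Finset.mem_singleton] at hr
    rcases hr with rfl | rfl | rfl
    · exact le_rfl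
    · exact sub_le_self _ (by decide)
    · exact sub_le_self _ (by decide)
  rw [hb r (hr.trans inf_le_left), hb' r (hr.trans inf_le_right)]

/-- Convexity between `p` and a point far down towards ω₀, where both charts coincide with `φ₀`. -/
theorem Normal.eq_of_le {φ₀ φ ψ : X.Chart} (hφ : Normal φ₀ φ) (hψ : Normal φ₀ ψ) {p r : Coweight}
    (hp : φ.toFun p = ψ.toFun p) (hr : r ≤ p) : φ.toFun r = ψ.toFun r := by
  obtain ⟨b, hb⟩ := hφ
  obtain ⟨b', hb'⟩ := hψ
  refine eq_of_eq_ends (a := b ⊓ b' ⊓ r) ?_ hp inf_le_right hr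
  rw [hb _ (inf_le_left.trans inf_le_left), hb' _ (inf_le_left.trans inf_le_right)]

/-- Agreement on a common subsector at the top spreads downwards to every vertex. This is the
uniqueness of [ω, ω₀]. -/
theorem Normal.eq_of_top_eq {φ₀ φ ψ : X.Chart} (hφ : Normal φ₀ φ) (hψ : Normal φ₀ ψ)
    (h : φ.top = ψ.top) : φ = ψ := by
  have h0 : ContainsSector φ idPair (φ.toFun '' fundSector) :=
    ⟨0, fun p hp => ⟨p, hp, by rw [lin_idPair, zero_add]⟩⟩
  obtain ⟨b, hb⟩ := ContainsSector.of_quot_eq (S := ⟨φ.toFun '' fundSector, _⟩)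
    (T := ⟨ψ.toFun '' fundSector, _⟩) idPair_mem h h0
  refine ApartmentChart.ext fun p => ?_
  refine hφ.eq_of_le hψ (p := b ⊔ p) ?_ le_sup_right
  have h1 := hb (b ⊔ p - b) (sub_nonneg.2 le_sup_left)
  rw [lin_idPair, add_sub_cancel] at h1
  refine (hφ.eq_of_mem_vertices hψ ?_).symm
  obtain ⟨r, -, hr⟩ := h1
  exact ⟨r, hr⟩

end TriangleBuilding

end

noncomputable section

theorem Coweight.IsChamber.ne {a b c : Coweight} (h : IsChamber {a, b, c}) :
    a ≠ b ∧ a ≠ c ∧ b ≠ c := by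
  have h := h.card
  refine ⟨?_, ?_, ?_⟩ <;> rintro rfl
  · have h' := Finset.card_le_two (a := a) (b := c)
    simp only [Finset.insert_eq_of_mem, Finset.mem_insert_self] at h
    lia
  · have h' := Finset.card_le_two (a := b) (b := a)
    rw [Finset.insert_comm, Finset.pair_eq_singleton] at h
    lia
  · have h' := Finset.card_le_two (a := a) (b := b)
    rw [Finset.pair_eq_singleton] at h
    lia

/-! ### Local geometry of the building and the coordinates on Ω₀. -/

namespace TriangleBuilding

open Coweight

variable {V : Type u} {q : ℕ} {X : TriangleBuilding V q}

theorem pos_of_chart (φ : X.Chart) : 0 < q := by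
  have h₁ : IsChamber {(0, 0), (1, 0), (0, 1)} := ⟨0, Or.inl rfl⟩
  have h₂ : IsChamber {(1, 0), (0, 0), (1, -1)} := ⟨(1, 0), Or.inr rfl⟩
  have he : ({(0, 0), (1, 0)} : Finset Coweight) ∈ coxeterComplex :=
    ⟨⟨_, Finset.mem_insert_self _ _⟩, _, h₁, by decide⟩
  have hcard := X.card_chambers _ (φ.face_mem he) (by rw [φ.card_face]; decide)
  have hmem {c : Finset Coweight} (hc : IsChamber c) (hec : {(0, 0), (1, 0)} ⊆ c) :
      φ.face c ∈ {c : Finset V | c ∈ X.complex ∧ c.card = 3 ∧ φ.face {(0, 0), (1, 0)} ⊆ c} :=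
    ⟨φ.face_mem hc.mem, by rw [φ.card_face, hc.card], Finset.map_subset_map.2 hec⟩
  have h := (Set.one_lt_ncard_iff (Set.finite_of_ncard_pos (by rw [hcard]; lia))).2
    ⟨_, _, hmem h₁ (by decide), hmem h₂ (by decide), fun e => by
      have := φ.mem_face.1 (e ▸ φ.mem_face.2 (show ((0, 1) : Coweight) ∈ _ by decide))
      exact absurd this (by decide)⟩
  lia

/-- In the link of a vertex there is no cycle of length four. -/
theorem eq_or_eq_of_four_cycle {y x z w w' : V}
    (h₁ : ∃ t ∈ X.complex, y ∈ t ∧ x ∈ t ∧ w ∈ t) (h₂ : ∃ t ∈ X.complex, y ∈ t ∧ z ∈ t ∧ w' ∈ t)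
    (h₃ : ∃ t ∈ X.complex, z ∈ t ∧ w ∈ t) (h₄ : ∃ t ∈ X.complex, x ∈ t ∧ w' ∈ t)
    (hz : X.typ z = X.typ x) (hw : X.typ w' = X.typ w) (hyx : X.typ y ≠ X.typ x)
    (hyw : X.typ y ≠ X.typ w) (hxw : X.typ x ≠ X.typ w) : x = z ∨ w = w' := by
  obtain ⟨t₁, ht₁, hy₁, hx₁, hw₁⟩ := h₁
  obtain ⟨t₂, ht₂, hy₂, hz₂, hw₂⟩ := h₂
  obtain ⟨φ, hφ₁, hφ₂⟩ := X.exists_apartment _ ht₁ _ ht₂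
  obtain ⟨y, rfl⟩ := φ.mem_vertices_of_mem hφ₁ hy₁
  obtain ⟨x, rfl⟩ := φ.mem_vertices_of_mem hφ₁ hx₁
  obtain ⟨w, rfl⟩ := φ.mem_vertices_of_mem hφ₁ hw₁
  obtain ⟨z, rfl⟩ := φ.mem_vertices_of_mem hφ₂ hz₂
  obtain ⟨w', rfl⟩ := φ.mem_vertices_of_mem hφ₂ hw₂
  have adj {p p' : Coweight} (h : ∃ t ∈ X.complex, φ.toFun p ∈ t ∧ φ.toFun p' ∈ t)
      (hne : X.typ (φ.toFun p) ≠ X.typ (φ.toFun p')) : p' - p ∈ steps := by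
    obtain ⟨t, ht, hp, hp'⟩ := h
    obtain ⟨s, hs, h⟩ := exists_simplex φ ht
    exact sub_mem_steps hs (h _ hp) (h _ hp') fun e => hne (by rw [e])
  have hexagon : ∀ a ∈ steps, ∀ b ∈ steps, ∀ c ∈ steps, a ≠ b → c - a ∈ steps → c - b ∈ steps →
      c = a + b := by decide
  -- All five vertices lie in one apartment. If `x ≠ z`, the hexagon around `y` gives both `w - y`
  -- and `w' - y` the value `(x - y) + (z - y)`.
  by_contra! hne
  have sub {p p' : Coweight} (h : p' - p ∈ steps) : (p' - y) - (p - y) ∈ steps := by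
    rwa [sub_sub_sub_cancel_right]
  have hx := adj ⟨t₁, ht₁, hy₁, hx₁⟩ hyx
  have hz' := adj ⟨t₂, ht₂, hy₂, hz₂⟩ (by rwa [hz])
  have hxz : x - y ≠ z - y := fun e => hne.1 (congrArg _ (sub_left_injective e))
  have e₁ := hexagon _ hx _ hz' _ (adj ⟨t₁, ht₁, hy₁, hw₁⟩ hyw) hxz
    (sub (adj ⟨t₁, ht₁, hx₁, hw₁⟩ hxw)) (sub (adj h₃ (by rwa [hz])))
  have e₂ := hexagon _ hx _ hz' _ (adj ⟨t₂, ht₂, hy₂, hw₂⟩ (by rwa [hw])) hxz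
    (sub (adj h₄ (by rwa [hw]))) (sub (adj ⟨t₂, ht₂, hz₂, hw₂⟩ (by rwa [hz, hw])))
  exact hne.2 (congrArg _ (sub_left_injective (e₁.trans e₂.symm)))

/-! ### The coordinates on `Ω₀` -/

variable {φ₀ : X.Chart}

theorem exists_coordChart (ω : Omega₀ φ₀) :
    ∃ φ : X.Chart, φ.top = ω.1 ∧ φ.bottom = φ₀.bottom ∧ Normal φ₀ φ := by
  obtain ⟨φ, h1, h2⟩ := ω.2
  obtain ⟨c, hc, hn⟩ := exists_normal h2
  exact ⟨φ.translate c hc, (top_translate φ c hc).trans h1, (bottom_translate φ c hc).trans h2, hn⟩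

/-- The chart of the apartment `[ω, ω₀]` that is compatible with `φ₀`. -/
def coordChart (ω : Omega₀ φ₀) : X.Chart := (exists_coordChart ω).choose

theorem coordChart_top (ω : Omega₀ φ₀) : (coordChart ω).top = ω.1 :=
  (exists_coordChart ω).choose_spec.1

theorem coordChart_bottom (ω : Omega₀ φ₀) : (coordChart ω).bottom = φ₀.bottom :=
  (exists_coordChart ω).choose_spec.2.1

theorem normal_coordChart (ω : Omega₀ φ₀) : Normal φ₀ (coordChart ω) :=
  (exists_coordChart ω).choose_spec.2.2

/-- The vertex of the apartment `[ω, ω₀]` that retracts to `p`. -/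
def coord (p : Coweight) (ω : Omega₀ φ₀) : V := (coordChart ω).toFun p

theorem coord_eq_of_le {p r : Coweight} (h : r ≤ p) {ω ω' : Omega₀ φ₀}
    (hp : coord p ω = coord p ω') : coord r ω = coord r ω' :=
  (normal_coordChart ω).eq_of_le (normal_coordChart ω') hp h

theorem retractsTo_iff {x : V} {p : Coweight} :
    RetractsTo φ₀ x p ↔ ∃ φ : X.Chart, Normal φ₀ φ ∧ φ.toFun p = x := by
  simp only [RetractsTo, normal_iff]

theorem retractsTo_coord (p : Coweight) (ω : Omega₀ φ₀) : RetractsTo φ₀ (coord p ω) p :=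
  retractsTo_iff.2 ⟨_, normal_coordChart ω, rfl⟩

theorem E_eq {x : V} {p : Coweight} (h : RetractsTo φ₀ x p) : E φ₀ x = coord p ⁻¹' {x} := by
  obtain ⟨ψ, hψ, rfl⟩ := retractsTo_iff.1 h
  ext ω
  constructor
  · rintro ⟨φ, h1, h2, h3⟩
    obtain ⟨c, hc, hn⟩ := exists_normal h2
    have e : φ.translate c hc = coordChart ω := hn.eq_of_top_eq (normal_coordChart ω)
      (by rw [top_translate, h1, coordChart_top])
    obtain ⟨r, hr⟩ := h3
    refine hψ.eq_of_mem_vertices (normal_coordChart ω) ⟨r - c, ?_⟩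
    rw [← e, ← hr]
    change φ.toFun _ = _
    rw [add_sub_cancel]
  · intro hω
    exact ⟨_, coordChart_top ω, coordChart_bottom ω, p, hω⟩

/-- The sets `E_x` with `ρ x = p`. -/
def gens (φ₀ : X.Chart) (p : Coweight) : Set (Set (Omega₀ φ₀)) :=
  {A | ∃ x, RetractsTo φ₀ x p ∧ A = E φ₀ x}

/-- The measure of `E_x` is positive, so `E_x` is nonempty and `x` is a value of the coordinate; no
separate geometric argument for this is needed. -/
theorem mem_gens {π : Measure (Omega₀ φ₀)} (hπ : IsBoundaryMeasure φ₀ π) {p : Coweight}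
    {A : Set (Omega₀ φ₀)} :
    A ∈ gens φ₀ p ↔ ∃ ω : Omega₀ φ₀, A = coord p ⁻¹' {coord p ω} := by
  constructor
  · rintro ⟨x, hx, rfl⟩
    have h := hπ x p hx
    have hq : (q : ℝ≥0∞) ≠ 0 := by exact_mod_cast (pos_of_chart φ₀).ne'
    have h0 : π (E φ₀ x) ≠ 0 := by
      rw [h]; exact (ENNReal.zpow_pos hq (ENNReal.natCast_ne_top q) _).ne'
    obtain ⟨ω, hω⟩ := nonempty_of_measure_ne_zero h0
    rw [E_eq hx] at hω ⊢
    exact ⟨ω, by rw [show coord p ω = x from hω]⟩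
  · rintro ⟨ω, rfl⟩
    exact ⟨_, retractsTo_coord p ω, (E_eq (retractsTo_coord p ω)).symm⟩

theorem measurableSet_coord (p : Coweight) (v : V) :
    MeasurableSet (coord (φ₀ := φ₀) p ⁻¹' {v}) := by
  rcases (coord (φ₀ := φ₀) p ⁻¹' {v}).eq_empty_or_nonempty with h | ⟨ω, rfl⟩
  · rw [h]; exact MeasurableSet.empty
  · refine filt_le φ₀ p _ (MeasurableSpace.measurableSet_generateFrom
      ⟨_, retractsTo_coord p ω, (E_eq (retractsTo_coord p ω)).symm⟩)

theorem measure_coord {π : Measure (Omega₀ φ₀)} (hπ : IsBoundaryMeasure φ₀ π) (p : Coweight)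
    (ω : Omega₀ φ₀) : π (coord p ⁻¹' {coord p ω}) = (q : ℝ≥0∞) ^ (-2 * p.level) := by
  rw [← E_eq (retractsTo_coord p ω), hπ _ p (retractsTo_coord p ω)]

theorem measure_coord_ne_top {π : Measure (Omega₀ φ₀)} (hπ : IsBoundaryMeasure φ₀ π)
    (p : Coweight) (v : V) : π (coord p ⁻¹' {v}) ≠ ∞ := by
  rcases (coord (φ₀ := φ₀) p ⁻¹' {v}).eq_empty_or_nonempty with h | ⟨ω, rfl⟩
  · simp [h]
  · rw [measure_coord hπ]
    exact ENNReal.zpow_ne_top (by exact_mod_cast (pos_of_chart φ₀).ne')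
      (ENNReal.natCast_ne_top q) _

theorem measureReal_coord {π : Measure (Omega₀ φ₀)} (hπ : IsBoundaryMeasure φ₀ π) (p : Coweight)
    (ω : Omega₀ φ₀) :
    π.real (coord p ⁻¹' {coord p ω}) = (q : ℝ)⁻¹ ^ (2 * (p.1 + p.2)) := by
  have hq : (q : NNReal) ≠ 0 := by exact_mod_cast (pos_of_chart φ₀).ne'
  rw [measureReal_def, measure_coord hπ, ← ENNReal.coe_natCast, ← ENNReal.coe_zpow hq,
    ENNReal.coe_toReal, NNReal.coe_zpow, NNReal.coe_natCast, inv_zpow', neg_mul, level]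

/-- Every [ω, ω₀] agrees with `φ₀` far enough down the diagonal below `p`. Over a fixed vertex there
the coordinate at `p` takes finitely many values, because its atoms have equal positive measure. -/
theorem countable_range_coord {π : Measure (Omega₀ φ₀)} (hπ : IsBoundaryMeasure φ₀ π)
    (p : Coweight) : (Set.range (coord (φ₀ := φ₀) p)).Countable := by
  have hfin (v : V) (r : Coweight) (hr : r ≤ p) :
      (coord p '' (coord (φ₀ := φ₀) r ⁻¹' {v})).Finite := by
    refine finite_image_of_le_measureReal (π := π) (c := (q : ℝ)⁻¹ ^ (2 * (p.1 + p.2)))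
      (fun w => (measurableSet_coord r v).inter (measurableSet_coord p w))
      (measure_coord_ne_top hπ r v) ?_ fun ω hω => ?_
    · have := pos_of_chart φ₀
      positivity
    · rw [Set.inter_eq_right.2, measureReal_coord hπ]
      intro ω' hω'
      exact (coord_eq_of_le hr hω').trans hω
  refine (Set.countable_iUnion fun n : ℕ => (hfin (φ₀.toFun (p - ((n : ℤ), (n : ℤ))))
    (p - ((n : ℤ), (n : ℤ))) (sub_le_self p ⟨Int.natCast_nonneg n, Int.natCast_nonneg n⟩)).countable).mono ?_
  rintro _ ⟨ω, rfl⟩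
  obtain ⟨b, hb⟩ := normal_coordChart ω
  refine Set.mem_iUnion.2 ⟨(max (p.1 - b.1) (p.2 - b.2)).toNat, ω, hb _ ⟨?_, ?_⟩, rfl⟩
  · simp only [Prod.fst_sub]; lia
  · simp only [Prod.snd_sub]; lia

theorem typ_coord (p : Coweight) (ω : Omega₀ φ₀) : X.typ (coord p ω) = p.vertexType :=
  (coordChart ω).type_eq p

theorem typ_coord_ne {s : Finset Coweight} (hs : s ∈ coxeterComplex) {p p' : Coweight} (hp : p ∈ s)
    (hp' : p' ∈ s) (hne : p ≠ p') (ω ω' : Omega₀ φ₀) :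
    X.typ (coord p ω) ≠ X.typ (coord p' ω') := by
  rw [typ_coord, typ_coord]
  intro e
  have h1 := vertexType_add (p' - p) p
  rw [sub_add_cancel, e] at h1
  exact type_ne_of_step (sub_mem_steps hs hp hp' hne) (add_eq_right.1 h1.symm)

theorem coord_ne {p p' : Coweight} (h : p ≠ p') (ω : Omega₀ φ₀) : coord p ω ≠ coord p' ω :=
  fun e => h ((coordChart ω).injective e)

theorem exists_simplex_coord {s : Finset Coweight} (hs : s ∈ coxeterComplex) (ω : Omega₀ φ₀) :
    ∃ t ∈ X.complex, ∀ p ∈ s, coord p ω ∈ t :=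
  ⟨_, (coordChart ω).face_mem hs, fun _ hp => (coordChart ω).mem_face.2 hp⟩

/-- If two adjacent chambers of `Σ` are given and the first one is fixed, then there are at most
`q` vertices that complete the second one. -/
theorem encard_coord_le {a b c d : Coweight} (hc : IsChamber {a, b, c}) (hd : IsChamber {a, b, d})
    (hcd : c ≠ d) {A : Set (Omega₀ φ₀)} (ha : ∀ ω ∈ A, ∀ ω' ∈ A, coord a ω = coord a ω')
    (hb : ∀ ω ∈ A, ∀ ω' ∈ A, coord b ω = coord b ω')
    (hc' : ∀ ω ∈ A, ∀ ω' ∈ A, coord c ω = coord c ω') : (coord d '' A).encard ≤ q := by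
  classical
  rcases A.eq_empty_or_nonempty with rfl | ⟨ω₁, hω₁⟩
  · simp
  have hface (x y z : Coweight) (ω : Omega₀ φ₀) :
      (coordChart ω).face {x, y, z} = {coord x ω, coord y ω, coord z ω} := by
    ext v
    simp [ApartmentChart.face, coord]
  have hface' (x y : Coweight) (ω : Omega₀ φ₀) :
      (coordChart ω).face {x, y} = {coord x ω, coord y ω} := by
    ext v
    simp [ApartmentChart.face, coord]
  obtain ⟨hab, had, hbd⟩ := hd.ne
  have hda := had.symm
  have hdb := hbd.symm
  have he : ({a, b} : Finset Coweight) ∈ coxeterComplex :=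
    ⟨⟨a, by simp⟩, _, hd, by intro; simp; tauto⟩
  have hq := X.card_chambers _ ((coordChart ω₁).face_mem he)
    (by rw [ApartmentChart.card_face, Finset.card_pair hab])
  rw [hface'] at hq
  set T := {t : Finset V | t ∈ X.complex ∧ t.card = 3 ∧ {coord a ω₁, coord b ω₁} ⊆ t} with hT
  have hTmem {x : Coweight} (hx : IsChamber {a, b, x}) (ω : Omega₀ φ₀) (hω : ω ∈ A) :
      {coord a ω₁, coord b ω₁, coord x ω} ∈ T := by
    refine ⟨?_, ?_, ?_⟩
    · rw [ha ω₁ hω₁ ω hω, hb ω₁ hω₁ ω hω, ← hface]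
      exact ApartmentChart.face_mem _ hx.mem
    · rw [ha ω₁ hω₁ ω hω, hb ω₁ hω₁ ω hω, ← hface, ApartmentChart.card_face, hx.card]
    · intro v; simp only [Finset.mem_insert, Finset.mem_singleton]; tauto
  have hnot (ω : Omega₀ φ₀) (hω : ω ∈ A) {v : V} {x : Coweight} (hx : d ≠ x)
      (hv : ∀ ω' ∈ A, coord x ω' = v) : coord d ω ≠ v := by
    rw [← hv ω hω]
    exact coord_ne hx ω
  have hda' (ω : Omega₀ φ₀) (hω : ω ∈ A) := hnot ω hω hda fun ω' hω' => ha ω' hω' ω₁ hω₁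
  have hdb' (ω : Omega₀ φ₀) (hω : ω ∈ A) := hnot ω hω hdb fun ω' hω' => hb ω' hω' ω₁ hω₁
  have hdc' (ω : Omega₀ φ₀) (hω : ω ∈ A) := hnot ω hω hcd.symm fun ω' hω' => hc' ω' hω' ω₁ hω₁
  have hinj : Set.InjOn (fun z => ({coord a ω₁, coord b ω₁, z} : Finset V)) (coord d '' A) := by
    rintro _ ⟨ω, hω, rfl⟩ _ ⟨ω', hω', rfl⟩ e
    dsimp only at e
    have h1 : coord d ω ∈ ({coord a ω₁, coord b ω₁, coord d ω'} : Finset V) := by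
      rw [← e]; simp
    simpa [hda' ω hω, hdb' ω hω] using h1
  -- The fixed chamber on the edge is never attained, which lowers `q + 1` to `q`.
  have hsub : (fun z => ({coord a ω₁, coord b ω₁, z} : Finset V)) '' (coord d '' A) ⊆
      T \ {{coord a ω₁, coord b ω₁, coord c ω₁}} := by
    rintro _ ⟨_, ⟨ω, hω, rfl⟩, rfl⟩
    refine ⟨hTmem hd ω hω, fun e => ?_⟩
    have h1 : coord d ω ∈ ({coord a ω₁, coord b ω₁, coord c ω₁} : Finset V) := by
      rw [← show _ = _ from e]; simp
    simp [hda' ω hω, hdb' ω hω, hdc' ω hω] at h1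
  rw [← hinj.encard_image]
  refine (Set.encard_le_encard hsub).trans ?_
  have hTfin : T.Finite := Set.finite_of_ncard_pos (by rw [hq]; lia)
  rw [Set.encard_sdiff_singleton_of_mem (hTmem hc ω₁ hω₁), ← hTfin.cast_ncard_eq, hq]
  norm_cast

/-- The vertices of two adjacent chambers, of which one is not fixed, determine the edge between
them. -/
theorem coord_eq_of_adjacent {x y z w : Coweight} (h₁ : IsChamber {x, y, w})
    (h₂ : IsChamber {y, z, w}) (hxz : x ≠ z) (htype : z.vertexType = x.vertexType)
    {ω ω' : Omega₀ φ₀} (hx : coord x ω = coord x ω') (hy : coord y ω = coord y ω')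
    (hz : coord z ω = coord z ω') : coord w ω = coord w ω' := by
  obtain ⟨hxy, hxw, hyw⟩ := h₁.ne
  obtain ⟨t₁, ht₁, hm₁⟩ := exists_simplex_coord h₁.mem ω
  obtain ⟨t₂, ht₂, hm₂⟩ := exists_simplex_coord h₂.mem ω'
  obtain ⟨t₃, ht₃, hm₃⟩ := exists_simplex_coord h₂.mem ω
  obtain ⟨t₄, ht₄, hm₄⟩ := exists_simplex_coord h₁.mem ω'
  refine (eq_or_eq_of_four_cycle (X := X) (y := coord y ω) (x := coord x ω) (z := coord z ω)
    ⟨t₁, ht₁, hm₁ y (by simp), hm₁ x (by simp), hm₁ w (by simp)⟩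
    ⟨t₂, ht₂, by rw [hy]; exact hm₂ y (by simp), by rw [hz]; exact hm₂ z (by simp),
      hm₂ w (by simp)⟩
    ⟨t₃, ht₃, hm₃ z (by simp), hm₃ w (by simp)⟩
    ⟨t₄, ht₄, by rw [hx]; exact hm₄ x (by simp), hm₄ w (by simp)⟩
    (by rw [typ_coord, typ_coord, htype]) (by rw [typ_coord, typ_coord])
    (typ_coord_ne h₁.mem (by simp) (by simp) hxy.symm _ _)
    (typ_coord_ne h₁.mem (by simp) (by simp) hyw _ _)
    (typ_coord_ne h₁.mem (by simp) (by simp) hxw _ _)).resolve_left (coord_ne hxz ω)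

theorem coord_eq_or_eq {x w y : Coweight} (h : IsChamber {x, w, y}) (hyx : y ≤ x) (hyw : y ≤ w)
    {a b c d : Omega₀ φ₀} (hab : coord x a = coord x b) (hcd : coord x c = coord x d)
    (hac : coord w a = coord w c) (hbd : coord w b = coord w d) :
    coord x a = coord x c ∨ coord w a = coord w b := by
  obtain ⟨hxw, hxy, hwy⟩ := h.ne
  obtain ⟨ta, hta, ha⟩ := exists_simplex_coord h.mem a
  obtain ⟨tb, htb, hb⟩ := exists_simplex_coord h.mem b
  obtain ⟨tc, htc, hc⟩ := exists_simplex_coord h.mem c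
  obtain ⟨td, htd, hd⟩ := exists_simplex_coord h.mem d
  have had : coord y a = coord y d :=
    (coord_eq_of_le hyx hab).trans (coord_eq_of_le hyw hbd)
  exact eq_or_eq_of_four_cycle (X := X) (y := coord y a) (x := coord x a) (z := coord x c)
    (w := coord w a) (w' := coord w b)
    ⟨ta, hta, ha y (by simp), ha x (by simp), ha w (by simp)⟩
    ⟨td, htd, by rw [had]; exact hd y (by simp), by rw [hcd]; exact hd x (by simp),
      by rw [hbd]; exact hd w (by simp)⟩
    ⟨tc, htc, hc x (by simp), by rw [hac]; exact hc w (by simp)⟩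
    ⟨tb, htb, by rw [hab]; exact hb x (by simp), hb w (by simp)⟩
    (by rw [typ_coord, typ_coord]) (by rw [typ_coord, typ_coord])
    (typ_coord_ne h.mem (by simp) (by simp) hxy.symm _ _)
    (typ_coord_ne h.mem (by simp) (by simp) hwy.symm _ _)
    (typ_coord_ne h.mem (by simp) (by simp) hxw _ _)

theorem vertexType_eq_of_dvd {p p' : Coweight} (h : 3 ∣ p'.1 - p'.2 - (p.1 - p.2)) :
    p.vertexType = p'.vertexType :=
  (ZMod.intCast_eq_intCast_iff_dvd_sub _ _ 3).2 h

theorem isChamber_down (i j : ℤ) : IsChamber {(i - 1, j), (i, j - 1), (i, j)} :=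
  ⟨(i, j), Or.inr (by
    ext ⟨c, d⟩
    simp only [fund₁, fund₂, Finset.mem_insert, Finset.mem_singleton, Prod.mk_sub_mk,
      Prod.mk.injEq]
    lia)⟩

theorem isChamber_up' (i j : ℤ) : IsChamber {(i - 1, j), (i, j - 1), (i - 1, j - 1)} :=
  ⟨(i - 1, j - 1), Or.inl (by
    ext ⟨c, d⟩
    simp only [fund₁, fund₂, Finset.mem_insert, Finset.mem_singleton, Prod.mk_add_mk,
      Prod.mk.injEq]
    lia)⟩

end TriangleBuilding

end

/-! ### The conditional expectations as projections of the coordinate system. -/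

noncomputable section

namespace TriangleBuilding

open Coweight

variable {V : Type u} {q : ℕ} {X : TriangleBuilding V q} {φ₀ : X.Chart}
  {π : Measure (Omega₀ φ₀)}

/-- The coordinates on `Ω₀` form a system with uniform branching. -/
def coordSystem (hπ : IsBoundaryMeasure φ₀ π) : CoordSystem V π q where
  X i j := coord (i, j)
  pos := pos_of_chart φ₀
  measurableSet_fiber i j v := measurableSet_coord (i, j) v
  measure_ne_top i j v := measure_coord_ne_top hπ (i, j) v
  measureReal_fiber i j ω := measureReal_coord hπ (i, j) ω
  countable_range i j := countable_range_coord hπ (i, j)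
  det_left {i j _ _} h := coord_eq_of_le (p := (i, j)) (r := (i - 1, j))
    ⟨sub_le_self _ zero_le_one, le_rfl⟩ h
  det_right {i j _ _} h := coord_eq_of_le (p := (i, j)) (r := (i, j - 1))
    ⟨le_rfl, sub_le_self _ zero_le_one⟩ h
  encard_right_le i j v := by
    have h {p : Coweight} (hp : p ≤ (i - 1, j)) (ω : Omega₀ φ₀) (hω : coord (i - 1, j) ω = v)
        (ω' : Omega₀ φ₀) (hω' : coord (i - 1, j) ω' = v) : coord p ω = coord p ω' :=
      coord_eq_of_le hp (hω.trans hω'.symm)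
    refine encard_coord_le (a := (i - 1, j)) (b := (i - 1, j - 1)) (c := (i - 1 - 1, j)) ?_ ?_ ?_
      (h le_rfl) (h ⟨le_rfl, sub_le_self _ zero_le_one⟩) (h ⟨sub_le_self _ zero_le_one, le_rfl⟩)
    · refine ⟨(i - 1, j), Or.inr ?_⟩
      ext ⟨c, d⟩
      simp only [fund₁, fund₂, Finset.mem_insert, Finset.mem_singleton, Prod.mk_sub_mk,
        Prod.mk.injEq]
      lia
    · refine ⟨(i - 1, j - 1), Or.inl ?_⟩
      ext ⟨c, d⟩
      simp only [fund₁, fund₂, Finset.mem_insert, Finset.mem_singleton, Prod.mk_add_mk,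
        Prod.mk.injEq]
      lia
    · simp only [ne_eq, Prod.mk.injEq]; lia
  encard_left_le i j v := by
    have h {p : Coweight} (hp : p ≤ (i, j - 1)) (ω : Omega₀ φ₀) (hω : coord (i, j - 1) ω = v)
        (ω' : Omega₀ φ₀) (hω' : coord (i, j - 1) ω' = v) : coord p ω = coord p ω' :=
      coord_eq_of_le hp (hω.trans hω'.symm)
    refine encard_coord_le (a := (i, j - 1)) (b := (i - 1, j - 1)) (c := (i, j - 1 - 1)) ?_ ?_ ?_
      (h le_rfl) (h ⟨sub_le_self _ zero_le_one, le_rfl⟩) (h ⟨le_rfl, sub_le_self _ zero_le_one⟩)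
    · refine ⟨(i, j - 1), Or.inr ?_⟩
      ext ⟨c, d⟩
      simp only [fund₁, fund₂, Finset.mem_insert, Finset.mem_singleton, Prod.mk_sub_mk,
        Prod.mk.injEq]
      lia
    · refine ⟨(i - 1, j - 1), Or.inl ?_⟩
      ext ⟨c, d⟩
      simp only [fund₁, fund₂, Finset.mem_insert, Finset.mem_singleton, Prod.mk_add_mk,
        Prod.mk.injEq]
      lia
    · simp only [ne_eq, Prod.mk.injEq]; lia
  encard_top_le i j v w := by
    refine encard_coord_le (isChamber_up' i j) (isChamber_down i j) ?_
      (fun ω hω ω' hω' => hω.1.trans hω'.1.symm) (fun ω hω ω' hω' => hω.2.trans hω'.2.symm)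
      (fun ω hω ω' hω' => coord_eq_of_le (p := (i - 1, j)) (r := (i - 1, j - 1))
        ⟨le_rfl, sub_le_self _ zero_le_one⟩ (hω.1.trans hω'.1.symm))
    simp only [ne_eq, Prod.mk.injEq]; lia
  det_of_right {i j ω ω'} h1 h2 h3 := by
    refine coord_eq_of_adjacent (isChamber_down i j) ?_ ?_ (vertexType_eq_of_dvd ⟨-1, ?_⟩) h1 h2 h3
    · refine ⟨(i, j - 1), Or.inl ?_⟩
      ext ⟨c, d⟩
      simp only [fund₁, fund₂, Finset.mem_insert, Finset.mem_singleton, Prod.mk_add_mk,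
        Prod.mk.injEq]
      lia
    · simp only [ne_eq, Prod.mk.injEq]; lia
    · ring
  det_of_left {i j ω ω'} h1 h2 h3 := by
    refine coord_eq_of_adjacent (x := (i, j - 1)) (y := (i - 1, j)) (z := (i - 1, j + 1)) ?_ ?_ ?_
      (vertexType_eq_of_dvd ⟨1, ?_⟩) h2 h1 h3
    · rw [Finset.insert_comm]; exact isChamber_down i j
    · refine ⟨(i - 1, j), Or.inl ?_⟩
      ext ⟨c, d⟩
      simp only [fund₁, fund₂, Finset.mem_insert, Finset.mem_singleton, Prod.mk_add_mk,
        Prod.mk.injEq]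
      lia
    · simp only [ne_eq, Prod.mk.injEq]; lia
    · ring
  no_four_cycle {i j a b c d} h1 h2 h3 h4 :=
    coord_eq_or_eq (isChamber_up' i j) ⟨le_rfl, sub_le_self _ zero_le_one⟩
      ⟨sub_le_self _ zero_le_one, le_rfl⟩ h1 h2 h3 h4

/-- Along a chain of coweights two generating events are nested or disjoint, so they form a
π-system. Constant chains give 𝔼_p, rows and columns give the limit σ-fields. -/
theorem condE_eq_spanProj_of_monotone (hπ : IsBoundaryMeasure φ₀ π) {s : ℤ → Coweight}
    (hs : Monotone s) (hm : (⨆ n, filt φ₀ (s n)) ≤ filtTop φ₀) :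
    condE π hm =
      spanProj (⋃ n, Set.range fun v => ind π (coord (φ₀ := φ₀) (s n) ⁻¹' {v})) := by
  have hspan : Submodule.span ℂ (ind π '' ⋃ n, gens φ₀ (s n)) =
      Submodule.span ℂ (⋃ n, Set.range fun v => ind π (coord (φ₀ := φ₀) (s n) ⁻¹' {v})) := by
    refine le_antisymm (Submodule.span_mono ?_) (Submodule.span_le.2 ?_)
    · rintro _ ⟨A, hA, rfl⟩
      obtain ⟨n, hA⟩ := Set.mem_iUnion.1 hA
      obtain ⟨ω, rfl⟩ := (mem_gens hπ).1 hA
      exact Set.mem_iUnion.2 ⟨n, _, rfl⟩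
    · rintro _ hf
      obtain ⟨n, v, rfl⟩ := Set.mem_iUnion.1 hf
      dsimp only
      rcases (coord (φ₀ := φ₀) (s n) ⁻¹' {v}).eq_empty_or_nonempty with h | ⟨ω, rfl⟩
      · rw [h, ind_empty]; exact Submodule.zero_mem _
      · exact Submodule.subset_span ⟨_, Set.mem_iUnion.2 ⟨n, (mem_gens hπ).2 ⟨ω, rfl⟩⟩, rfl⟩
  refine condE_eq_spanProj hm ?_
  rw [← hspan]
  refine lpMeas_eq_closedSpan π hm ?_ ?_ ?_ ?_
  · exact MeasurableSpace.iSup_generateFrom _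
  · intro A hA B hB hAB
    obtain ⟨n, hA⟩ := Set.mem_iUnion.1 hA
    obtain ⟨k, hB⟩ := Set.mem_iUnion.1 hB
    obtain ⟨ω, rfl⟩ := (mem_gens hπ).1 hA
    obtain ⟨ω', rfl⟩ := (mem_gens hπ).1 hB
    obtain ⟨η, hη, hη'⟩ := hAB
    rcases le_total n k with hnk | hnk
    · rw [Set.inter_eq_right.2]
      · exact Set.mem_iUnion.2 ⟨k, hB⟩
      · intro ξ hξ
        exact (coord_eq_of_le (hs hnk) (hξ.trans hη'.symm)).trans hη
    · rw [Set.inter_eq_left.2]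
      · exact Set.mem_iUnion.2 ⟨n, hA⟩
      · intro ξ hξ
        exact (coord_eq_of_le (hs hnk) (hξ.trans hη.symm)).trans hη'
  · intro A hA
    obtain ⟨n, hA⟩ := Set.mem_iUnion.1 hA
    obtain ⟨ω, rfl⟩ := (mem_gens hπ).1 hA
    exact measure_coord_ne_top hπ _ _
  · refine ⟨(fun v => coord (s 0) ⁻¹' {v}) '' Set.range (coord (s 0)), ?_,
      (countable_range_coord hπ (s 0)).image _, ?_⟩
    · rintro _ ⟨_, ⟨ω, rfl⟩, rfl⟩
      exact Set.mem_iUnion.2 ⟨0, (mem_gens hπ).2 ⟨ω, rfl⟩⟩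
    · exact Set.eq_univ_of_forall fun ω => ⟨_, ⟨_, ⟨ω, rfl⟩, rfl⟩, rfl⟩

theorem condE_congr {α : Type u} {m m' m0 : MeasurableSpace α} {π : Measure α} (h : m = m')
    (hm : m ≤ m0) : condE π hm = condE π (h ▸ hm) := by
  subst h; rfl

theorem expect_eq (hπ : IsBoundaryMeasure φ₀ π) (p : Coweight) :
    expect π p = (coordSystem hπ).projectionField.P p.1 p.2 := by
  have h := condE_eq_spanProj_of_monotone hπ (s := fun _ => p) monotone_const
    (iSup_le fun _ => filt_le φ₀ p)
  rw [Set.iUnion_const] at h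
  exact (condE_congr iSup_const.symm _).trans h

theorem condE_filtL_eq (hπ : IsBoundaryMeasure φ₀ π) (i : ℤ) :
    condE π (filtL_le φ₀ i) = (coordSystem hπ).projectionField.M i :=
  condE_eq_spanProj_of_monotone hπ (s := fun j => (i, j)) (fun _ _ h => ⟨le_rfl, h⟩) _

theorem condE_filtR_eq (hπ : IsBoundaryMeasure φ₀ π) (j : ℤ) :
    condE π (filtR_le φ₀ j) = (coordSystem hπ).projectionField.N j :=
  condE_eq_spanProj_of_monotone hπ (s := fun i => (i, j)) (fun _ _ h => ⟨h, le_rfl⟩) _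

theorem smallD_eq (hπ : IsBoundaryMeasure φ₀ π) (p : Coweight) :
    smallD π p = (coordSystem hπ).projectionField.d p.1 p.2 := by
  simp only [smallD, expect_eq hπ, ProjectionField.d, fund₁, fund₂, Prod.fst_sub, Prod.snd_sub,
    sub_zero]

theorem bigD_eq (hπ : IsBoundaryMeasure φ₀ π) (p : Coweight) :
    bigD π p =
      ((coordSystem hπ).projectionField.M p.1 - (coordSystem hπ).projectionField.M (p.1 - 1)) *
      ((coordSystem hπ).projectionField.N p.2 - (coordSystem hπ).projectionField.N (p.2 - 1)) := by
  rw [bigD, diffL, diffR, condE_filtL_eq hπ, condE_filtL_eq hπ, condE_filtR_eq hπ,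
    condE_filtR_eq hπ]
  rfl

end TriangleBuilding

/-! ### Powers of `d` and the final estimates. -/

namespace ProjectionField

variable {A : Type*} [NormedRing A] [StarRing A] [CStarRing A] {t : ℝ}
  (S : ProjectionField A t)

theorem norm_d_pow_le [NormedSpace ℝ A] (k : ℕ) (i j : ℤ) {x : A} : ‖S.d i j ^ k * x‖ ≤ ‖x‖ := by
  induction k with
  | zero => simp
  | succ k ih =>
    rw [pow_succ', mul_assoc]
    refine (norm_mul_le _ _).trans ?_
    exact (mul_le_of_le_one_left (norm_nonneg _) (S.norm_d_le i j)).trans ih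

theorem norm_mul_d_pow_le [NormedSpace ℝ A] (k : ℕ) (i j : ℤ) {x : A} :
    ‖x * S.d i j ^ k‖ ≤ ‖x‖ := by
  induction k with
  | zero => simp
  | succ k ih =>
    rw [pow_succ, ← mul_assoc]
    refine (norm_mul_le _ _).trans ?_
    exact (mul_le_of_le_one_right (norm_nonneg _) (S.norm_d_le i j)).trans ih

theorem norm_mul_sub_proj_le {p r : A} (hp : IsStarProjection p) (hr : IsStarProjection r) (x : A) :
    ‖x * (p - r)‖ ≤ 2 * ‖x‖ := by
  have h := norm_sub_proj_le hp hr (star x)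
  rwa [← hp.isSelfAdjoint.star_eq, ← hr.isSelfAdjoint.star_eq, ← star_sub, ← star_mul,
    norm_star, norm_star] at h

/-- One factor `d` is spent on the left or on the right difference operators. The opposite pair
costs at most 4, so each way gives the constant `4 * 8 = 32`, and the two bounds are combined by
their geometric mean. -/
theorem norm_diff_mul_d_pow_mul_diff [NormedSpace ℝ A] (ht : 0 ≤ t) (ht1 : t ≤ 1) {m : ℕ}
    (hm : 1 ≤ m) (a b c d i j : ℤ) :
    ‖(S.M a - S.M (a - 1)) * (S.N b - S.N (b - 1)) * S.d i j ^ m *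
      ((S.M c - S.M (c - 1)) * (S.N d - S.N (d - 1)))‖ ≤
      32 * √(t ^ (max |i - a| |j - b|).toNat * t ^ (max |i - c| |j - d|).toNat) := by
  obtain ⟨k, rfl⟩ := Nat.exists_eq_add_of_le' hm
  set x := (S.M a - S.M (a - 1)) * (S.N b - S.N (b - 1)) with hx
  set y := (S.M c - S.M (c - 1)) * (S.N d - S.N (d - 1)) with hy
  have right (z : A) : ‖z * y‖ ≤ 4 * ‖z‖ := by
    rw [hy, ← mul_assoc]
    have h1 := norm_mul_sub_proj_le (S.isProj_N d) (S.isProj_N (d - 1)) (z * (S.M c - S.M (c - 1)))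
    have h2 := norm_mul_sub_proj_le (S.isProj_M c) (S.isProj_M (c - 1)) z
    linarith
  have left (z : A) : ‖x * z‖ ≤ 4 * ‖z‖ := by
    rw [hx, mul_assoc]
    have h1 := norm_sub_proj_le (S.isProj_M a) (S.isProj_M (a - 1)) ((S.N b - S.N (b - 1)) * z)
    have h2 := norm_sub_proj_le (S.isProj_N b) (S.isProj_N (b - 1)) z
    linarith
  have h1 : ‖x * S.d i j ^ (k + 1) * y‖ ≤ 32 * t ^ (max |i - a| |j - b|).toNat := by
    have h := S.norm_diff_mul_diff_mul_d ht ht1 a b i j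
    rw [← mul_assoc, ← hx] at h
    rw [pow_succ', ← mul_assoc x]
    linarith [right (x * S.d i j * S.d i j ^ k), S.norm_mul_d_pow_le k i j (x := x * S.d i j)]
  have h2 : ‖x * S.d i j ^ (k + 1) * y‖ ≤ 32 * t ^ (max |i - c| |j - d|).toNat := by
    have h := S.norm_d_mul_diff_mul_diff ht ht1 c d i j
    rw [pow_succ, mul_assoc x, mul_assoc (_ ^ k)]
    linarith [left (S.d i j ^ k * (S.d i j * y)), S.norm_d_pow_le k i j (x := S.d i j * y)]
  rw [← div_le_iff₀' (by norm_num)] at h1 h2 ⊢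
  refine Real.le_sqrt_of_sq_le ?_
  rw [sq]
  exact mul_le_mul h1 h2 (by positivity) (by positivity)

theorem norm_d_pow_mul_d_pow [NormedSpace ℝ A] (ht : 0 ≤ t) {m : ℕ} (hm : 1 ≤ m) (a b i j : ℤ) :
    ‖S.d a b ^ m * S.d i j ^ m‖ ≤ 8 * t ^ (max |a - i| |b - j|).toNat := by
  obtain ⟨k, rfl⟩ := Nat.exists_eq_add_of_le' hm
  rw [pow_succ, pow_succ' (S.d i j), mul_assoc, ← mul_assoc (S.d a b)]
  exact (S.norm_d_pow_le k a b).trans ((S.norm_mul_d_pow_le k i j).trans (S.norm_d_mul_d ht a b i j))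

end ProjectionField

theorem sqrt_inv_pow_toNat {q : ℝ} (hq : 0 ≤ q) {n : ℤ} (hn : 0 ≤ n) :
    √q⁻¹ ^ n.toNat = q ^ (-(n : ℝ) / 2) := by
  have h : ((n.toNat : ℕ) : ℝ) = n := by exact_mod_cast Int.toNat_of_nonneg hn
  rw [Real.sqrt_eq_rpow, ← Real.rpow_natCast, ← Real.rpow_mul (inv_nonneg.2 hq), h,
    Real.inv_rpow hq, ← Real.rpow_neg hq]
  congr 1; ring

theorem Coweight.size_nonneg (p : Coweight) : 0 ≤ p.size := le_max_of_le_left (abs_nonneg _)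

end

theorem mainTheorem8 :
    ∃ C : ℝ, 0 < C ∧
      ∀ (V : Type u) (q : ℕ) (X : TriangleBuilding V q) (φ₀ : X.Chart)
        (π : Measure (TriangleBuilding.Omega₀ φ₀)),
        TriangleBuilding.IsBoundaryMeasure φ₀ π →
        ∀ (l l' μ : Coweight) (m : ℕ), 1 ≤ m →
          ‖TriangleBuilding.bigD π l * TriangleBuilding.smallD π μ ^ m *
              TriangleBuilding.bigD π l'‖ ≤
            C * (q : ℝ) ^ (-((μ - l).size : ℝ) / 4) * (q : ℝ) ^ (-((μ - l').size : ℝ) / 4) ∧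
          ‖TriangleBuilding.smallD π l ^ m * TriangleBuilding.smallD π μ ^ m‖ ≤
            C * (q : ℝ) ^ (-((l - μ).size : ℝ) / 2) := by
  refine ⟨32, by norm_num, fun V q X φ₀ π hπ l l' μ m hm => ?_⟩
  have hq : 0 < q := TriangleBuilding.pos_of_chart φ₀
  have ht : 0 ≤ √((q : ℝ)⁻¹) := Real.sqrt_nonneg _
  have ht1 : √((q : ℝ)⁻¹) ≤ 1 := Real.sqrt_le_one.2 (inv_le_one_of_one_le₀ (by exact_mod_cast hq))
  have hpow (p : Coweight) : √((q : ℝ)⁻¹) ^ p.size.toNat = (q : ℝ) ^ (-(p.size : ℝ) / 2) :=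
    sqrt_inv_pow_toNat q.cast_nonneg p.size_nonneg
  have hsqrt (p : Coweight) :
      √((q : ℝ) ^ (-(p.size : ℝ) / 2)) = (q : ℝ) ^ (-(p.size : ℝ) / 4) := by
    rw [Real.sqrt_eq_rpow, ← Real.rpow_mul q.cast_nonneg]
    congr 1; ring
  have hnonneg (p : Coweight) : 0 ≤ (q : ℝ) ^ (-(p.size : ℝ) / 2) :=
    Real.rpow_nonneg q.cast_nonneg _
  simp only [TriangleBuilding.bigD_eq hπ, TriangleBuilding.smallD_eq hπ]
  set S := (TriangleBuilding.coordSystem hπ).projectionField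
  constructor
  · have h := S.norm_diff_mul_d_pow_mul_diff ht ht1 hm l.1 l.2 l'.1 l'.2 μ.1 μ.2
    have e (p : Coweight) : max |μ.1 - p.1| |μ.2 - p.2| = (μ - p).size := rfl
    -- With `t = q^(-1/2)` the square root of the mean turns exponents 1/2 into 1/4.
    rw [e, e, hpow, hpow, Real.sqrt_mul (hnonneg _), hsqrt, hsqrt] at h
    rwa [mul_assoc (32 : ℝ)]
  · have h := S.norm_d_pow_mul_d_pow ht hm l.1 l.2 μ.1 μ.2
    have e : max |l.1 - μ.1| |l.2 - μ.2| = (l - μ).size := rfl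
    rw [e, hpow] at h
    exact h.trans (by gcongr; norm_num)
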